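/- **Theorem 1.4 (weak comparison principle in small domains).** Let $N\ge 2$, let $\Omega\subset\mathbb R^N$ be open and let $0<\alpha\le 1$. Let $A:(0,\infty)\to(0,\infty)$ be of class $C^1$ and satisfy * (hpA1) $\limsup_{t\to0^+}tA(t)<\infty$; * (hpA2) $-1<\inf_{t>0}\frac{tA'(t)}{A(t)}$ and $\sup_{t>0}\frac{tA'(t)}{A(t)}<\infty$; * (hpA3) there are $\tilde\vartheta\ge0$ and $K>0$ with $A(t)\ge Kt^{\tilde\vartheta}$ for all $t>0$; * (hpA4) either $A$ is nondecreasing, or $t\mapsto tA(t)$ is nondecreasing and for every compact $\mathcal K\subset[0,\infty)$ there is $\tau>0$ with $A(t)\ge\tau$ for all $t\in\mathcal K$, $t>0$. Let $B:[0,\infty)\to[0,\infty)$ be of class $C^1$ with (hpB1) $B(0)=0$ and (hpB3) $B'(t)\le\hat C\,tA(t)$ for all $t>0$, for some $\hat C>0$. Let $f:\mathbb R\to\mathbb R$ be locally Lipschitz with $f(s)>0$ for $s>0$. Let $u,v\in C^{1,\alpha}(\Omega)$ (that is, $C^1$ in $\Omega$ with gradient $\alpha$-Hölder on compact subsets), with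 $u$ of class $C^2$ on $\{x\in\Omega:\nabla u\ne0\}$ and $v$ of class $C^2$ on $\{x\in\Omega:\nabla v\neq0\}$, be weak solutions of $$-\operatorname{div}(A(|\nabla w|)\nabla w)+B(|\nabla w|)=f(w)\quad\text{in }\Omega ,$$ that is, for $w=u$ and for $w=v$, $$\int_\Omega A(|\nabla w|)(\nabla w,\nabla\psi)\,dx+\int_\Omega B(|\nabla w|)\psi\,dx=\int_\Omega f(w)\psi\,dx\qquad\text{for all }\psi\in C_c^\infty(\Omega),$$ where $A(|\nabla w|)\nabla w:=0$ at points with $\nabla w=0$. Assume $u>0$ in $\Omega$. Then: 1. For every compact $K\subset\Omega$ there is $\delta>0$ such that, for every open $\Omega'\subset K$ with $|\Omega'|\le\delta$ and $u\le v$ on $\partial\Omega'$, one has $u\le v$ in $\Omega'$. 2. Suppose that $\Omega$ is bounded, that $u,v\in C^{1,\alpha}(\overline\Omega)$ (that is, $u,v$ are continuous on $\overline\Omega$, $C^1$ in $\Omega$, and their gradients are $\alpha$-Hölder on $\Omega$), and that there is no point of $\partial\Omega$ at which $u$ and the continuous extension of $\nabla u$ both vanish. Then there is $\delta>0$ such that,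 for every open $\Omega'\subset\Omega$ with $|\Omega'|\le\delta$ and $u\le v$ on $\partial\Omega'$, one has $u\le v$ in $\Omega'$. -/

import Mathlib

open MeasureTheory Filter Topology Set
open scoped NNReal ContDiff

/-- `A : (0,∞) → (0,∞)` of class `C¹` with the growth and ellipticity conditions; the value of `A`
outside `(0,∞)` is irrelevant. -/
structure OperatorA (A : ℝ → ℝ) : Prop where
  pos : ∀ t : ℝ, 0 < t → 0 < A t
  contDiffOn : ContDiffOn ℝ 1 A (Ioi 0)
  /-- `limsup_{t → 0⁺} t A(t) < ∞` -/
  limsup_lt : limsup (fun t : ℝ => ((t * A t : ℝ) : EReal)) (𝓝[>] 0) < ⊤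
  /-- `-1 < inf_{t > 0} t A'(t) / A(t)` -/
  lower : ∃ m : ℝ, -1 < m ∧ ∀ t : ℝ, 0 < t → m ≤ t * deriv A t / A t
  /-- `sup_{t > 0} t A'(t) / A(t) < ∞` -/
  upper : ∃ M : ℝ, ∀ t : ℝ, 0 < t → t * deriv A t / A t ≤ M
  /-- `A(t) ≥ K t ^ θ` -/
  power : ∃ θ K : ℝ, 0 ≤ θ ∧ 0 < K ∧ ∀ t : ℝ, 0 < t → K * t ^ θ ≤ A t
  /-- `A` is increasing, or `A` is bounded below by a positive constant on each compact subset of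
  `[0,∞)` (at the points where `A` is defined) and `t ↦ t A(t)` is increasing -/
  monotone : MonotoneOn A (Ioi 0) ∨
    ((∀ S : Set ℝ, IsCompact S → S ⊆ Ici 0 → ∃ τ : ℝ, 0 < τ ∧ ∀ t ∈ S, 0 < t → τ ≤ A t) ∧
      MonotoneOn (fun t : ℝ => t * A t) (Ioi 0))

/-- `B : [0,∞) → [0,∞)` of class `C¹` with `B(0) = 0` and `B'(t) ≤ C t A(t)` for `t > 0`. -/
structure OperatorB (A B : ℝ → ℝ) : Prop where
  nonneg : ∀ t : ℝ, 0 ≤ t → 0 ≤ B t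
  contDiffOn : ContDiffOn ℝ 1 B (Ici 0)
  zero : B 0 = 0
  deriv_le : ∃ C : ℝ, 0 < C ∧ ∀ t : ℝ, 0 < t → deriv B t ≤ C * (t * A t)

/-- `u ∈ C^{1,α}(Ω)`, `Ω` open: `u` is `C¹` in `Ω` and `∇u` is `α`-Hölder on compact subsets. -/
def IsC1Holder {N : ℕ} (α : ℝ≥0) (Ω : Set (EuclideanSpace ℝ (Fin N)))
    (u : EuclideanSpace ℝ (Fin N) → ℝ) : Prop :=
  ContDiffOn ℝ 1 u Ω ∧
    ∀ K : Set (EuclideanSpace ℝ (Fin N)), IsCompact K → K ⊆ Ω →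
      ∃ C : ℝ≥0, HolderOnWith C α (gradient u) K

/-- `u ∈ C^{1,α}(closure Ω)`, `Ω` open and bounded: `u` is continuous on the closure, `C¹` in `Ω`,
and `∇u` is `α`-Hölder on `Ω` (so that `∇u` extends continuously to the closure). -/
def IsC1HolderClosure {N : ℕ} (α : ℝ≥0) (Ω : Set (EuclideanSpace ℝ (Fin N)))
    (u : EuclideanSpace ℝ (Fin N) → ℝ) : Prop :=
  ContinuousOn u (closure Ω) ∧ ContDiffOn ℝ 1 u Ω ∧
    ∃ C : ℝ≥0, HolderOnWith C α (gradient u) Ω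

/-- The critical set `Z_u = {∇u = 0}`. -/
def criticalSet {N : ℕ} (u : EuclideanSpace ℝ (Fin N) → ℝ) : Set (EuclideanSpace ℝ (Fin N)) :=
  {x | gradient u x = 0}

/-- `u` is a weak solution of `-div(A(|∇u|)∇u) + B(|∇u|) = f(u)` in `Ω`. -/
def IsWeakSolution {N : ℕ} (A B f : ℝ → ℝ) (Ω : Set (EuclideanSpace ℝ (Fin N)))
    (u : EuclideanSpace ℝ (Fin N) → ℝ) : Prop :=
  ∀ ψ : EuclideanSpace ℝ (Fin N) → ℝ, ContDiff ℝ ∞ ψ → HasCompactSupport ψ → tsupport ψ ⊆ Ω →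
    (∫ x in Ω, A ‖gradient u x‖ * inner ℝ (gradient u x) (gradient ψ x)) +
      (∫ x in Ω, B ‖gradient u x‖ * ψ x) = ∫ x in Ω, f (u x) * ψ x

/-! Let `g = (u - v - k)₊` in the small domain, with `k > 0`. Testing the difference of the two
equations with `g³` bounds the energy `∫ p |∇(g²)|²` by a constant times `∫ q (g²)²` plus an error
of order `k`, where `p` comes from the monotonicity of the flux and `q` from Young's inequality
applied to the `B` and `f` terms. If `∫ q φ² ≤ κ ∫ p |∇φ|²` with `κ` small on sets of small measure,
the right side is absorbed, `∫ g⁴ = O(k)`, and `k → 0` gives `u ≤ v` (`le_of_energy_bounds`). The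
cube makes both `g³` and `φ = g²` of class `C¹`, so no Sobolev functions are needed.

If `A` is bounded below on bounded ranges, the flux is strongly monotone, `p = q = 1` works, and the
inequality is the Poincaré inequality on sets of small measure.

If `A` is nondecreasing it may degenerate at `0`; then `p = A(|∇u|)` and `q = 1 / A(θ(|∇u|))`, with
`θ` a regularization of `max t (2σ)`. The weighted inequality is extracted from the equation of `u`
itself. Near its critical set, `f(u) - B(|∇u|) ≥ c > 0`, so testing with `φ² / A(θ(|∇u|))` bounds `c
∫ q φ²` by terms in `∇φ` and `D²u`. The latter are controlled by testing the linearized equation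
with `θ'(|∇u|) φ² ∇u`, which lives away from the critical set, where `u` is `C²`. On `{|∇u| ≤ ε}`
this yields a constant `C ε²` (`hardy_near_critical`); elsewhere `A(|∇u|)` is bounded below and the
ordinary Poincaré inequality applies; cutoffs in `|∇u|` glue the two regimes
(`exists_small_domain_weighted_poincare`). All constants are independent of `σ`, which permits the
choice `σ = k`: where both gradients are below `k` the weights are not comparable, but there `|∇u -
∇v| ≤ 2k` and the loss is again of order `k`. -/

set_option linter.unusedSectionVars false

/-! ### Mollification of compactly supported `C¹` maps -/

/-- Mollification at a scale below the distance to the complement of `O` and the moduli of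
continuity of `ψ` and its derivative. `K` is fixed before `ε`, so later error integrals run over one
compact set. -/
theorem exists_contDiff_approx_of_hasCompactSupport {E F : Type*} [NormedAddCommGroup E]
    [InnerProductSpace ℝ E] [FiniteDimensional ℝ E] [MeasurableSpace E] [BorelSpace E]
    [NormedAddCommGroup F] [NormedSpace ℝ F] [CompleteSpace F]
    {O : Set E} (hO : IsOpen O) {ψ : E → F} (hψ : ContDiff ℝ 1 ψ) (hc : HasCompactSupport ψ)
    (hs : tsupport ψ ⊆ O) :
    ∃ K : Set E, IsCompact K ∧ K ⊆ O ∧ tsupport ψ ⊆ K ∧ ∀ ε : ℝ, 0 < ε → ∃ ψ' : E → F, ContDiff ℝ ∞ ψ' ∧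
      tsupport ψ' ⊆ K ∧ (∀ x, ‖ψ' x - ψ x‖ ≤ ε) ∧
      ∀ x, ‖fderiv ℝ ψ' x - fderiv ℝ ψ x‖ ≤ ε := by
  obtain ⟨r, hr, hrO⟩ := IsCompact.exists_cthickening_subset_open hc hO hs
  refine ⟨Metric.cthickening r (tsupport ψ), IsCompact.cthickening hc, hrO,
    Metric.self_subset_cthickening _, fun ε hε => ?_⟩
  have hu0 : UniformContinuous ψ := hc.uniformContinuous_of_continuous hψ.continuous
  have hcd : Continuous (fderiv ℝ ψ) := hψ.continuous_fderiv one_ne_zero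
  have hu1 : UniformContinuous (fderiv ℝ ψ) :=
    (hc.fderiv ℝ).uniformContinuous_of_continuous hcd
  obtain ⟨d0, hd0, h0⟩ := Metric.uniformContinuous_iff.1 hu0 ε hε
  obtain ⟨d1, hd1, h1⟩ := Metric.uniformContinuous_iff.1 hu1 ε hε
  set ρ := min r (min d0 d1) with hρ
  have hρ0 : 0 < ρ := lt_min hr (lt_min hd0 hd1)
  let φ : ContDiffBump (0 : E) := ⟨ρ / 2, ρ, by positivity, by linarith⟩
  have hrO' : φ.rOut = ρ := rfl
  refine ⟨MeasureTheory.convolution (φ.normed volume) ψ (ContinuousLinearMap.lsmul ℝ ℝ) volume,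
    ?_, ?_, ?_, ?_⟩
  · exact φ.hasCompactSupport_normed.contDiff_convolution_left _ φ.contDiff_normed
      hψ.continuous.locallyIntegrable
  · refine closure_minimal ?_ Metric.isClosed_cthickening
    refine (support_convolution_subset _).trans ?_
    rintro _ ⟨y, hy, z, hz, rfl⟩
    rw [φ.support_normed_eq, mem_ball_zero_iff, hrO'] at hy
    refine Metric.mem_cthickening_of_dist_le (y + z) z r _ (subset_tsupport _ hz) ?_
    simp only [dist_eq_norm, add_sub_cancel_right]
    exact hy.le.trans (min_le_left _ _)
  · intro x
    rw [← dist_eq_norm]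
    refine φ.dist_normed_convolution_le hψ.continuous.aestronglyMeasurable fun y hy => ?_
    refine (h0 (lt_of_lt_of_le hy ?_)).le
    rw [hrO']
    exact (min_le_right _ _).trans (min_le_left _ _)
  · intro x
    have hd := hc.hasFDerivAt_convolution_right (μ := volume) (ContinuousLinearMap.lsmul ℝ ℝ)
      (f := φ.normed volume) φ.continuous_normed.locallyIntegrable hψ x
    rw [hd.fderiv]
    have heq : MeasureTheory.convolution (φ.normed volume) (fderiv ℝ ψ)
        ((ContinuousLinearMap.lsmul ℝ ℝ : ℝ →L[ℝ] F →L[ℝ] F).precompR E) volume x =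
        MeasureTheory.convolution (φ.normed volume) (fderiv ℝ ψ)
        (ContinuousLinearMap.lsmul ℝ ℝ) volume x := rfl
    rw [heq, ← dist_eq_norm]
    refine φ.dist_normed_convolution_le hcd.aestronglyMeasurable fun y hy => ?_
    refine (h1 (lt_of_lt_of_le hy ?_)).le
    rw [hrO']
    exact (min_le_right _ _).trans (min_le_right _ _)

/-! ### Weak divergence identities -/

section WeakDivergence

variable {E : Type*} [NormedAddCommGroup E] [InnerProductSpace ℝ E] [FiniteDimensional ℝ E]
  [MeasurableSpace E] [BorelSpace E]

theorem integrable_of_continuousOn_of_eq_zero {F : Type*} [NormedAddCommGroup F] {K : Set E}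
    (hK : IsCompact K) {g : E → F} (hg : ContinuousOn g K) (h0 : ∀ x, x ∉ K → g x = 0) :
    Integrable g :=
  (integrableOn_iff_integrable_of_support_subset (fun x hx => by
    by_contra h
    exact hx (h0 x h))).1 (hg.integrableOn_compact hK)

/-- `-div X = h` weakly in `Ω`. -/
def WeakDiv (Ω : Set E) (X : E → E) (h : E → ℝ) : Prop :=
  ∀ ψ : E → ℝ, ContDiff ℝ ∞ ψ → HasCompactSupport ψ → tsupport ψ ⊆ Ω →
    ∫ x, fderiv ℝ ψ x (X x) = ∫ x, h x * ψ x

theorem fderiv_eq_zero_of_notMem_tsupport {F : Type*} [NormedAddCommGroup F] [NormedSpace ℝ F]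
    {ψ : E → F} {x : E} (hx : x ∉ tsupport ψ) : fderiv ℝ ψ x = 0 :=
  image_eq_zero_of_notMem_tsupport fun h => hx (tsupport_fderiv_subset ℝ h)

theorem le_zero_of_forall_le_mul {a C : ℝ} (h : ∀ ε : ℝ, 0 < ε → a ≤ ε * C) : a ≤ 0 := by
  have : Tendsto (fun ε : ℝ => ε * C) (𝓝[>] 0) (𝓝 (0 * C)) :=
    ((continuous_id.mul continuous_const).tendsto 0).mono_left nhdsWithin_le_nhds
  rw [zero_mul] at this
  exact ge_of_tendsto this (by filter_upwards [self_mem_nhdsWithin] with ε hε using h ε hε)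

/-- A bilinear first-order identity that holds for smooth test functions extends to `C¹` ones. -/
theorem integral_eq_of_smooth {O : Set E} (hO : IsOpen O) {Y : E → E} {k : E → ℝ}
    (hY : ContinuousOn Y O) (hk : ContinuousOn k O)
    (h : ∀ ψ : E → ℝ, ContDiff ℝ ∞ ψ → HasCompactSupport ψ → tsupport ψ ⊆ O →
      ∫ x, (fderiv ℝ ψ x (Y x) + k x * ψ x) = 0)
    {ψ : E → ℝ} (hψ : ContDiff ℝ 1 ψ) (hc : HasCompactSupport ψ) (hs : tsupport ψ ⊆ O) :
    ∫ x, (fderiv ℝ ψ x (Y x) + k x * ψ x) = 0 := by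
  obtain ⟨K, hK, hKO, hsK, hap⟩ := exists_contDiff_approx_of_hasCompactSupport hO hψ hc hs
  have hint : ∀ ζ : E → ℝ, ContDiff ℝ 1 ζ → tsupport ζ ⊆ K →
      Integrable (fun x => fderiv ℝ ζ x (Y x) + k x * ζ x) := fun ζ hζ hζK => by
    refine integrable_of_continuousOn_of_eq_zero hK ?_ fun x hx => ?_
    · exact ((hζ.continuous_fderiv one_ne_zero).continuousOn.clm_apply (hY.mono hKO)).add
        ((hk.mono hKO).mul hζ.continuous.continuousOn)
    · have hx' : x ∉ tsupport ζ := fun h => hx (hζK h)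
      simp [fderiv_eq_zero_of_notMem_tsupport hx', image_eq_zero_of_notMem_tsupport hx']
  have key : ∀ ε : ℝ, 0 < ε → |∫ x, (fderiv ℝ ψ x (Y x) + k x * ψ x)| ≤
      ε * ∫ x in K, (‖Y x‖ + |k x|) := fun ε hε => by
    obtain ⟨ψ', h1, h2, h3, h4⟩ := hap ε hε
    have h1' : ContDiff ℝ 1 ψ' := h1.of_le (by exact_mod_cast le_top)
    have e0 := h ψ' h1 (hK.of_isClosed_subset (isClosed_tsupport _) h2) (h2.trans hKO)
    have : ∫ x, (fderiv ℝ ψ x (Y x) + k x * ψ x) =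
        -∫ x, ((fderiv ℝ ψ' x (Y x) + k x * ψ' x) - (fderiv ℝ ψ x (Y x) + k x * ψ x)) := by
      rw [integral_sub (hint ψ' h1' h2) (hint ψ hψ hsK), e0]
      ring
    rw [this, abs_neg, ← setIntegral_eq_integral_of_forall_compl_eq_zero (s := K), ←
      integral_const_mul]
    · rw [← Real.norm_eq_abs]
      refine norm_integral_le_of_norm_le ?_ (Eventually.of_forall fun x => ?_)
      · exact (((hY.mono hKO).norm.add (hk.mono hKO).abs).integrableOn_compact hK).const_mul ε
      · have e1 : (fderiv ℝ ψ' x (Y x) + k x * ψ' x) - (fderiv ℝ ψ x (Y x) + k x * ψ x) =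
            (fderiv ℝ ψ' x - fderiv ℝ ψ x) (Y x) + k x * (ψ' x - ψ x) := by
          simp only [sub_apply]; ring
        rw [e1]
        refine (norm_add_le _ _).trans ?_
        rw [norm_mul, Real.norm_eq_abs (k x), mul_add]
        refine add_le_add (((fderiv ℝ ψ' x - fderiv ℝ ψ x).le_opNorm _).trans ?_) ?_
        · gcongr
          exact h4 x
        · rw [mul_comm]
          gcongr
          exact h3 x
    · intro x hx
      have hx1 : x ∉ tsupport ψ := fun h => hx (hsK h)
      have hx2 : x ∉ tsupport ψ' := fun h => hx (h2 h)
      simp [fderiv_eq_zero_of_notMem_tsupport hx1, image_eq_zero_of_notMem_tsupport hx1,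
        fderiv_eq_zero_of_notMem_tsupport hx2, image_eq_zero_of_notMem_tsupport hx2]
  exact abs_eq_zero.1 (le_antisymm (le_zero_of_forall_le_mul key) (abs_nonneg _))

theorem integrable_fderiv_apply {O : Set E} {Y : E → E} (hY : ContinuousOn Y O)
    {ψ : E → ℝ} (hψ : ContDiff ℝ 1 ψ) (hc : HasCompactSupport ψ) (hs : tsupport ψ ⊆ O) :
    Integrable fun x => fderiv ℝ ψ x (Y x) :=
  integrable_of_continuousOn_of_eq_zero hc
    ((hψ.continuous_fderiv one_ne_zero).continuousOn.clm_apply (hY.mono hs)) fun x hx => by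
      simp [fderiv_eq_zero_of_notMem_tsupport hx]

theorem integrable_mul_of_tsupport {O : Set E} {k : E → ℝ} (hk : ContinuousOn k O)
    {ψ : E → ℝ} (hψ : Continuous ψ) (hc : HasCompactSupport ψ) (hs : tsupport ψ ⊆ O) :
    Integrable fun x => k x * ψ x :=
  integrable_of_continuousOn_of_eq_zero hc ((hk.mono hs).mul hψ.continuousOn) fun x hx => by
    simp [image_eq_zero_of_notMem_tsupport hx]

theorem WeakDiv.integral_eq {Ω : Set E} (hΩ : IsOpen Ω) {X : E → E} {h : E → ℝ}
    (hw : WeakDiv Ω X h) (hX : ContinuousOn X Ω) (hh : ContinuousOn h Ω)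
    {ψ : E → ℝ} (hψ : ContDiff ℝ 1 ψ) (hc : HasCompactSupport ψ) (hs : tsupport ψ ⊆ Ω) :
    ∫ x, fderiv ℝ ψ x (X x) = ∫ x, h x * ψ x := by
  have := integral_eq_of_smooth hΩ hX hh.neg (fun ζ h1 h2 h3 => ?_) hψ hc hs
  · simp only [Pi.neg_apply, neg_mul, ← sub_eq_add_neg] at this
    rw [integral_sub (integrable_fderiv_apply hX hψ hc hs)
      (integrable_mul_of_tsupport hh hψ.continuous hc hs)] at this
    linarith
  · have h1' : ContDiff ℝ 1 ζ := h1.of_le (by exact_mod_cast le_top)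
    simp only [Pi.neg_apply, neg_mul, ← sub_eq_add_neg]
    rw [integral_sub (integrable_fderiv_apply hX h1' h2 h3)
      (integrable_mul_of_tsupport hh h1'.continuous h2 h3), hw ζ h1 h2 h3, sub_self]

theorem continuousOn_fderiv_apply_of_contDiffOn {F : Type*} [NormedAddCommGroup F]
    [NormedSpace ℝ F] {O : Set E} (hO : IsOpen O) {X : E → F} (hX : ContDiffOn ℝ 1 X O) (e : E) :
    ContinuousOn (fun x => fderiv ℝ X x e) O :=
  (hX.continuousOn_fderiv_of_isOpen hO le_rfl).clm_apply continuousOn_const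

/-- The equation differentiated in the direction `e`. -/
theorem WeakDiv.integral_fderiv_fderiv {O : Set E} (hO : IsOpen O) {X : E → E} {h : E → ℝ}
    (hw : WeakDiv O X h) (hX : ContDiffOn ℝ 1 X O) (hh : ContinuousOn h O) (e : E)
    {ζ : E → ℝ} (hζ : ContDiff ℝ 1 ζ) (hc : HasCompactSupport ζ) (hs : tsupport ζ ⊆ O) :
    ∫ x, fderiv ℝ ζ x (fderiv ℝ X x e) = -∫ x, h x * fderiv ℝ ζ x e := by
  -- The claim reads `∫ Dζ(Y) = 0` with `Y = ∂ₑX + h e`. In this form it passes from smooth to `C¹`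
  -- functions `ζ`, so the equation need only be tested with `∂ₑζ` for smooth `ζ`.
  have hY : ContinuousOn (fun x => fderiv ℝ X x e + h x • e) O :=
    (continuousOn_fderiv_apply_of_contDiffOn hO hX e).add (hh.smul continuousOn_const)
  have hI1 : ∀ ζ : E → ℝ, ContDiff ℝ 1 ζ → HasCompactSupport ζ → tsupport ζ ⊆ O →
      Integrable fun x => fderiv ℝ ζ x (fderiv ℝ X x e) := fun ζ h1 h2 h3 =>
    integrable_fderiv_apply (continuousOn_fderiv_apply_of_contDiffOn hO hX e) h1 h2 h3
  have hI2 : ∀ ζ : E → ℝ, ContDiff ℝ 1 ζ → HasCompactSupport ζ → tsupport ζ ⊆ O →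
      Integrable fun x => h x * fderiv ℝ ζ x e := fun ζ h1 h2 h3 => by
    have := integrable_fderiv_apply (hh.smul (continuousOn_const (c := e))) h1 h2 h3
    simpa using this
  have key := integral_eq_of_smooth hO hY (k := fun _ => 0) continuousOn_const
    (fun ζ h1 h2 h3 => ?_) hζ hc hs
  · simp only [map_add, map_smul, smul_eq_mul, zero_mul, add_zero] at key
    rw [integral_add (hI1 ζ hζ hc hs) (hI2 ζ hζ hc hs)] at key
    linarith
  · have h1' : ContDiff ℝ 1 ζ := h1.of_le (by exact_mod_cast le_top)
    have h1'' : ContDiff ℝ ∞ (fderiv ℝ ζ) := h1.fderiv_right (by simp)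
    simp only [map_add, map_smul, smul_eq_mul, zero_mul, add_zero]
    rw [integral_add (hI1 ζ h1' h2 h3) (hI2 ζ h1' h2 h3)]
    have hψ : ContDiff ℝ ∞ fun x => fderiv ℝ ζ x e := h1''.clm_apply contDiff_const
    have hts : tsupport (fun x => fderiv ℝ ζ x e) ⊆ tsupport ζ :=
      closure_minimal (fun x hx => by
        by_contra hx'
        exact hx (by simp [fderiv_eq_zero_of_notMem_tsupport hx'])) (isClosed_tsupport _)
    have e1 := hw _ hψ (h2.of_isClosed_subset (isClosed_tsupport _) hts) (hts.trans h3)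
    have hd : Differentiable ℝ (fderiv ℝ ζ) := h1''.differentiable (by simp)
    -- Symmetry of `D²ζ` turns the test with `∂ₑζ` into an `e`-derivative of `Dζ`, which is then
    -- integrated by parts onto `X`.
    have e2 : ∀ x, fderiv ℝ (fun y => fderiv ℝ ζ y e) x (X x) =
        fderiv ℝ (fderiv ℝ ζ) x e (X x) := fun x => by
      rw [fderiv_clm_apply (hd x) (differentiableAt_const e)]
      simp only [fderiv_const_apply, ContinuousLinearMap.comp_zero, zero_add,
        ContinuousLinearMap.flip_apply]
      exact (h1.contDiffAt.isSymmSndFDerivAt (by simp; exact WithTop.coe_le_coe.2 le_top)).eq _ _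
    simp only [e2] at e1
    have hcd : HasCompactSupport (fderiv ℝ ζ) := h2.fderiv ℝ
    have htd : tsupport (fderiv ℝ ζ) ⊆ O := (tsupport_fderiv_subset ℝ).trans h3
    have hI3 : Integrable fun x => fderiv ℝ (fderiv ℝ ζ) x e (X x) := by
      refine integrable_of_continuousOn_of_eq_zero hcd ?_ fun x hx => ?_
      · exact ((h1''.continuous_fderiv (by simp)).clm_apply
          continuous_const).continuousOn.clm_apply (hX.continuousOn.mono htd)
      · simp [fderiv_eq_zero_of_notMem_tsupport hx]
    have hI4 : Integrable fun x => fderiv ℝ ζ x (X x) :=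
      integrable_fderiv_apply hX.continuousOn h1' h2 h3
    have e3 := integral_bilinear_fderiv_right_eq_neg_left_of_integrable (μ := volume)
      (f := fderiv ℝ ζ) (g := X) (v := e) (B := ContinuousLinearMap.id ℝ (E →L[ℝ] ℝ))
      hI3 (hI1 ζ h1' h2 h3) hI4 (fun x _ => hd x)
      (fun x hx => (hX.differentiableOn one_ne_zero).differentiableAt (hO.mem_nhds (htd hx)))
    simp only [ContinuousLinearMap.id_apply] at e3
    rw [e3, e1, neg_add_cancel]

/-! ### Testing with vector fields -/

variable {ι : Type*} [Fintype ι]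

/-- The divergence computed in an orthonormal basis. -/
noncomputable def divergenceIn (b : OrthonormalBasis ι ℝ E) (V : E → E) (x : E) : ℝ :=
  ∑ j, inner ℝ (b j) (fderiv ℝ V x (b j))

theorem fderiv_inner_const_left {V : E → E} {x : E} (hV : DifferentiableAt ℝ V x) (e y : E) :
    fderiv ℝ (fun z => inner ℝ e (V z)) x y = inner ℝ e (fderiv ℝ V x y) := by
  have := ((innerSL ℝ e).hasFDerivAt.comp x hV.hasFDerivAt).fderiv
  have h2 : (fun z => inner ℝ e (V z)) = (innerSL ℝ e) ∘ V := rfl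
  rw [h2, this]; rfl

theorem tsupport_inner_const_left_subset (V : E → E) (e : E) :
    tsupport (fun z => (inner ℝ e (V z) : ℝ)) ⊆ tsupport V :=
  closure_mono fun x hx h => hx (by
    have : V x = 0 := h
    simp [this])

theorem continuous_divergenceIn (b : OrthonormalBasis ι ℝ E) {V : E → E} (hV : ContDiff ℝ 1 V) :
    Continuous (divergenceIn b V) :=
  continuous_finsetSum _ fun _ _ => continuous_const.inner
    ((hV.continuous_fderiv one_ne_zero).clm_apply continuous_const)

theorem divergenceIn_eq_zero (b : OrthonormalBasis ι ℝ E) {V : E → E} {x : E}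
    (hx : x ∉ tsupport V) : divergenceIn b V x = 0 := by
  simp [divergenceIn, fderiv_eq_zero_of_notMem_tsupport hx]

theorem integrable_mul_divergenceIn (b : OrthonormalBasis ι ℝ E) {O : Set E} {k : E → ℝ}
    (hk : ContinuousOn k O) {V : E → E} (hV : ContDiff ℝ 1 V) (hc : HasCompactSupport V)
    (hs : tsupport V ⊆ O) : Integrable fun x => k x * divergenceIn b V x :=
  integrable_of_continuousOn_of_eq_zero hc
    ((hk.mono hs).mul (continuous_divergenceIn b hV).continuousOn) fun x hx => by
      simp [divergenceIn_eq_zero b hx]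

theorem integrable_fderiv_apply_field {O : Set E} (hO : IsOpen O) {k : E → ℝ}
    (hk : ContDiffOn ℝ 1 k O) {V : E → E} (hV : Continuous V) (hc : HasCompactSupport V)
    (hs : tsupport V ⊆ O) : Integrable fun x => fderiv ℝ k x (V x) :=
  integrable_of_continuousOn_of_eq_zero hc
    (((hk.continuousOn_fderiv_of_isOpen hO le_rfl).mono hs).clm_apply hV.continuousOn)
    fun x hx => by simp [image_eq_zero_of_notMem_tsupport hx]

theorem integral_mul_divergenceIn (b : OrthonormalBasis ι ℝ E) {O : Set E} (hO : IsOpen O)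
    {k : E → ℝ} (hk : ContDiffOn ℝ 1 k O) {V : E → E} (hV : ContDiff ℝ 1 V)
    (hc : HasCompactSupport V) (hs : tsupport V ⊆ O) :
    ∫ x, k x * divergenceIn b V x = -∫ x, fderiv ℝ k x (V x) := by
  have hVd : Differentiable ℝ V := hV.differentiable one_ne_zero
  have hcj : ∀ j, HasCompactSupport fun z => (inner ℝ (b j) (V z) : ℝ) := fun j =>
    hc.of_isClosed_subset (isClosed_tsupport _) (tsupport_inner_const_left_subset V _)
  have hCj : ∀ j, ContDiff ℝ 1 fun z => (inner ℝ (b j) (V z) : ℝ) := fun j =>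
    contDiff_const.inner ℝ hV
  have hsj : ∀ j, tsupport (fun z => (inner ℝ (b j) (V z) : ℝ)) ⊆ O := fun j =>
    (tsupport_inner_const_left_subset V _).trans hs
  have hI1 : ∀ j, Integrable fun x => k x * fderiv ℝ (fun z => (inner ℝ (b j) (V z) : ℝ)) x (b j) :=
    fun j => by
      have := integrable_fderiv_apply (hk.continuousOn.smul (continuousOn_const (c := b j)))
        (hCj j) (hcj j) (hsj j)
      simpa using this
  have hI2 : ∀ j, Integrable fun x => fderiv ℝ k x (b j) * (inner ℝ (b j) (V x) : ℝ) := fun j =>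
    integrable_mul_of_tsupport (continuousOn_fderiv_apply_of_contDiffOn hO hk _)
      (hCj j).continuous (hcj j) (hsj j)
  have hI3 : ∀ j, Integrable fun x => k x * (inner ℝ (b j) (V x) : ℝ) := fun j =>
    integrable_mul_of_tsupport hk.continuousOn (hCj j).continuous (hcj j) (hsj j)
  have e1 : ∀ j, ∫ x, k x * fderiv ℝ (fun z => (inner ℝ (b j) (V z) : ℝ)) x (b j) =
      -∫ x, fderiv ℝ k x (b j) * (inner ℝ (b j) (V x) : ℝ) := fun j =>
    integral_bilinear_fderiv_right_eq_neg_left_of_integrable (μ := volume)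
      (f := k) (g := fun z => (inner ℝ (b j) (V z) : ℝ)) (v := b j)
      (B := ContinuousLinearMap.mul ℝ ℝ) (hI2 j) (hI1 j) (hI3 j)
      (fun x hx => (hk.differentiableOn one_ne_zero).differentiableAt (hO.mem_nhds (hsj j hx)))
      (fun x _ => (hCj j).differentiable one_ne_zero x)
  have e2 : ∀ x, k x * divergenceIn b V x =
      ∑ j, k x * fderiv ℝ (fun z => (inner ℝ (b j) (V z) : ℝ)) x (b j) := fun x => by
    simp only [divergenceIn, Finset.mul_sum, fderiv_inner_const_left (hVd x)]
  have e3 : ∀ x, fderiv ℝ k x (V x) = ∑ j, fderiv ℝ k x (b j) * (inner ℝ (b j) (V x) : ℝ) :=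
    fun x => by
      conv_lhs => rw [← b.sum_repr' (V x)]
      simp [mul_comm]
  simp only [e2, e3]
  rw [integral_finsetSum _ fun j _ => hI1 j, integral_finsetSum _ fun j _ => hI2 j,
    ← Finset.sum_neg_distrib]
  exact Finset.sum_congr rfl fun j _ => e1 j

/-- For a Lipschitz `f`, the composition `f ∘ u` has distributional gradient bounded by that
of `u`, in every direction. -/
theorem abs_integral_comp_mul_divergenceIn_le (b : OrthonormalBasis ι ℝ E) {O : Set E}
    (hO : IsOpen O) {f : ℝ → ℝ} {L : ℝ≥0} (hf : LipschitzWith L f) {u : E → ℝ}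
    (hu : ContDiffOn ℝ 1 u O) {V : E → E} (hV : ContDiff ℝ 1 V)
    (hc : HasCompactSupport V) (hs : tsupport V ⊆ O) :
    |∫ x, f (u x) * divergenceIn b V x| ≤ L * ∫ x, |fderiv ℝ u x (V x)| := by
  have hIu := integrable_fderiv_apply_field hO hu hV.continuous hc hs
  have hIf : Integrable fun x => f (u x) * divergenceIn b V x :=
    integrable_mul_divergenceIn b (hf.continuous.comp_continuousOn hu.continuousOn)
    hV hc hs
  have hId : Integrable fun x => divergenceIn b V x := by
    simpa using integrable_mul_divergenceIn b (continuousOn_const (c := (1 : ℝ)) (s := O)) hV hc hs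
  suffices h : ∀ δ : ℝ, 0 < δ → |∫ x, f (u x) * divergenceIn b V x| -
      L * ∫ x, |fderiv ℝ u x (V x)| ≤ δ * (L * ∫ x, |divergenceIn b V x|) by
    linarith [le_zero_of_forall_le_mul h]
  intro δ hδ
  -- Since `f ∘ u` need not be differentiable, `f` is replaced by its forward average `fd` over
  -- intervals of length `δ`: it is `C¹`, has derivative at most `L` in absolute value, and lies
  -- within `L δ` of `f`.
  let F : ℝ → ℝ := fun s => ∫ y in (0 : ℝ)..s, f y
  let fd : ℝ → ℝ := fun s => δ⁻¹ * (F (s + δ) - F s)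
  have hF : ∀ s, HasDerivAt F (f s) s := fun s =>
    intervalIntegral.integral_hasDerivAt_right (hf.continuous.intervalIntegrable _ _)
      (hf.continuous.stronglyMeasurableAtFilter _ _) hf.continuous.continuousAt
  have hfd : ∀ s, HasDerivAt fd (δ⁻¹ * (f (s + δ) - f s)) s := fun s =>
    (((hF (s + δ)).comp_add_const s δ).sub (hF s)).const_mul δ⁻¹
  have hfdC : ContDiff ℝ 1 fd := by
    rw [contDiff_one_iff_deriv]
    refine ⟨fun s => (hfd s).differentiableAt, ?_⟩
    have : deriv fd = fun s => δ⁻¹ * (f (s + δ) - f s) := funext fun s => (hfd s).deriv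
    rw [this]
    exact continuous_const.mul ((hf.continuous.comp (continuous_id.add continuous_const)).sub
      hf.continuous)
  have hbd : ∀ s, |δ⁻¹ * (f (s + δ) - f s)| ≤ L := fun s => by
    have := hf.dist_le_mul (s + δ) s
    rw [Real.dist_eq, Real.dist_eq, add_sub_cancel_left, abs_of_pos hδ] at this
    rw [abs_mul, abs_of_pos (inv_pos.2 hδ), inv_mul_le_iff₀ hδ, mul_comm δ]
    exact this
  have hclose : ∀ s, |f s - fd s| ≤ L * δ := fun s => by
    have h1 : F (s + δ) - F s = ∫ y in s..(s + δ), f y :=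
      intervalIntegral.integral_interval_sub_left (hf.continuous.intervalIntegrable _ _)
        (hf.continuous.intervalIntegrable _ _)
    have h2 : f s - fd s = δ⁻¹ * ∫ y in s..(s + δ), (f s - f y) := by
      simp only [fd]
      rw [h1, intervalIntegral.integral_sub (by simp) (hf.continuous.intervalIntegrable _ _),
        intervalIntegral.integral_const, add_sub_cancel_left, smul_eq_mul]
      field_simp
    have h3 : ‖∫ y in s..(s + δ), (f s - f y)‖ ≤ L * δ * |s + δ - s| := by
      refine intervalIntegral.norm_integral_le_of_norm_le_const fun y hy => ?_
      rw [uIoc_of_le (by linarith)] at hy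
      have := hf.dist_le_mul s y
      rw [Real.dist_eq, Real.dist_eq] at this
      rw [Real.norm_eq_abs]
      refine this.trans ?_
      gcongr
      rw [abs_sub_comm, abs_of_pos (by linarith [hy.1])]
      linarith [hy.2]
    rw [h2, abs_mul, abs_of_pos (inv_pos.2 hδ), inv_mul_le_iff₀ hδ, ← Real.norm_eq_abs]
    refine h3.trans (le_of_eq ?_)
    rw [add_sub_cancel_left, abs_of_pos hδ]; ring
  have hk : ContDiffOn ℝ 1 (fun x => fd (u x)) O := hfdC.comp_contDiffOn hu
  have e1 := integral_mul_divergenceIn b hO hk hV hc hs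
  have e2 : |∫ x, fd (u x) * divergenceIn b V x| ≤ L * ∫ x, |fderiv ℝ u x (V x)| := by
    rw [e1, abs_neg, ← Real.norm_eq_abs, ← integral_const_mul]
    refine norm_integral_le_of_norm_le (hIu.abs.const_mul _) (Eventually.of_forall fun x => ?_)
    by_cases hx : x ∈ tsupport V
    · have hux : DifferentiableAt ℝ u x :=
        (hu.differentiableOn one_ne_zero).differentiableAt (hO.mem_nhds (hs hx))
      have := ((hfd (u x)).comp_hasFDerivAt x hux.hasFDerivAt).fderiv
      have h4 : fderiv ℝ (fun x => fd (u x)) x = fderiv ℝ (fd ∘ u) x := rfl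
      rw [h4, this, smul_apply, norm_smul, Real.norm_eq_abs, Real.norm_eq_abs]
      exact mul_le_mul_of_nonneg_right (hbd _) (abs_nonneg _)
    · simp [image_eq_zero_of_notMem_tsupport hx]
  have hIk := integrable_mul_divergenceIn b hk.continuousOn hV hc hs
  have e3 : |∫ x, (f (u x) * divergenceIn b V x - fd (u x) * divergenceIn b V x)| ≤
      δ * (L * ∫ x, |divergenceIn b V x|) := by
    rw [← mul_assoc, ← integral_const_mul, ← Real.norm_eq_abs]
    refine norm_integral_le_of_norm_le (hId.abs.const_mul _) (Eventually.of_forall fun x => ?_)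
    rw [← sub_mul, norm_mul, Real.norm_eq_abs, Real.norm_eq_abs, mul_comm δ]
    exact mul_le_mul_of_nonneg_right (hclose _) (abs_nonneg _)
  rw [integral_sub hIf hIk] at e3
  have := abs_sub_abs_le_abs_sub (∫ x, f (u x) * divergenceIn b V x)
    (∫ x, fd (u x) * divergenceIn b V x)
  linarith

/-- The linearized equation tested with a vector field. -/
theorem WeakDiv.integral_linearized_le (b : OrthonormalBasis ι ℝ E) {O : Set E}
    (hO : IsOpen O) {X : E → E} {f : ℝ → ℝ} {L : ℝ≥0} (hf : LipschitzWith L f) {u β : E → ℝ}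
    (hw : WeakDiv O X fun x => f (u x) - β x) (hX : ContDiffOn ℝ 1 X O)
    (hu : ContDiffOn ℝ 1 u O) (hβ : ContDiffOn ℝ 1 β O) {V : E → E} (hV : ContDiff ℝ 1 V)
    (hc : HasCompactSupport V) (hs : tsupport V ⊆ O) :
    (Integrable fun x => (∑ j, inner ℝ (b j) (fderiv ℝ V x (fderiv ℝ X x (b j))) +
      fderiv ℝ β x (V x) - L * |fderiv ℝ u x (V x)| : ℝ)) ∧
    ∫ x, (∑ j, inner ℝ (b j) (fderiv ℝ V x (fderiv ℝ X x (b j))) + fderiv ℝ β x (V x) -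
      L * |fderiv ℝ u x (V x)|) ≤ 0 := by
  have hVd : Differentiable ℝ V := hV.differentiable one_ne_zero
  have hcj : ∀ j, HasCompactSupport fun z => (inner ℝ (b j) (V z) : ℝ) := fun j =>
    hc.of_isClosed_subset (isClosed_tsupport _) (tsupport_inner_const_left_subset V _)
  have hCj : ∀ j, ContDiff ℝ 1 fun z => (inner ℝ (b j) (V z) : ℝ) := fun j =>
    contDiff_const.inner ℝ hV
  have hsj : ∀ j, tsupport (fun z => (inner ℝ (b j) (V z) : ℝ)) ⊆ O := fun j =>
    (tsupport_inner_const_left_subset V _).trans hs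
  have hfu : ContinuousOn (fun x => f (u x)) O := hf.continuous.comp_continuousOn hu.continuousOn
  have hh : ContinuousOn (fun x => f (u x) - β x) O := hfu.sub hβ.continuousOn
  have hI1 : ∀ j, Integrable fun x =>
      (inner ℝ (b j) (fderiv ℝ V x (fderiv ℝ X x (b j))) : ℝ) := fun j => by
    have := integrable_fderiv_apply (continuousOn_fderiv_apply_of_contDiffOn hO hX (b j))
        (hCj j) (hcj j) (hsj j)
    simpa only [fderiv_inner_const_left (hVd _)] using this
  have hI2 : ∀ j, Integrable fun x =>
      (f (u x) - β x) * (inner ℝ (b j) (fderiv ℝ V x (b j)) : ℝ) := fun j => by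
    have := integrable_fderiv_apply (hh.smul (continuousOn_const (c := b j)))
        (hCj j) (hcj j) (hsj j)
    simpa only [Pi.smul_apply', map_smul, smul_eq_mul, fderiv_inner_const_left (hVd _),
      inner_smul_right] using this
  have e1 : ∀ j, ∫ x, (inner ℝ (b j) (fderiv ℝ V x (fderiv ℝ X x (b j))) : ℝ) =
      -∫ x, (f (u x) - β x) * (inner ℝ (b j) (fderiv ℝ V x (b j)) : ℝ) := fun j => by
    have := hw.integral_fderiv_fderiv hO hX hh (b j) (hCj j) (hcj j) (hsj j)
    simpa only [fderiv_inner_const_left (hVd _)] using this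
  have hIβ := integrable_fderiv_apply_field hO hβ hV.continuous hc hs
  have hIu := integrable_fderiv_apply_field hO hu hV.continuous hc hs
  have hIS : Integrable fun x => ∑ j, (inner ℝ (b j) (fderiv ℝ V x (fderiv ℝ X x (b j))) : ℝ) :=
    integrable_finsetSum _ fun j _ => hI1 j
  -- Summing the equations differentiated along the basis, each tested with the matching component
  -- of `V`, produces the divergence of `V`. The `β` part is then integrated by parts, while the `f
  -- ∘ u` part is only estimated.
  have e2 : ∫ x, ∑ j, (inner ℝ (b j) (fderiv ℝ V x (fderiv ℝ X x (b j))) : ℝ) =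
      -(∫ x, f (u x) * divergenceIn b V x) + ∫ x, β x * divergenceIn b V x := by
    rw [integral_finsetSum _ fun j _ => hI1 j, Finset.sum_congr rfl fun j _ => e1 j,
      Finset.sum_neg_distrib, ← integral_finsetSum _ fun j _ => hI2 j]
    have : ∀ x, ∑ j, (f (u x) - β x) * (inner ℝ (b j) (fderiv ℝ V x (b j)) : ℝ) =
        f (u x) * divergenceIn b V x - β x * divergenceIn b V x := fun x => by
      rw [divergenceIn, ← Finset.mul_sum, sub_mul]
    simp only [this]
    rw [integral_sub (integrable_mul_divergenceIn b hfu hV hc hs)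
      (integrable_mul_divergenceIn b hβ.continuousOn hV hc hs)]
    ring
  have hI3 : Integrable fun x => ∑ j, (inner ℝ (b j) (fderiv ℝ V x (fderiv ℝ X x (b j))) : ℝ) +
      fderiv ℝ β x (V x) := hIS.add hIβ
  refine ⟨hI3.sub (hIu.abs.const_mul _), ?_⟩
  rw [integral_sub hI3 (hIu.abs.const_mul _), integral_add hIS hIβ, e2,
    integral_mul_divergenceIn b hO hβ hV hc hs, integral_const_mul]
  have := abs_integral_comp_mul_divergenceIn_le b hO hf hu hV hc hs
  linarith [neg_abs_le (∫ x, f (u x) * divergenceIn b V x)]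

end WeakDivergence

/-! ### One-variable lemmas -/

/-- `θ` is a `C²` convex regularization of `t ↦ max t (2σ)`, with derivative `m`. -/
structure TruncationProfile (σ : ℝ) (θ m : ℝ → ℝ) : Prop where
  contDiff : ContDiff ℝ 1 m
  hasDerivAt : ∀ t, HasDerivAt θ (m t) t
  nonneg : ∀ t, 0 ≤ m t
  le_one : ∀ t, m t ≤ 1
  eq_zero : ∀ t ≤ σ, m t = 0
  deriv_nonneg : ∀ t, 0 ≤ deriv m t
  eq_const : ∀ t ≤ σ, θ t = 2 * σ
  le_self : ∀ t, t ≤ θ t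
  le_max : ∀ t, θ t ≤ 3 * max t σ
  const_le : ∀ t, 2 * σ ≤ θ t

/-- The slope `m` is a smooth step from `0` at `σ` to `1` at `2 * σ`. Starting `θ` at the height `2
* σ` keeps it above the identity although the slope reaches `1` only at `2 * σ`; slope at most `1`
gives `θ t ≤ t + σ` beyond `σ`. -/
theorem exists_truncationProfile {σ : ℝ} (hσ : 0 < σ) :
    ∃ θ m : ℝ → ℝ, TruncationProfile σ θ m := by
  let m : ℝ → ℝ := fun t => Real.smoothTransition (σ⁻¹ * (t - σ))
  let θ : ℝ → ℝ := fun t => 2 * σ + ∫ s in (0 : ℝ)..t, m s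
  have hmc : ContDiff ℝ 1 m := Real.smoothTransition.contDiff.comp
    (contDiff_const.mul (contDiff_id.sub contDiff_const))
  have hθ : ∀ t, HasDerivAt θ (m t) t := fun t =>
    (intervalIntegral.integral_hasDerivAt_right (hmc.continuous.intervalIntegrable _ _)
      (hmc.continuous.stronglyMeasurableAtFilter _ _) hmc.continuous.continuousAt).const_add _
  have hm0 : ∀ t, 0 ≤ m t := fun t => Real.smoothTransition.nonneg _
  have hm1 : ∀ t, m t ≤ 1 := fun t => Real.smoothTransition.le_one _
  have hmz : ∀ t ≤ σ, m t = 0 := fun t ht =>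
    Real.smoothTransition.zero_of_nonpos
      (mul_nonpos_of_nonneg_of_nonpos (inv_pos.2 hσ).le (by linarith))
  have hmo : ∀ t, 2 * σ ≤ t → m t = 1 := fun t ht =>
    Real.smoothTransition.one_of_one_le (by rw [← div_eq_inv_mul, le_div_iff₀ hσ]; linarith)
  have hmm : Monotone m := fun s t hst => Real.smoothTransition.monotone (by gcongr)
  have hconst : ∀ t ≤ σ, θ t = 2 * σ := fun t ht => by
    have : ∫ s in (0 : ℝ)..t, m s = ∫ s in (0 : ℝ)..t, (0 : ℝ) :=
      intervalIntegral.integral_congr fun s hs => hmz s (hs.2.trans (sup_le hσ.le ht))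
    simp only [θ, this, intervalIntegral.integral_zero, add_zero]
  have hθd : Differentiable ℝ θ := fun t => (hθ t).differentiableAt
  have hθm : Monotone θ := monotone_of_deriv_nonneg hθd fun t => by
    rw [(hθ t).deriv]; exact hm0 t
  have hder : ∀ t, HasDerivAt (fun t => θ t - t) (m t - 1) t := fun t =>
    (hθ t).sub (hasDerivAt_id t)
  have hθa : Antitone fun t => θ t - t := by
    refine antitone_of_deriv_nonpos (hθd.sub differentiable_id) fun t => ?_
    rw [(hder t).deriv]
    linarith [hm1 t]
  have hlow : ∀ t, 2 * σ ≤ θ t := fun t => by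
    rcases le_total t σ with h | h
    · exact (hconst t h).ge
    · exact (hconst σ le_rfl).ge.trans (hθm h)
  refine ⟨θ, m, hmc, hθ, hm0, hm1, hmz, fun t => hmm.deriv_nonneg, hconst,
    fun t => ?_, fun t => ?_, hlow⟩
  · rcases le_total t (2 * σ) with h | h
    · exact h.trans (hlow t)
    · have hmono : MonotoneOn (fun t => θ t - t) (Ici (2 * σ)) := by
        refine monotoneOn_of_deriv_nonneg (convex_Ici _) (hθd.sub differentiable_id).continuous.continuousOn
          (hθd.sub differentiable_id).differentiableOn fun s hs => ?_
        rw [interior_Ici] at hs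
        rw [(hder s).deriv, hmo s (le_of_lt hs)]
        simp
      have := hmono (mem_Ici.2 le_rfl) (mem_Ici.2 h) h
      simp only at this
      linarith [hlow (2 * σ)]
  · rcases le_total t σ with h | h
    · rw [hconst t h, max_eq_right h]; linarith
    · have := hθa h
      simp only [hconst σ le_rfl] at this
      rw [max_eq_left h]; linarith

theorem differentiableAt_of_contDiffOn_Ioi {A : ℝ → ℝ} (hA : ContDiffOn ℝ 1 A (Ioi 0)) {t : ℝ}
    (ht : 0 < t) : DifferentiableAt ℝ A t :=
  (hA.differentiableOn one_ne_zero).differentiableAt (Ioi_mem_nhds ht)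

/-- The sign of this derivative compares `t A'(t) / A(t)` with `M`, so bounds on that quotient
become monotonicity of `A(t) t^(-M)`. -/
theorem hasDerivAt_log_sub_mul_log {A : ℝ → ℝ} (hA : ContDiffOn ℝ 1 A (Ioi 0))
    (hpos : ∀ t : ℝ, 0 < t → 0 < A t) (M : ℝ) {t : ℝ} (ht : 0 < t) :
    HasDerivAt (fun t => Real.log (A t) - M * Real.log t) ((t * deriv A t / A t - M) / t) t := by
  have h1 := (differentiableAt_of_contDiffOn_Ioi hA ht).hasDerivAt.log (hpos t ht).ne'
  have h2 := (Real.hasDerivAt_log ht.ne').const_mul M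
  convert! h1.sub h2 using 1
  have := (hpos t ht).ne'
  field_simp

theorem antitoneOn_log_sub_mul_log {A : ℝ → ℝ} (hA : ContDiffOn ℝ 1 A (Ioi 0))
    (hpos : ∀ t : ℝ, 0 < t → 0 < A t) {M : ℝ} (hM : ∀ t : ℝ, 0 < t → t * deriv A t / A t ≤ M) :
    AntitoneOn (fun t => Real.log (A t) - M * Real.log t) (Ioi 0) := by
  have hd := fun t (ht : 0 < t) => hasDerivAt_log_sub_mul_log hA hpos M ht
  refine antitoneOn_of_deriv_nonpos (convex_Ioi 0)
    (fun t ht => (hd t ht).continuousAt.continuousWithinAt)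
    (fun t ht => ((hd t (interior_subset ht)).differentiableAt).differentiableWithinAt)
    fun t ht => ?_
  have ht' : 0 < t := interior_subset ht
  rw [(hd t ht').deriv]
  exact div_nonpos_of_nonpos_of_nonneg (by linarith [hM t ht']) ht'.le

theorem monotoneOn_log_sub_mul_log {A : ℝ → ℝ} (hA : ContDiffOn ℝ 1 A (Ioi 0))
    (hpos : ∀ t : ℝ, 0 < t → 0 < A t) {M : ℝ} (hM : ∀ t : ℝ, 0 < t → M ≤ t * deriv A t / A t) :
    MonotoneOn (fun t => Real.log (A t) - M * Real.log t) (Ioi 0) := by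
  have hd := fun t (ht : 0 < t) => hasDerivAt_log_sub_mul_log hA hpos M ht
  refine monotoneOn_of_deriv_nonneg (convex_Ioi 0)
    (fun t ht => (hd t ht).continuousAt.continuousWithinAt)
    (fun t ht => ((hd t (interior_subset ht)).differentiableAt).differentiableWithinAt)
    fun t ht => ?_
  have ht' : 0 < t := interior_subset ht
  rw [(hd t ht').deriv]
  exact div_nonneg (by linarith [hM t ht']) ht'.le

/-- `A(t) t^(-M)` is nonincreasing, hence `A(3t) ≤ 3^M A(t)`; monotonicity of `A` covers every `s ≤
3t`. -/
theorem exists_doubling {A : ℝ → ℝ} (hA : ContDiffOn ℝ 1 A (Ioi 0))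
    (hpos : ∀ t : ℝ, 0 < t → 0 < A t) {M : ℝ} (hM : ∀ t : ℝ, 0 < t → t * deriv A t / A t ≤ M)
    (hmono : Monotone A) : ∃ D : ℝ, 0 < D ∧ ∀ s t : ℝ, 0 < t → s ≤ 3 * t → A s ≤ D * A t := by
  refine ⟨Real.exp (M * Real.log 3), Real.exp_pos _, fun s t ht hst => (hmono hst).trans ?_⟩
  have h := antitoneOn_log_sub_mul_log hA hpos hM (mem_Ioi.2 ht)
    (mem_Ioi.2 (by positivity : 0 < 3 * t)) (by linarith)
  simp only [Real.log_mul (three_ne_zero) ht.ne'] at h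
  rw [← Real.log_le_log_iff (hpos _ (by positivity)) (mul_pos (Real.exp_pos _) (hpos t ht)),
    Real.log_mul (Real.exp_pos _).ne' (hpos t ht).ne', Real.log_exp]
  linarith

/-- For `t < 1` the lower bound `m` integrates to `A(t) ≤ A(1) t^m`, and `1 + m > 0`. -/
theorem tendsto_mul_self_zero {A : ℝ → ℝ} (hA : ContDiffOn ℝ 1 A (Ioi 0))
    (hpos : ∀ t : ℝ, 0 < t → 0 < A t) {m : ℝ} (hm1 : -1 < m)
    (hm : ∀ t : ℝ, 0 < t → m ≤ t * deriv A t / A t) :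
    Tendsto (fun t => t * A t) (𝓝[>] 0) (𝓝 0) := by
  have hlim : Tendsto (fun t : ℝ => A 1 * t ^ (1 + m)) (𝓝[>] 0) (𝓝 0) := by
    have h1 := (Real.continuousAt_rpow_const 0 (1 + m) (Or.inr (by linarith))).tendsto
    rw [Real.zero_rpow (by linarith)] at h1
    simpa using (h1.mono_left nhdsWithin_le_nhds).const_mul (A 1)
  refine tendsto_of_tendsto_of_tendsto_of_le_of_le' tendsto_const_nhds hlim ?_ ?_
  · filter_upwards [self_mem_nhdsWithin] with t ht using (mul_pos ht (hpos t ht)).le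
  · filter_upwards [self_mem_nhdsWithin, mem_nhdsWithin_of_mem_nhds (Iio_mem_nhds one_pos)]
      with t ht ht1
    have ht : 0 < t := ht
    have h := monotoneOn_log_sub_mul_log hA hpos hm (mem_Ioi.2 ht) (mem_Ioi.2 one_pos) (le_of_lt ht1)
    simp only [Real.log_one, mul_zero, sub_zero] at h
    rw [← Real.log_le_log_iff (mul_pos ht (hpos t ht))
      (mul_pos (hpos 1 one_pos) (Real.rpow_pos_of_pos ht _)), Real.log_mul ht.ne' (hpos t ht).ne',
      Real.log_mul (hpos 1 one_pos).ne' (Real.rpow_pos_of_pos ht _).ne', Real.log_rpow ht]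
    linarith

/-! ### Continuity and monotonicity of the flux -/

section Flux

variable {E : Type*} [NormedAddCommGroup E] [InnerProductSpace ℝ E]

theorem continuous_flux {A : ℝ → ℝ} (hA : ContDiffOn ℝ 1 A (Ioi 0))
    (h0 : Tendsto (fun t => t * A t) (𝓝[>] 0) (𝓝 0)) :
    Continuous fun ξ : E => A ‖ξ‖ • ξ := by
  rw [continuous_iff_continuousAt]
  intro ξ
  by_cases hξ : ξ = 0
  · subst hξ
    rw [ContinuousAt, smul_zero, tendsto_zero_iff_norm_tendsto_zero, Metric.tendsto_nhds]
    intro ε hε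
    have h1 := (Metric.tendsto_nhds.1 h0 ε hε)
    obtain ⟨δ, hδ, h2⟩ := Metric.mem_nhdsWithin_iff.1 h1
    filter_upwards [Metric.ball_mem_nhds (0 : E) hδ] with ζ hζ
    by_cases hz : ζ = 0
    · simpa [hz] using hε
    · have h3 : ‖ζ‖ ∈ Metric.ball (0 : ℝ) δ ∩ Ioi 0 :=
        ⟨by simpa using hζ, norm_pos_iff.2 hz⟩
      have h4 := h2 h3
      simp only [mem_ofPred_eq, dist_zero_right, norm_mul, norm_norm] at h4
      rwa [dist_zero_right, norm_norm, norm_smul, mul_comm]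
  · exact (ContinuousAt.comp (f := fun ξ : E => ‖ξ‖)
      (differentiableAt_of_contDiffOn_Ioi hA (norm_pos_iff.2 hξ)).continuousAt
      continuous_norm.continuousAt).smul continuousAt_id

theorem inner_flux_sub (a b : ℝ) (ξ ζ : E) :
    (inner ℝ (a • ξ - b • ζ) (ξ - ζ) : ℝ) =
      a * ‖ξ‖ ^ 2 + b * ‖ζ‖ ^ 2 - (a + b) * inner ℝ ξ ζ := by
  simp only [inner_sub_left, inner_sub_right, real_inner_smul_left, real_inner_self_eq_norm_sq,
    real_inner_comm ξ ζ]
  ring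

/-- With `a = A ‖ξ‖` and `b = A ‖ζ‖`, the inner product equals `(a + b)/2 ‖ξ - ζ‖² + (a - b)(‖ξ‖² -
‖ζ‖²)/2`, and the last term is nonnegative for nondecreasing `A`. -/
theorem inner_flux_sub_ge_of_monotone {A : ℝ → ℝ} (hmono : Monotone A) (h0 : ∀ t, 0 ≤ A t)
    (ξ ζ : E) : A (max ‖ξ‖ ‖ζ‖) / 2 * ‖ξ - ζ‖ ^ 2 ≤
      inner ℝ (A ‖ξ‖ • ξ - A ‖ζ‖ • ζ) (ξ - ζ) := by
  wlog h : ‖ζ‖ ≤ ‖ξ‖ generalizing ξ ζ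
  · have := this ζ ξ (le_of_not_ge h)
    rwa [max_comm, norm_sub_rev, ← neg_sub (A ‖ξ‖ • ξ), ← neg_sub ξ ζ, inner_neg_neg] at this
  rw [inner_flux_sub, max_eq_left h]
  have e := norm_sub_sq_real ξ ζ
  have h1 : 0 ≤ (A ‖ξ‖ - A ‖ζ‖) * (‖ξ‖ ^ 2 - ‖ζ‖ ^ 2) :=
    mul_nonneg (sub_nonneg.2 (hmono h))
      (sub_nonneg.2 (pow_le_pow_left₀ (norm_nonneg _) h 2))
  have h2 : 0 ≤ A ‖ζ‖ * ‖ξ - ζ‖ ^ 2 := mul_nonneg (h0 _) (sq_nonneg _)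
  rw [e] at h2 ⊢
  linarith

/-- The derivative of `t A(t)` is `A(t)(1 + t A'/A) ≥ (1 + m) τ`, which gives strong monotonicity in
the radial direction; in the angular direction `A ≥ τ` suffices. The constant `c` is the smaller of
the two bounds. -/
theorem exists_inner_flux_sub_ge {A : ℝ → ℝ} (hA : ContDiffOn ℝ 1 A (Ioi 0))
    (hpos : ∀ t : ℝ, 0 < t → 0 < A t) {m : ℝ} (hm1 : -1 < m)
    (hm : ∀ t : ℝ, 0 < t → m ≤ t * deriv A t / A t) {R τ : ℝ} (hτ : 0 < τ)
    (hAτ : ∀ t ∈ Icc 0 R, 0 < t → τ ≤ A t) :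
    ∃ c : ℝ, 0 < c ∧ ∀ ξ ζ : E, ‖ξ‖ ≤ R → ‖ζ‖ ≤ R →
      c * ‖ξ - ζ‖ ^ 2 ≤ inner ℝ (A ‖ξ‖ • ξ - A ‖ζ‖ • ζ) (ξ - ζ) := by
  set c := min 1 (1 + m) * τ with hc
  have hc0 : 0 < c := mul_pos (lt_min one_pos (by linarith)) hτ
  have hcτ : c ≤ τ := by
    have := mul_le_mul_of_nonneg_right (min_le_left 1 (1 + m)) hτ.le
    linarith
  have hmon : MonotoneOn (fun t => t * A t - c * t) (Ioc 0 R) := by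
    have hd : ∀ t, 0 < t → HasDerivAt (fun t => t * A t - c * t)
        (1 * A t + t * deriv A t - c * 1) t := fun t ht =>
      ((hasDerivAt_id t).mul (differentiableAt_of_contDiffOn_Ioi hA ht).hasDerivAt).sub
        ((hasDerivAt_id t).const_mul c)
    refine monotoneOn_of_deriv_nonneg (convex_Ioc 0 R)
      (fun t ht => (hd t ht.1).continuousAt.continuousWithinAt)
      (fun t ht => (hd t (interior_subset ht).1).differentiableAt.differentiableWithinAt)
      fun t ht => ?_
    obtain ⟨ht0, htR⟩ := interior_subset ht
    rw [(hd t ht0).deriv]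
    have h1 := hm t ht0
    rw [le_div_iff₀ (hpos t ht0)] at h1
    have h2 : (1 + m) * τ ≤ (1 + m) * A t :=
      mul_le_mul_of_nonneg_left (hAτ t ⟨ht0.le, htR⟩ ht0) (by linarith)
    have h3 : c ≤ (1 + m) * τ := mul_le_mul_of_nonneg_right (min_le_right _ _) hτ.le
    linarith
  refine ⟨c, hc0, fun ξ ζ hξ hζ => ?_⟩
  wlog h : ‖ζ‖ ≤ ‖ξ‖ generalizing ξ ζ
  · have := this ζ ξ hζ hξ (le_of_not_ge h)
    rwa [norm_sub_rev, ← neg_sub (A ‖ξ‖ • ξ), ← neg_sub ξ ζ, inner_neg_neg] at this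
  rw [inner_flux_sub]
  have e := norm_sub_sq_real ξ ζ
  rcases eq_or_ne ζ 0 with h0 | h0
  · subst h0
    rcases eq_or_ne ξ 0 with h1 | h1
    · simp [h1]
    · have h2 := hAτ ‖ξ‖ ⟨norm_nonneg _, hξ⟩ (norm_pos_iff.2 h1)
      simp only [sub_zero, norm_zero, inner_zero_right, mul_zero]
      have : c * ‖ξ‖ ^ 2 ≤ A ‖ξ‖ * ‖ξ‖ ^ 2 :=
        mul_le_mul_of_nonneg_right (hcτ.trans h2) (sq_nonneg _)
      linarith
  · have hz : 0 < ‖ζ‖ := norm_pos_iff.2 h0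
    have hx : 0 < ‖ξ‖ := hz.trans_le h
    have h1 := hmon ⟨hz, hζ⟩ ⟨hx, hξ⟩ h
    simp only at h1
    have h2 := hAτ ‖ξ‖ ⟨norm_nonneg _, hξ⟩ hx
    have h3 := hAτ ‖ζ‖ ⟨norm_nonneg _, hζ⟩ hz
    have h4 := real_inner_le_norm ξ ζ
    rw [e]
    -- The claimed difference is exactly the sum of this radial term and the angular term `h6`.
    have h5 : 0 ≤ (‖ξ‖ * A ‖ξ‖ - ‖ζ‖ * A ‖ζ‖ - c * (‖ξ‖ - ‖ζ‖)) * (‖ξ‖ - ‖ζ‖) :=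
      mul_nonneg (by linarith) (by linarith)
    have h6 : 0 ≤ (A ‖ξ‖ + A ‖ζ‖ - 2 * c) * (‖ξ‖ * ‖ζ‖ - inner ℝ ξ ζ) :=
      mul_nonneg (by linarith) (by linarith)
    linarith

end Flux

/-! ### Pointwise estimates -/

section Pointwise

variable {E : Type*} [NormedAddCommGroup E] [InnerProductSpace ℝ E] {ι : Type*} [Fintype ι]

theorem norm_apply_sq_le_sum (b : OrthonormalBasis ι ℝ E) {H : E →L[ℝ] E}
    (hH : ∀ y z, (inner ℝ (H y) z : ℝ) = inner ℝ y (H z)) (y : E) :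
    ‖H y‖ ^ 2 ≤ (∑ j, ‖H (b j)‖ ^ 2) * ‖y‖ ^ 2 := by
  rw [← b.sum_sq_norm_inner_right (H y), Finset.sum_mul]
  refine Finset.sum_le_sum fun j _ => ?_
  rw [← hH, ← mul_pow]
  exact pow_le_pow_left₀ (norm_nonneg _) (norm_inner_le_norm _ _) 2

theorem sum_inner_mul_clm (b : OrthonormalBasis ι ℝ E) (ℓ : E →L[ℝ] ℝ) (y : E) :
    ∑ j, (inner ℝ (b j) y : ℝ) * ℓ (b j) = ℓ y := by
  conv_rhs => rw [← b.sum_repr' y]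
  simp

/-- The trace of the product of the derivatives of `A(|G|) G` and `m(|G|) φ² G`. -/
theorem sum_inner_linearized_eq (b : OrthonormalBasis ι ℝ E) {H : E →L[ℝ] E}
    (hH : ∀ y z, (inner ℝ (H y) z : ℝ) = inner ℝ y (H z)) (G : E) (ℓ : E →L[ℝ] ℝ)
    (a a' m m' p : ℝ) (DX DV : E → E)
    (hDX : ∀ y, DX y = a • H y + (a' * inner ℝ G (H y)) • G)
    (hDV : ∀ y, DV y = (m * p ^ 2) • H y + (m' * inner ℝ G (H y) * p ^ 2 + m * (2 * p * ℓ y)) • G) :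
    ∑ j, (inner ℝ (b j) (DV (DX (b j))) : ℝ) =
      p ^ 2 * (a * m * ∑ j, ‖H (b j)‖ ^ 2 + (m * a' + m' * a) * ‖H G‖ ^ 2 +
        m' * a' * (inner ℝ G (H G)) ^ 2) +
      2 * p * m * (a * ℓ (H G) + a' * inner ℝ G (H G) * ℓ G) := by
  have h1 : ∀ j, (inner ℝ (b j) (H (H (b j))) : ℝ) = ‖H (b j)‖ ^ 2 := fun j => by
    rw [← hH, real_inner_self_eq_norm_sq]
  have h2 : ∑ j, (inner ℝ (H G) (b j) : ℝ) * inner ℝ (b j) (H G) = ‖H G‖ ^ 2 := by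
    rw [b.sum_inner_mul_inner, real_inner_self_eq_norm_sq]
  have h3 : ∑ j, (inner ℝ (b j) G : ℝ) * inner ℝ (H (H G)) (b j) = ‖H G‖ ^ 2 := by
    have := b.sum_inner_mul_inner (H (H G)) G
    simp only [mul_comm] at this ⊢
    rw [this, hH, real_inner_self_eq_norm_sq]
  have h4 : ∑ j, (inner ℝ (b j) G : ℝ) * inner ℝ (H G) (b j) = inner ℝ G (H G) := by
    have := b.sum_inner_mul_inner (H G) G
    simp only [mul_comm] at this ⊢
    rw [this, real_inner_comm]
  have h5 : ∑ j, (inner ℝ (b j) G : ℝ) * ℓ (H (b j)) = ℓ (H G) :=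
    sum_inner_mul_clm b (ℓ.comp H) G
  have key : ∀ j, (inner ℝ (b j) (DV (DX (b j))) : ℝ) =
      p ^ 2 * (a * m) * ‖H (b j)‖ ^ 2 +
      p ^ 2 * m * a' * ((inner ℝ (H G) (b j) : ℝ) * inner ℝ (b j) (H G)) +
      p ^ 2 * m' * a * ((inner ℝ (b j) G : ℝ) * inner ℝ (H (H G)) (b j)) +
      (p ^ 2 * m' * a' * inner ℝ G (H G) + 2 * p * m * a' * ℓ G) *
        ((inner ℝ (b j) G : ℝ) * inner ℝ (H G) (b j)) +
      2 * p * m * a * ((inner ℝ (b j) G : ℝ) * ℓ (H (b j))) := fun j => by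
    have e1 : (inner ℝ G (H (b j)) : ℝ) = inner ℝ (H G) (b j) := (hH _ _).symm
    have e2 : (inner ℝ G (H (H (b j))) : ℝ) = inner ℝ (H (H G)) (b j) := by rw [hH, hH]
    rw [hDV, hDX]
    simp only [map_add, map_smul, inner_add_right, inner_smul_right, smul_eq_mul, h1, e1, e2]
    ring
  rw [Finset.sum_congr rfl fun j _ => key j]
  simp only [Finset.sum_add_distrib, ← Finset.mul_sum, h2, h3, h4, h5]
  ring

end Pointwise

/-- The algebraic inequality that combines the equation with its linearization. -/
theorem quadratic_absorption {p d t a h m q c M D Lb L A₁ ε F₁ F₂ : ℝ}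
    (ht : 0 ≤ t) (htε : t ≤ ε) (ha : 0 < a) (haA : a ≤ A₁)
    (hm : 0 ≤ m) (hm1 : m ≤ 1) (hq : 0 < q) (haq : a * q ≤ 1) (hmq : m ≤ D * a * q)
    (hc : 0 < c) (hM : 0 ≤ M) (hD : 0 ≤ D) (hL : 0 ≤ L)
    (hε : 4 * M ^ 2 / c * ε ^ 2 * (Lb ^ 2 * D + L * D * A₁) ≤ c / 2)
    (h1 : c * p ^ 2 * q - 2 * p * d * a * t * q - M * p ^ 2 * m * a * h * q ≤ -F₁)
    (h2 : p ^ 2 * a * m * h ^ 2 - 2 * (1 + M) * p * m * d * a * h * t - Lb * m * p ^ 2 * h * t -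
      L * m * p ^ 2 * t ^ 2 ≤ F₂) :
    c / 4 * (p ^ 2 * q) ≤ -F₁ + 4 * M ^ 2 / c * F₂ +
      (8 / c + 16 * M ^ 2 / c * (1 + M) ^ 2) * ε ^ 2 * (a * d ^ 2) := by
  -- Here `p = φ`, `d = |∇φ|`, `t = |∇u|`, `a = A(t)`, `h` is the Hilbert–Schmidt norm of `D²u`, `m
  -- = θ'(t)` and `q = 1 / A(θ(t))`. Young's inequality in `y2` costs `2M²/c` copies of `p² a m h²`;
  -- `y3` and `y4` each spend a quarter of that quantity in `h2`, so half of it survives, whence the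
  -- multiplier `4M²/c`.
  have ht2 : t ^ 2 ≤ ε ^ 2 := pow_le_pow_left₀ ht htε 2
  have y1 : 2 * p * d * a * t * q ≤ c / 8 * (p ^ 2 * q) + 8 / c * ε ^ 2 * (a * d ^ 2) := by
    have e1 : 2 * p * d * a * t * q ≤ c / 8 * (p ^ 2 * q) + 8 / c * (a * q) * (t ^ 2) * (a * d ^ 2) := by
      have : 0 ≤ q * (c / 8) * (p - 8 / c * (a * t * d)) ^ 2 := by positivity
      have e : q * (c / 8) * (p - 8 / c * (a * t * d)) ^ 2 = c / 8 * (p ^ 2 * q) +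
          8 / c * (a * q) * (t ^ 2) * (a * d ^ 2) - 2 * p * d * a * t * q := by
        field_simp; ring
      linarith
    have e2 : 8 / c * (a * q) * (t ^ 2) * (a * d ^ 2) ≤ 8 / c * 1 * ε ^ 2 * (a * d ^ 2) := by
      gcongr
    linarith
  have y2 : M * p ^ 2 * m * a * h * q ≤ c / 8 * (p ^ 2 * q) + 2 * M ^ 2 / c * (p ^ 2 * a * m * h ^ 2) := by
    have e0 : 0 ≤ p ^ 2 * q * m * (c / 8) * (1 - 4 * M / c * (a * h)) ^ 2 := by positivity
    have e1 : p ^ 2 * q * m * (c / 8) * (1 - 4 * M / c * (a * h)) ^ 2 =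
        m * (c / 8 * (p ^ 2 * q)) + 2 * M ^ 2 / c * (a * q) * (p ^ 2 * a * m * h ^ 2) -
        M * p ^ 2 * m * a * h * q := by
      field_simp; ring
    have e2 : m * (c / 8 * (p ^ 2 * q)) ≤ 1 * (c / 8 * (p ^ 2 * q)) := by gcongr
    have e3 : 2 * M ^ 2 / c * (a * q) * (p ^ 2 * a * m * h ^ 2) ≤
        2 * M ^ 2 / c * 1 * (p ^ 2 * a * m * h ^ 2) := by gcongr
    linarith
  have y3 : 2 * (1 + M) * p * m * d * a * h * t ≤
      p ^ 2 * a * m * h ^ 2 / 4 + 4 * (1 + M) ^ 2 * ε ^ 2 * (a * d ^ 2) := by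
    have e0 : 0 ≤ a * m * (p * h / 2 - 2 * (1 + M) * (d * t)) ^ 2 := by positivity
    have e1 : 4 * (1 + M) ^ 2 * m * t ^ 2 * (a * d ^ 2) ≤ 4 * (1 + M) ^ 2 * 1 * ε ^ 2 * (a * d ^ 2) := by
      gcongr
    nlinarith
  have y4 : Lb * m * p ^ 2 * h * t ≤ p ^ 2 * a * m * h ^ 2 / 4 + Lb ^ 2 * D * ε ^ 2 * (p ^ 2 * q) := by
    -- This is where the degeneracy could hurt: Young's inequality divides by `a`, and doubling
    -- turns `m / a` into the admissible weight `q`.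
    have hma : m / a ≤ D * q := by
      rw [div_le_iff₀ ha]; linarith
    have e0 : 0 ≤ (m / a) * p ^ 2 * (a * h / 2 - Lb * t) ^ 2 := by positivity
    have e1 : (m / a) * p ^ 2 * (a * h / 2 - Lb * t) ^ 2 = p ^ 2 * a * m * h ^ 2 / 4 -
        Lb * m * p ^ 2 * h * t + Lb ^ 2 * (m / a) * t ^ 2 * p ^ 2 := by
      field_simp; ring
    have e2 : Lb ^ 2 * (m / a) * t ^ 2 * p ^ 2 ≤ Lb ^ 2 * (D * q) * ε ^ 2 * p ^ 2 := by gcongr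
    linarith
  have y5 : L * m * p ^ 2 * t ^ 2 ≤ L * D * A₁ * ε ^ 2 * (p ^ 2 * q) := by
    have e1 : m ≤ D * A₁ * q := hmq.trans (by gcongr)
    have hA₁ : 0 ≤ A₁ := ha.le.trans haA
    have e2 : L * m * p ^ 2 * t ^ 2 ≤ L * (D * A₁ * q) * p ^ 2 * ε ^ 2 := by gcongr
    linarith
  have hK : 0 ≤ 4 * M ^ 2 / c := by positivity
  have z : 4 * M ^ 2 / c * (p ^ 2 * a * m * h ^ 2 / 2 - 4 * (1 + M) ^ 2 * ε ^ 2 * (a * d ^ 2) -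
      (Lb ^ 2 * D + L * D * A₁) * ε ^ 2 * (p ^ 2 * q)) ≤ 4 * M ^ 2 / c * F₂ :=
    mul_le_mul_of_nonneg_left (by linarith) hK
  have z2 : 4 * M ^ 2 / c * ε ^ 2 * (Lb ^ 2 * D + L * D * A₁) * (p ^ 2 * q) ≤ c / 2 * (p ^ 2 * q) := by
    gcongr
  have e3 : 4 * M ^ 2 / c * (p ^ 2 * a * m * h ^ 2 / 2 - 4 * (1 + M) ^ 2 * ε ^ 2 * (a * d ^ 2) -
      (Lb ^ 2 * D + L * D * A₁) * ε ^ 2 * (p ^ 2 * q)) =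
      2 * M ^ 2 / c * (p ^ 2 * a * m * h ^ 2) - 16 * M ^ 2 / c * (1 + M) ^ 2 * ε ^ 2 * (a * d ^ 2) -
      4 * M ^ 2 / c * ε ^ 2 * (Lb ^ 2 * D + L * D * A₁) * (p ^ 2 * q) := by ring
  linarith

/-! ### A weighted Poincaré inequality near the critical set -/

/-- A nondecreasing `A`, extended by zero, with its derived doubling constant. -/
structure DegenerateA (A : ℝ → ℝ) (M D : ℝ) : Prop where
  pos : ∀ t : ℝ, 0 < t → 0 < A t
  eq_zero : ∀ t : ℝ, t ≤ 0 → A t = 0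
  mono : Monotone A
  contDiffOn : ContDiffOn ℝ 1 A (Ioi 0)
  deriv_le : ∀ t : ℝ, 0 < t → t * deriv A t ≤ M * A t
  doubling : ∀ s t : ℝ, 0 < t → s ≤ 3 * t → A s ≤ D * A t
  tendsto : Tendsto (fun t => t * A t) (𝓝[>] 0) (𝓝 0)
  M_nonneg : 0 ≤ M
  D_nonneg : 0 ≤ D

section Hardy

variable {E : Type*} [NormedAddCommGroup E] [InnerProductSpace ℝ E] [FiniteDimensional ℝ E]

theorem DegenerateA.nonneg {A : ℝ → ℝ} {M D : ℝ} (hA : DegenerateA A M D) (t : ℝ) : 0 ≤ A t := by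
  rcases le_or_gt t 0 with h | h
  · exact (hA.eq_zero t h).ge
  · exact (hA.pos t h).le

theorem contDiff_of_contDiffOn_of_tsupport_subset {F : Type*} [NormedAddCommGroup F]
    [NormedSpace ℝ F] {n : ℕ∞ω} {O : Set E} (hO : IsOpen O) {f : E → F} (hf : ContDiffOn ℝ n f O)
    (hs : tsupport f ⊆ O) : ContDiff ℝ n f := by
  rw [contDiff_iff_contDiffAt]
  intro x
  by_cases hx : x ∈ tsupport f
  · exact hf.contDiffAt (hO.mem_nhds (hs hx))
  · exact contDiffAt_const.congr_of_eventuallyEq (notMem_tsupport_iff_eventuallyEq.1 hx)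

theorem continuousOn_gradient {u : E → ℝ} {O : Set E} (hO : IsOpen O) (hu : ContDiffOn ℝ 1 u O) :
    ContinuousOn (gradient u) O :=
  (InnerProductSpace.toDual ℝ E).symm.continuous.comp_continuousOn
    (hu.continuousOn_fderiv_of_isOpen hO le_rfl)

theorem contDiffOn_gradient {u : E → ℝ} {O : Set E} (hO : IsOpen O) (hu : ContDiffOn ℝ 2 u O) :
    ContDiffOn ℝ 1 (gradient u) O :=
  (InnerProductSpace.toDual ℝ E).symm.toContinuousLinearEquiv.contDiff.comp_contDiffOn
    (hu.fderiv_of_isOpen (m := 1) hO (by norm_num))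

theorem inner_fderiv_gradient_symm {u : E → ℝ} {O : Set E} (hO : IsOpen O)
    (hu : ContDiffOn ℝ 2 u O) {x : E} (hx : x ∈ O) (y z : E) :
    (inner ℝ (fderiv ℝ (gradient u) x y) z : ℝ) = inner ℝ y (fderiv ℝ (gradient u) x z) := by
  have hd : DifferentiableAt ℝ (fderiv ℝ u) x :=
    ((hu.fderiv_of_isOpen (m := 1) hO (by norm_num)).differentiableOn one_ne_zero).differentiableAt
      (hO.mem_nhds hx)
  have h1 : ∀ y, fderiv ℝ (gradient u) x y =
      (InnerProductSpace.toDual ℝ E).symm (fderiv ℝ (fderiv ℝ u) x y) := fun y => by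
    have := ((InnerProductSpace.toDual ℝ E).symm.toContinuousLinearEquiv.hasFDerivAt.comp x
      hd.hasFDerivAt).fderiv
    have h2 : gradient u =
      (InnerProductSpace.toDual ℝ E).symm.toContinuousLinearEquiv ∘ (fderiv ℝ u) := rfl
    rw [h2, this]; rfl
  rw [h1, h1, InnerProductSpace.toDual_symm_apply, real_inner_comm,
    InnerProductSpace.toDual_symm_apply]
  exact ((hu.contDiffAt (hO.mem_nhds hx)).isSymmSndFDerivAt (by simp)).eq _ _

theorem hasFDerivAt_comp_norm {G : E → E} {H : E →L[ℝ] E} {x : E} (hG : HasFDerivAt G H x)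
    (h0 : G x ≠ 0) {κ : ℝ → ℝ} {k : ℝ} (hκ : HasDerivAt κ k ‖G x‖) :
    HasFDerivAt (fun x => κ ‖G x‖) ((k * ‖G x‖⁻¹) • (innerSL ℝ (G x)).comp H) x := by
  have hn : ‖G x‖ ≠ 0 := norm_ne_zero_iff.2 h0
  have h1 := hG.norm_sq.sqrt (pow_ne_zero 2 hn)
  simp only [Real.sqrt_sq (norm_nonneg _)] at h1
  convert! hκ.comp_hasFDerivAt x h1 using 1
  ext y
  simp
  field_simp

variable [MeasurableSpace E] [BorelSpace E]

/-- `A` extended by zero may jump at `0`, so measurability of the weight comes from monotonicity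
instead of continuity. -/
theorem integrable_weight_mul {A : ℝ → ℝ} (hA : Monotone A) {G : E → E} {K : Set E}
    (hK : IsCompact K) (hG : ContinuousOn G K) {w : E → ℝ} (hw : Continuous w)
    (h0 : ∀ x, x ∉ K → w x = 0) : Integrable fun x => A ‖G x‖ * w x := by
  refine (integrableOn_iff_integrable_of_support_subset (s := K) fun x hx => ?_).1 ?_
  · by_contra h
    exact hx (by simp [h0 x h])
  · obtain ⟨R, hR⟩ := hK.exists_bound_of_continuousOn hG
    have hm : AEStronglyMeasurable (fun x => A ‖G x‖) (volume.restrict K) :=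
      (hA.measurable.comp_aemeasurable
        (hG.norm.aemeasurable hK.measurableSet)).aestronglyMeasurable
    refine Integrable.bdd_mul (c := max |A 0| |A R|) (hw.continuousOn.integrableOn_compact hK) hm ?_
    filter_upwards [ae_restrict_mem hK.measurableSet] with x hx
    exact abs_le_max_abs_abs (hA (norm_nonneg _)) (hA (hR x hx))

set_option maxHeartbeats 2000000 in
/-- Near the critical set of a solution with positive source, the measure with density
`1 / A(|∇u|)` satisfies a Poincaré inequality with respect to the energy weight `A(|∇u|)`. -/
theorem hardy_near_critical {A B f : ℝ → ℝ} {M D : ℝ} (hA : DegenerateA A M D)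
    (hB : ContDiffOn ℝ 1 B (Ioi 0)) {Lb : ℝ} (hLb : 0 ≤ Lb)
    (hBd : ∀ t, 0 < t → t ≤ 1 → |deriv B t| ≤ Lb) (hBc : ContinuousOn B (Ici 0)) {L : ℝ≥0} (hf : LipschitzWith L f)
    {Ω : Set E} (hΩ : IsOpen Ω) {u : E → ℝ} (hu : ContDiffOn ℝ 1 u Ω)
    (hu2 : ContDiffOn ℝ 2 u {x ∈ Ω | gradient u x ≠ 0})
    (hw : WeakDiv Ω (fun x => A ‖gradient u x‖ • gradient u x)
      fun x => f (u x) - B ‖gradient u x‖) {c : ℝ} (hc : 0 < c) :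
    ∃ C ε₁ : ℝ, 0 < C ∧ 0 < ε₁ ∧ ∀ ε : ℝ, 0 < ε → ε ≤ ε₁ → ∀ (σ : ℝ) (θ m : ℝ → ℝ), 0 < σ →
      TruncationProfile σ θ m → ∀ φ : E → ℝ, ContDiff ℝ 1 φ → HasCompactSupport φ →
      tsupport φ ⊆ Ω → (∀ x, 0 ≤ φ x) →
      (∀ x, φ x ≠ 0 → ‖gradient u x‖ ≤ ε ∧ c ≤ f (u x) - B ‖gradient u x‖) →
      ∫ x, (A (θ ‖gradient u x‖))⁻¹ * φ x ^ 2 ≤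
        C * ε ^ 2 * ∫ x, A ‖gradient u x‖ * ‖fderiv ℝ φ x‖ ^ 2 := by
  set C₀ := 8 / c + 16 * M ^ 2 / c * (1 + M) ^ 2 with hC₀
  have hC₀0 : 0 < C₀ := by have := hA.M_nonneg; positivity
  set S := 4 * M ^ 2 / c * (Lb ^ 2 * D + L * D * A 1) with hS
  have hS0 : 0 ≤ S := by
    have := hA.D_nonneg; have := hA.nonneg 1; positivity
  -- `ε² S ≤ c / 2` is the smallness condition of `quadratic_absorption`. The cap at `1` in the
  -- witness gives `x² ≤ x`, and the later cap `ε ≤ 1` gives `A(|∇u|) ≤ A 1` on the support of `φ`.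
  obtain ⟨ε₂, hε₂, hε₂S⟩ : ∃ ε₂ : ℝ, 0 < ε₂ ∧ ε₂ ^ 2 * S ≤ c / 2 := by
    refine ⟨min 1 (c / (2 * (S + 1))), by positivity, ?_⟩
    have h1 : min 1 (c / (2 * (S + 1))) ^ 2 ≤ c / (2 * (S + 1)) := by
      have e1 : min 1 (c / (2 * (S + 1))) ≤ 1 := min_le_left _ _
      have e2 : min 1 (c / (2 * (S + 1))) ≤ c / (2 * (S + 1)) := min_le_right _ _
      have e3 : 0 ≤ min 1 (c / (2 * (S + 1))) := by positivity
      nlinarith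
    calc _ ≤ c / (2 * (S + 1)) * (S + 1) := by gcongr; linarith
      _ = c / 2 := by field_simp
  refine ⟨4 / c * C₀, min 1 ε₂, by positivity, by positivity, ?_⟩
  intro ε hε hεle σ θ m hσ hθ φ hφ hφc hφs hφ0 hcond
  have hε1 : ε ≤ 1 := hεle.trans (min_le_left _ _)
  have hεS : 4 * M ^ 2 / c * ε ^ 2 * (Lb ^ 2 * D + L * D * A 1) ≤ c / 2 := by
    have : ε ^ 2 * S ≤ ε₂ ^ 2 * S := by
      gcongr; exact hεle.trans (min_le_right _ _)
    calc _ = ε ^ 2 * S := by rw [hS]; ring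
      _ ≤ _ := this.trans hε₂S
  set G := gradient u with hGdef
  set K := tsupport φ with hK
  have hKc : IsCompact K := hφc
  set O := {x ∈ Ω | G x ≠ 0} with hOdef
  have hG : ContinuousOn G Ω := continuousOn_gradient hΩ hu
  have hO : IsOpen O := hG.isOpen_inter_preimage hΩ isOpen_ne
  have hOΩ : O ⊆ Ω := fun x hx => hx.1
  have hG1 : ContDiffOn ℝ 1 G O := contDiffOn_gradient hO hu2
  have hGd : ∀ x ∈ O, HasFDerivAt G (fderiv ℝ G x) x := fun x hx =>
    ((hG1.differentiableOn one_ne_zero).differentiableAt (hO.mem_nhds hx)).hasFDerivAt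
  have hnorm : ContDiffOn ℝ 1 (fun x => ‖G x‖) O := hG1.norm ℝ fun x hx => hx.2
  have hmaps : MapsTo (fun x => ‖G x‖) O (Ioi 0) := fun x hx => norm_pos_iff.2 hx.2
  have hθC : ContDiff ℝ 1 θ := by
    rw [contDiff_one_iff_deriv]
    refine ⟨fun t => (hθ.hasDerivAt t).differentiableAt, ?_⟩
    rw [funext fun t => (hθ.hasDerivAt t).deriv]
    exact hθ.contDiff.continuous
  have hθpos : ∀ t, 0 < θ t := fun t => by linarith [hθ.const_le t]
  have hAθ : ∀ t, 0 < A (θ t) := fun t => hA.pos _ (hθpos t)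
  have hq1 : ContDiff ℝ 1 fun t => (A (θ t))⁻¹ := by
    refine ContDiff.inv ?_ fun t => (hAθ t).ne'
    exact contDiff_iff_contDiffAt.2 fun t =>
      (hA.contDiffOn.contDiffAt (Ioi_mem_nhds (hθpos t))).comp t hθC.contDiffAt
  have hqd : ∀ t, HasDerivAt (fun t => (A (θ t))⁻¹)
      (-(deriv A (θ t) * m t) / A (θ t) ^ 2) t := fun t =>
    (((differentiableAt_of_contDiffOn_Ioi hA.contDiffOn (hθpos t)).hasDerivAt.comp t
      (hθ.hasDerivAt t)).inv (hAθ t).ne')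
  let X : E → E := fun x => A ‖G x‖ • G x
  let r : E → ℝ := fun x => (A (θ ‖G x‖))⁻¹
  -- `ψ` tests the equation itself; `V` tests the linearized one.
  let ψ : E → ℝ := fun x => φ x ^ 2 * r x
  let V : E → E := fun x => (m ‖G x‖ * φ x ^ 2) • G x
  let β : E → ℝ := fun x => B ‖G x‖
  have hXc : ContinuousOn X Ω := (continuous_flux hA.contDiffOn hA.tendsto).comp_continuousOn hG
  have hX1 : ContDiffOn ℝ 1 X O := (hA.contDiffOn.comp hnorm hmaps).smul hG1
  have hβ1 : ContDiffOn ℝ 1 β O := hB.comp hnorm hmaps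
  have hβc : ContinuousOn β Ω := hBc.comp hG.norm fun x _ => mem_Ici.2 (norm_nonneg _)
  -- Around a critical point `|∇u| < σ`, where `θ` is constant. So `r` is locally constant there,
  -- hence `C¹` on all of `Ω`, although `∇u` is differentiable only off the critical set.
  have hsmall : ∀ x ∈ Ω, G x = 0 → ∀ᶠ y in 𝓝 x, ‖G y‖ < σ := fun x hx h0 =>
    (hG.continuousAt (hΩ.mem_nhds hx)).norm.eventually_lt continuousAt_const (by simpa [h0])
  have hr1 : ContDiffOn ℝ 1 r Ω := fun x hx => by
    refine ContDiffAt.contDiffWithinAt ?_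
    by_cases h0 : G x = 0
    · refine (contDiffAt_const (c := (A (2 * σ))⁻¹)).congr_of_eventuallyEq ?_
      filter_upwards [hsmall x hx h0] with y hy
      simp only [r, hθ.eq_const _ hy.le]
    · exact hq1.contDiffAt.comp x (hnorm.contDiffAt (hO.mem_nhds ⟨hx, h0⟩))
  have hψK : ∀ x, x ∉ K → ψ x = 0 := fun x hx => by
    simp [ψ, image_eq_zero_of_notMem_tsupport hx]
  have hψsK : tsupport ψ ⊆ K := closure_minimal
    (fun x hx => by by_contra h; exact hx (hψK x h)) (isClosed_tsupport φ)
  have hψ1 : ContDiff ℝ 1 ψ := contDiff_of_contDiffOn_of_tsupport_subset hΩ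
    ((hφ.contDiffOn.pow 2).mul hr1) (hψsK.trans hφs)
  have hψc : HasCompactSupport ψ := hKc.of_isClosed_subset (isClosed_tsupport _) hψsK
  -- `m` vanishes up to `σ`, so `V` is supported in `{|∇u| ≥ σ}`, inside the region where `u` is
  -- `C²`.
  set K' := K ∩ (fun x => ‖G x‖) ⁻¹' Ici σ with hK'
  have hK'cl : IsClosed K' :=
    ((hG.mono hφs).norm).preimage_isClosed_of_isClosed (isClosed_tsupport φ) isClosed_Ici
  have hK'O : K' ⊆ O := fun x hx => ⟨hφs hx.1, norm_pos_iff.1 (hσ.trans_le hx.2)⟩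
  have hVsK : tsupport V ⊆ K' := by
    refine closure_minimal (fun x hx => ?_) hK'cl
    by_contra h
    apply hx
    by_cases hxK : x ∈ K
    · have : ‖G x‖ < σ := by
        by_contra h'
        exact h ⟨hxK, not_lt.1 h'⟩
      simp [V, hθ.eq_zero _ this.le]
    · simp [V, image_eq_zero_of_notMem_tsupport hxK]
  have hVs : tsupport V ⊆ O := hVsK.trans hK'O
  have hV1 : ContDiff ℝ 1 V := contDiff_of_contDiffOn_of_tsupport_subset hO
    (((hθ.contDiff.comp_contDiffOn hnorm).mul (hφ.contDiffOn.pow 2)).smul hG1) hVs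
  have hVc : HasCompactSupport V :=
    (hKc.inter_right (t := tsupport V) (isClosed_tsupport _)).of_isClosed_subset
      (isClosed_tsupport _) fun x hx => ⟨(hVsK hx).1, hx⟩
  have hhc : ContinuousOn (fun x => f (u x) - β x) Ω :=
    (hf.continuous.comp_continuousOn hu.continuousOn).sub hβc
  have I1 := hw.integral_eq hΩ hXc hhc hψ1 hψc (hψsK.trans hφs)
  have hwO : WeakDiv O X fun x => f (u x) - β x := fun ζ h1 h2 h3 => hw ζ h1 h2 (h3.trans hOΩ)
  let b := stdOrthonormalBasis ℝ E
  obtain ⟨hF2i, hF2⟩ := hwO.integral_linearized_le b hO hf hX1 (hu.mono hOΩ) hβ1 hV1 hVc hVs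
  set F₂ : E → ℝ := fun x => ∑ j, inner ℝ (b j) (fderiv ℝ V x (fderiv ℝ X x (b j))) +
    fderiv ℝ β x (V x) - L * |fderiv ℝ u x (V x)| with hF₂
  let F₁ : E → ℝ := fun x => fderiv ℝ ψ x (X x) - (f (u x) - β x) * ψ x
  have hi1 := integrable_fderiv_apply hXc hψ1 hψc (hψsK.trans hφs)
  have hi2 := integrable_mul_of_tsupport hhc hψ1.continuous hψc (hψsK.trans hφs)
  have hF1i : Integrable F₁ := hi1.sub hi2
  have hF1 : ∫ x, F₁ x = 0 := by
    simp only [F₁]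
    rw [integral_sub hi1 hi2, I1, sub_self]
  have hEi : Integrable fun x => A ‖G x‖ * ‖fderiv ℝ φ x‖ ^ 2 :=
    integrable_weight_mul hA.mono hKc (hG.mono hφs)
      ((hφ.continuous_fderiv one_ne_zero).norm.pow 2)
      fun x hx => by simp [fderiv_eq_zero_of_notMem_tsupport hx]
  have pointwise : ∀ x, c / 4 * (r x * φ x ^ 2) ≤
      -F₁ x + 4 * M ^ 2 / c * F₂ x + C₀ * ε ^ 2 * (A ‖G x‖ * ‖fderiv ℝ φ x‖ ^ 2) := by
    intro x
    have hEnn : 0 ≤ C₀ * ε ^ 2 * (A ‖G x‖ * ‖fderiv ℝ φ x‖ ^ 2) := by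
      have := hA.nonneg ‖G x‖; positivity
    have hVout : x ∉ O → F₂ x = 0 := fun hx => by
      have hx' : x ∉ tsupport V := fun h => hx (hVs h)
      simp [hF₂, fderiv_eq_zero_of_notMem_tsupport hx', image_eq_zero_of_notMem_tsupport hx']
    have hF₁eq : F₁ x = fderiv ℝ ψ x (X x) - (f (u x) - β x) * ψ x := rfl
    have hDV : x ∈ O → ∀ y, fderiv ℝ V x y = (m ‖G x‖ * φ x ^ 2) • fderiv ℝ G x y +
        ((deriv m ‖G x‖ * ‖G x‖⁻¹) * inner ℝ (G x) (fderiv ℝ G x y) * φ x ^ 2 +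
          m ‖G x‖ * (2 * φ x * fderiv ℝ φ x y)) • G x := fun hx y => by
      have h1 := hasFDerivAt_comp_norm (hGd x hx) hx.2
        ((hθ.contDiff.differentiable one_ne_zero) ‖G x‖).hasDerivAt
      have h2 := ((hφ.differentiable one_ne_zero) x).hasFDerivAt.pow 2
      have e0 : fderiv ℝ V x = _ := ((h1.mul h2).smul (hGd x hx)).fderiv
      rw [e0]
      simp
      module
    by_cases hφx : φ x = 0
    -- Where `φ` vanishes nothing is known about the gradient of `u`, but `φ` and `ψ` are minimal
    -- there and their derivatives vanish.
    · have hmin : IsLocalMin φ x := Eventually.of_forall fun y => by simpa [hφx] using hφ0 y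
      have hψmin : IsLocalMin ψ x := Eventually.of_forall fun y => by
        have h1 : ψ x = 0 := by simp [ψ, hφx]
        rw [h1]
        exact mul_nonneg (sq_nonneg _) (inv_nonneg.2 (hAθ _).le)
      have e1 : F₁ x = 0 := by
        rw [hF₁eq, hψmin.fderiv_eq_zero]; simp [ψ, hφx]
      have e2 : F₂ x = 0 := by
        by_cases hxO : x ∈ O
        · have hV0 : V x = 0 := by simp [V, hφx]
          simp only [hF₂, hDV hxO, hV0, hmin.fderiv_eq_zero, hφx]
          simp
        · exact hVout hxO
      rw [e1, e2, hφx]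
      simpa using hEnn
    obtain ⟨htε, hcx⟩ := hcond x hφx
    have hxΩ : x ∈ Ω := hφs (subset_tsupport _ hφx)
    have hqx : 0 < r x := inv_pos.2 (hAθ _)
    by_cases hG0 : G x = 0
    -- At a critical point the flux and `F₂` vanish, and the bound is the positivity of the source
    -- alone.
    · rw [hVout fun h => h.2 hG0, hF₁eq]
      have e1 : X x = 0 := by simp [X, hG0]
      rw [e1, map_zero]
      have e2 : c * (r x * φ x ^ 2) ≤ (f (u x) - β x) * ψ x := by
        have : ψ x = r x * φ x ^ 2 := mul_comm _ _
        rw [this]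
        exact mul_le_mul_of_nonneg_right hcx (by positivity)
      have e3 : 0 ≤ c * (r x * φ x ^ 2) := by positivity
      linarith
    have hxO : x ∈ O := ⟨hxΩ, hG0⟩
    set t := ‖G x‖ with ht
    have ht0 : 0 < t := norm_pos_iff.2 hG0
    have hsym := inner_fderiv_gradient_symm hO hu2 hxO
    set H := fderiv ℝ G x with hH
    set s := ∑ j, ‖H (b j)‖ ^ 2 with hs
    have hs0 : 0 ≤ s := Finset.sum_nonneg fun j _ => sq_nonneg _
    set h := √s with hh
    have hh0 : 0 ≤ h := Real.sqrt_nonneg _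
    have hh2 : h ^ 2 = s := Real.sq_sqrt hs0
    have hHG : ‖H (G x)‖ ≤ h * t := by
      refine abs_le_of_sq_le_sq' ?_ (by positivity) |>.2
      rw [mul_pow, hh2]
      exact norm_apply_sq_le_sum b hsym (G x)
    have hGHG : |(inner ℝ (G x) (H (G x)) : ℝ)| ≤ h * t ^ 2 := by
      refine (abs_real_inner_le_norm _ _).trans ?_
      calc _ ≤ t * (h * t) := by gcongr
        _ = _ := by ring
    have hdA := differentiableAt_of_contDiffOn_Ioi hA.contDiffOn ht0
    have hat := hA.pos t ht0
    have hA'0 : ∀ s, 0 ≤ deriv A s := fun s => hA.mono.deriv_nonneg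
    set ℓ := fderiv ℝ φ x with hℓ
    set d := ‖ℓ‖ with hd
    have hd0 : 0 ≤ d := norm_nonneg _
    have hp0 := hφ0 x
    have hDX : ∀ y, fderiv ℝ X x y =
        A t • H y + ((deriv A t * t⁻¹) * inner ℝ (G x) (H y)) • G x := fun y => by
      have e0 : fderiv ℝ X x = _ :=
        ((hasFDerivAt_comp_norm (hGd x hxO) hG0 hdA.hasDerivAt).smul (hGd x hxO)).fderiv
      rw [e0]
      simp [← ht, ← hH]
    have htr := sum_inner_linearized_eq b hsym (G x) ℓ (A t) (deriv A t * t⁻¹) (m t)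
      (deriv m t * t⁻¹) (φ x) (fderiv ℝ X x) (fderiv ℝ V x) hDX (hDV hxO)
    have hℓG : |ℓ (G x)| ≤ d * t := ℓ.le_opNorm _
    have hℓHG : |ℓ (H (G x))| ≤ d * (h * t) :=
      (ℓ.le_opNorm _).trans (mul_le_mul_of_nonneg_left hHG hd0)
    have hmt0 := hθ.nonneg t
    have hAd := hA.deriv_le t ht0
    refine quadratic_absorption (p := φ x) (d := d) (t := t) (a := A t) (h := h) (m := m t)
      (q := r x) (D := D) (Lb := Lb) (L := L) (A₁ := A 1) ht0.le htε hat
      (hA.mono (htε.trans hε1)) hmt0 (hθ.le_one t) hqx ?_ ?_ hc hA.M_nonneg hA.D_nonneg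
      L.coe_nonneg hεS ?_ ?_ |>.trans_eq' ?_
    · rw [← div_eq_mul_inv, div_le_one (hAθ t)]
      exact hA.mono (hθ.le_self t)
    -- Below `σ` the slope is zero; above it `θ t ≤ 3 * t`, and doubling applies.
    · rcases le_or_gt t σ with hts | hts
      · rw [hθ.eq_zero t hts]
        have := hA.D_nonneg; positivity
      · refine (hθ.le_one t).trans ?_
        rw [← div_eq_mul_inv, one_le_div (hAθ t)]
        refine hA.doubling _ t ht0 ((hθ.le_max t).trans ?_)
        rw [max_eq_left hts.le]
    · have hψd := (((hφ.differentiable one_ne_zero) x).hasFDerivAt.pow 2).mul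
        (hasFDerivAt_comp_norm (hGd x hxO) hG0 (hqd t))
      have e1 : fderiv ℝ ψ x (X x) = 2 * φ x * (A t * ℓ (G x)) * r x -
          φ x ^ 2 * (m t * (A t * inner ℝ (G x) (H (G x))) * (deriv A (θ t) * t⁻¹ * r x ^ 2)) := by
        have e0 : fderiv ℝ ψ x = _ := hψd.fderiv
        rw [e0]
        simp [X, r, ← ht, ← hH, ← hℓ]
        ring
      have e2 : c * φ x ^ 2 * r x ≤ (f (u x) - β x) * ψ x := by
        have : ψ x = φ x ^ 2 * r x := rfl
        rw [this, mul_assoc]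
        exact mul_le_mul_of_nonneg_right hcx (by positivity)
      have e3 : 2 * φ x * (A t * ℓ (G x)) * r x ≤ 2 * φ x * (A t * (d * t)) * r x := by
        gcongr
        exact (le_abs_self _).trans hℓG
      have e4 : deriv A (θ t) * t⁻¹ * r x ^ 2 * t ^ 2 ≤ M * r x := by
        have h1 := hA.deriv_le (θ t) (hθpos t)
        have h2 : t * deriv A (θ t) ≤ M * A (θ t) :=
          (mul_le_mul_of_nonneg_right (hθ.le_self t) (hA'0 _)).trans h1
        have h3 : A (θ t) * r x = 1 := mul_inv_cancel₀ (hAθ t).ne'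
        calc deriv A (θ t) * t⁻¹ * r x ^ 2 * t ^ 2 = (t * deriv A (θ t)) * r x ^ 2 := by
              field_simp
          _ ≤ (M * A (θ t)) * r x ^ 2 := by gcongr
          _ = M * r x * (A (θ t) * r x) := by ring
          _ = M * r x := by rw [h3, mul_one]
      have e5 : -(φ x ^ 2 * (m t * (A t * inner ℝ (G x) (H (G x))) *
          (deriv A (θ t) * t⁻¹ * r x ^ 2))) ≤
          φ x ^ 2 * (m t * (A t * (h * t ^ 2)) * (deriv A (θ t) * t⁻¹ * r x ^ 2)) := by
        have h1 : -(inner ℝ (G x) (H (G x)) : ℝ) ≤ h * t ^ 2 := (neg_le_abs _).trans hGHG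
        have h2 := hA'0 (θ t)
        have h3 : 0 ≤ φ x ^ 2 * (m t * A t * (deriv A (θ t) * t⁻¹ * r x ^ 2)) := by positivity
        have := mul_le_mul_of_nonneg_left h1 h3
        linarith
      have e6 : φ x ^ 2 * (m t * (A t * (h * t ^ 2)) * (deriv A (θ t) * t⁻¹ * r x ^ 2)) ≤
          φ x ^ 2 * (m t * (A t * h)) * (M * r x) := by
        have h3 : 0 ≤ φ x ^ 2 * (m t * (A t * h)) := by positivity
        have := mul_le_mul_of_nonneg_left e4 h3
        linarith
      rw [hF₁eq, e1]
      linarith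
    · have hVx : V x = (m t * φ x ^ 2) • G x := rfl
      have e1 : fderiv ℝ β x (V x) = deriv B t * t⁻¹ * (m t * φ x ^ 2 * inner ℝ (G x) (H (G x))) := by
        have hdB := differentiableAt_of_contDiffOn_Ioi hB ht0
        have e0 : fderiv ℝ β x = _ := (hasFDerivAt_comp_norm (hGd x hxO) hG0 hdB.hasDerivAt).fderiv
        rw [e0, hVx]
        simp [← ht, ← hH]
        ring
      have e2 : |fderiv ℝ u x (V x)| = m t * φ x ^ 2 * t ^ 2 := by
        rw [← inner_gradient_left, hVx, inner_smul_right]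
        have : (inner ℝ (gradient u x) (G x) : ℝ) = t ^ 2 := real_inner_self_eq_norm_sq _
        rw [this, abs_of_nonneg (by positivity)]
      have e3 : -(Lb * m t * φ x ^ 2 * h * t) ≤
          deriv B t * t⁻¹ * (m t * φ x ^ 2 * inner ℝ (G x) (H (G x))) := by
        refine neg_le_of_abs_le ?_
        rw [abs_mul, abs_mul, abs_mul, abs_of_pos (inv_pos.2 ht0),
          abs_of_nonneg (by positivity : 0 ≤ m t * φ x ^ 2)]
        calc _ ≤ Lb * t⁻¹ * (m t * φ x ^ 2 * (h * t ^ 2)) := by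
              gcongr; exact hBd t ht0 (htε.trans hε1)
          _ = _ := by field_simp
      have hm'0 := hθ.deriv_nonneg t
      have hA't := hA'0 t
      -- Convexity of `θ` and monotonicity of `A` give these second-order terms a favourable sign,
      -- so they are dropped.
      have e4 : 0 ≤ φ x ^ 2 * ((m t * (deriv A t * t⁻¹) + deriv m t * t⁻¹ * A t) * ‖H (G x)‖ ^ 2 +
          deriv m t * t⁻¹ * (deriv A t * t⁻¹) * (inner ℝ (G x) (H (G x))) ^ 2) := by positivity
      have e5 : -(A t * (d * (h * t)) + M * A t * (h * (d * t))) ≤ A t * ℓ (H (G x)) +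
          deriv A t * t⁻¹ * inner ℝ (G x) (H (G x)) * ℓ (G x) := by
        have h1 : A t * -ℓ (H (G x)) ≤ A t * (d * (h * t)) := by
          gcongr; exact (neg_le_abs _).trans hℓHG
        have h2 : |deriv A t * t⁻¹ * inner ℝ (G x) (H (G x)) * ℓ (G x)| ≤
            M * A t * (h * (d * t)) := by
          rw [abs_mul, abs_mul, abs_of_nonneg (by positivity : 0 ≤ deriv A t * t⁻¹)]
          calc _ ≤ deriv A t * t⁻¹ * (h * t ^ 2) * (d * t) := by gcongr
            _ = (t * deriv A t) * (h * (d * t)) := by field_simp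
            _ ≤ _ := by gcongr
        linarith [neg_abs_le (deriv A t * t⁻¹ * inner ℝ (G x) (H (G x)) * ℓ (G x))]
      have e6 : 2 * φ x * m t * -(A t * (d * (h * t)) + M * A t * (h * (d * t))) ≤
          2 * φ x * m t * (A t * ℓ (H (G x)) +
          deriv A t * t⁻¹ * inner ℝ (G x) (H (G x)) * ℓ (G x)) := by
        gcongr
      have e7 : F₂ x = ∑ j, inner ℝ (b j) (fderiv ℝ V x (fderiv ℝ X x (b j))) +
        fderiv ℝ β x (V x) - L * |fderiv ℝ u x (V x)| := rfl
      rw [e7, htr, e1, e2, hh2]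
      linarith
    · ring
  -- On integration `F₁` contributes zero by the equation and `F₂` at most zero by the linearized
  -- equation, leaving only the energy term.
  have hmono := integral_mono ((integrable_mul_of_tsupport (k := r) (hr1.continuousOn) (hφ.continuous.pow 2) ?_ ?_).const_mul (c / 4))
    ((hF1i.neg.add (hF2i.const_mul (4 * M ^ 2 / c))).add (hEi.const_mul (C₀ * ε ^ 2))) pointwise
  · have e1 : ∫ x, (-F₁ x + 4 * M ^ 2 / c * F₂ x + C₀ * ε ^ 2 * (A ‖G x‖ * ‖fderiv ℝ φ x‖ ^ 2)) =
        4 * M ^ 2 / c * (∫ x, F₂ x) + C₀ * ε ^ 2 * ∫ x, A ‖G x‖ * ‖fderiv ℝ φ x‖ ^ 2 := by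
      have i1 : Integrable fun x => -F₁ x + 4 * M ^ 2 / c * F₂ x :=
        hF1i.neg.add (hF2i.const_mul (4 * M ^ 2 / c))
      have i2 : Integrable fun x => -F₁ x := hF1i.neg
      rw [integral_add i1 (hEi.const_mul _), integral_add i2 (hF2i.const_mul _), integral_neg, hF1,
        integral_const_mul, integral_const_mul]
      ring
    have e2 : 4 * M ^ 2 / c * (∫ x, F₂ x) ≤ 0 :=
      mul_nonpos_of_nonneg_of_nonpos (by positivity) hF2
    have e3 : c / 4 * ∫ x, r x * φ x ^ 2 ≤
        C₀ * ε ^ 2 * ∫ x, A ‖G x‖ * ‖fderiv ℝ φ x‖ ^ 2 := by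
      rw [← integral_const_mul]
      refine hmono.trans ?_
      refine (le_of_eq e1).trans ?_
      linarith
    have e4 : c ≠ 0 := hc.ne'
    calc ∫ x, r x * φ x ^ 2 = 4 / c * (c / 4 * ∫ x, r x * φ x ^ 2) := by
          rw [← mul_assoc, div_mul_div_cancel₀' (by norm_num), div_self e4, one_mul]
      _ ≤ 4 / c * (C₀ * ε ^ 2 * ∫ x, A ‖G x‖ * ‖fderiv ℝ φ x‖ ^ 2) := by gcongr
      _ = _ := by ring
  · exact hKc.of_isClosed_subset (isClosed_tsupport _) (closure_minimal (fun x hx => by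
      by_contra h; exact hx (by simp [image_eq_zero_of_notMem_tsupport h])) (isClosed_tsupport φ))
  · exact (closure_minimal (fun x hx => by
      by_contra h; exact hx (by simp [image_eq_zero_of_notMem_tsupport h])) (isClosed_tsupport φ)).trans hφs

end Hardy

/-! ### Poincaré inequalities in domains of small measure -/

section SmallDomain

variable {E : Type*} [NormedAddCommGroup E] [InnerProductSpace ℝ E] [FiniteDimensional ℝ E]
  [MeasurableSpace E] [BorelSpace E]

theorem integrable_sq_of_hasCompactSupport {φ : E → ℝ} (hφ : Continuous φ)
    (hc : HasCompactSupport φ) : Integrable fun x => φ x ^ 2 :=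
  integrable_of_continuousOn_of_eq_zero hc (hφ.pow 2).continuousOn fun x hx => by
    simp [image_eq_zero_of_notMem_tsupport hx]

theorem integrable_norm_fderiv_sq {φ : E → ℝ} (hφ : ContDiff ℝ 1 φ)
    (hc : HasCompactSupport φ) : Integrable fun x => ‖fderiv ℝ φ x‖ ^ 2 :=
  integrable_of_continuousOn_of_eq_zero hc
    ((hφ.continuous_fderiv one_ne_zero).norm.pow 2).continuousOn fun x hx => by
      simp [fderiv_eq_zero_of_notMem_tsupport hx]

/-- The Gagliardo–Nirenberg–Sobolev inequality for `W^{1,1}` is applied to `φ²`. Hölder's inequality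
on `W` gains the factor `|W|^(1/n)`, and `∇(φ²) = 2φ∇φ` lets Young's inequality absorb half of `∫
φ²`. -/
theorem exists_small_domain_poincare (hdim : 2 ≤ Module.finrank ℝ E) {κ : ℝ} (hκ : 0 < κ) :
    ∃ δ : ℝ, 0 < δ ∧ ∀ W : Set E, volume W ≤ ENNReal.ofReal δ → ∀ φ : E → ℝ, ContDiff ℝ 1 φ →
      HasCompactSupport φ → (∀ x, x ∉ W → φ x = 0) →
      ∫ x, φ x ^ 2 ≤ κ * ∫ x, ‖fderiv ℝ φ x‖ ^ 2 := by
  set n := Module.finrank ℝ E with hn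
  have hn1 : (1 : ℝ≥0) < n := by exact_mod_cast (by omega : 1 < n)
  set p := NNReal.conjExponent (n : ℝ≥0) with hp
  have hpc : NNReal.HolderConjugate (n : ℝ≥0) p := NNReal.HolderConjugate.conjExponent hn1
  set C := eLpNormLESNormFDerivOneConst (volume : Measure E) p with hC
  set η := √κ / (2 * (C + 1)) with hη
  have hη0 : 0 < η := by positivity
  refine ⟨η ^ n, by positivity, fun W hW φ hφ hc h0 => ?_⟩
  have hφ2 : ContDiff ℝ 1 fun x => φ x ^ 2 := hφ.pow 2
  have hc2 : HasCompactSupport fun x => φ x ^ 2 :=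
    hc.of_isClosed_subset (isClosed_tsupport _) (closure_minimal (fun x hx => by
      by_contra h; exact hx (by simp [image_eq_zero_of_notMem_tsupport h])) (isClosed_tsupport φ))
  have s1 := eLpNorm_le_eLpNorm_fderiv_one (volume : Measure E) hφ2 hc2 hpc
  have hp1 : (1 : ENNReal) ≤ p := by exact_mod_cast hpc.symm.lt.le
  have hsupp : Function.support (fun x => φ x ^ 2) ⊆ W := fun x hx => by
    by_contra h
    exact hx (by simp [h0 x h])
  have s2 : eLpNorm (fun x => φ x ^ 2) 1 volume ≤
      eLpNorm (fun x => φ x ^ 2) p volume * ENNReal.ofReal η := by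
    rw [← eLpNorm_restrict_eq_of_support_subset hsupp,
      ← eLpNorm_restrict_eq_of_support_subset (p := p) hsupp]
    refine (eLpNorm_le_eLpNorm_mul_rpow_measure_univ hp1
      hφ2.continuous.aestronglyMeasurable).trans ?_
    gcongr
    rw [Measure.restrict_apply_univ]
    have hexp : 1 / (1 : ENNReal).toReal - 1 / ((p : ENNReal)).toReal = (n : ℝ)⁻¹ := by
      have := hpc.coe.inv_add_inv_eq_one
      simp only [ENNReal.toReal_one, ENNReal.coe_toReal, one_div, inv_one]
      have h3 : ((n : ℝ≥0) : ℝ) = (n : ℝ) := by simp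
      rw [h3] at this
      linarith
    rw [hexp]
    calc volume W ^ ((n : ℝ)⁻¹) ≤ ENNReal.ofReal (η ^ n) ^ ((n : ℝ)⁻¹) := by gcongr
      _ = ENNReal.ofReal η := by
        rw [ENNReal.ofReal_rpow_of_pos (by positivity), Real.pow_rpow_inv_natCast hη0.le (by omega)]
  have hfd : ∀ x, fderiv ℝ (fun x => φ x ^ 2) x = (2 * φ x) • fderiv ℝ φ x := fun x => by
    rw [(((hφ.differentiable one_ne_zero) x).hasFDerivAt.pow 2).fderiv]; simp
  have hi1 := integrable_sq_of_hasCompactSupport hφ.continuous hc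
  have hi2 := integrable_norm_fderiv_sq hφ hc
  have hi3 : Integrable (fderiv ℝ fun x => φ x ^ 2) :=
    (hφ2.continuous_fderiv one_ne_zero).integrable_of_hasCompactSupport (hc2.fderiv ℝ)
  have s3 : ENNReal.ofReal (∫ x, φ x ^ 2) ≤
      ENNReal.ofReal (C * η * ∫ x, ‖fderiv ℝ (fun x => φ x ^ 2) x‖) := by
    have e1 : ENNReal.ofReal (∫ x, φ x ^ 2) = eLpNorm (fun x => φ x ^ 2) 1 volume := by
      rw [eLpNorm_one_eq_lintegral_enorm, ← ofReal_integral_norm_eq_lintegral_enorm hi1]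
      congr 1
      exact integral_congr_ae (Eventually.of_forall fun x => by simp)
    rw [e1, ENNReal.ofReal_mul (by positivity), ENNReal.ofReal_mul (by positivity),
      ofReal_integral_norm_eq_lintegral_enorm hi3, ← eLpNorm_one_eq_lintegral_enorm,
      ENNReal.ofReal_coe_nnreal]
    refine s2.trans ?_
    calc _ ≤ (C * eLpNorm (fderiv ℝ fun x => φ x ^ 2) 1 volume) * ENNReal.ofReal η := by gcongr
      _ = _ := by ring
  have s4 : ∫ x, φ x ^ 2 ≤ C * η * ∫ x, ‖fderiv ℝ (fun x => φ x ^ 2) x‖ :=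
    (ENNReal.ofReal_le_ofReal_iff (by positivity)).1 s3
  have s5 : C * η * ∫ x, ‖fderiv ℝ (fun x => φ x ^ 2) x‖ ≤
      1 / 2 * (∫ x, φ x ^ 2) + 2 * (C * η) ^ 2 * ∫ x, ‖fderiv ℝ φ x‖ ^ 2 := by
    rw [← integral_const_mul, ← integral_const_mul, ← integral_const_mul,
      ← integral_add (hi1.const_mul _) (hi2.const_mul _)]
    refine integral_mono (hi3.norm.const_mul _) ((hi1.const_mul _).add (hi2.const_mul _))
      fun x => ?_
    simp only [hfd, norm_smul, Real.norm_eq_abs, abs_mul, abs_two]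
    have := sq_nonneg (|φ x| - 2 * (C * η) * ‖fderiv ℝ φ x‖)
    have e := sq_abs (φ x)
    nlinarith
  have s6 : 4 * (C * η) ^ 2 ≤ κ := by
    have h1 : 2 * (C * η) ≤ √κ := by
      rw [hη, mul_div_assoc', mul_div_assoc', div_le_iff₀ (by positivity)]
      nlinarith [Real.sqrt_nonneg κ, C.coe_nonneg]
    calc 4 * (C * η) ^ 2 = (2 * (C * η)) ^ 2 := by ring
      _ ≤ √κ ^ 2 := by gcongr
      _ = κ := Real.sq_sqrt hκ.le
  have s7 : 0 ≤ ∫ x, ‖fderiv ℝ φ x‖ ^ 2 := integral_nonneg fun x => sq_nonneg _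
  have s8 := mul_le_mul_of_nonneg_right s6 s7
  linarith

/-- A smooth cutoff between sublevel and superlevel sets of `‖G‖`. -/
theorem exists_gradient_cutoff {S : Set E} (hS : IsCompact (closure S)) {G : E → E}
    (hG : UniformContinuousOn G S) {a b : ℝ} (hab : a < b) :
    ∃ (η : E → ℝ) (L : ℝ), ContDiff ℝ 1 η ∧ (∀ x, 0 ≤ η x) ∧ (∀ x, η x ≤ 1) ∧
      (∀ x ∈ S, ‖G x‖ ≤ a → η x = 1) ∧ (∀ x ∈ S, b ≤ ‖G x‖ → η x = 0) ∧ 0 ≤ L ∧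
      ∀ x ∈ S, ‖fderiv ℝ η x‖ ≤ L := by
  set S₁ := closure {x ∈ S | b ≤ ‖G x‖}
  set S₂ := closure {x ∈ S | ‖G x‖ ≤ a}
  -- `S` need not be closed; uniform continuity of `G` keeps the two sets a positive distance apart,
  -- hence also their closures.
  have hdisj : Disjoint S₁ S₂ := by
    rw [Set.disjoint_left]
    intro x h1 h2
    obtain ⟨δ, hδ, h⟩ := Metric.uniformContinuousOn_iff.1 hG (b - a) (by linarith)
    obtain ⟨y, hy, hxy⟩ := Metric.mem_closure_iff.1 h1 (δ / 2) (by positivity)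
    obtain ⟨z, hz, hxz⟩ := Metric.mem_closure_iff.1 h2 (δ / 2) (by positivity)
    have h3 := h y hy.1 z hz.1 ((dist_triangle_left y z x).trans_lt (by linarith))
    rw [dist_eq_norm] at h3
    have := norm_sub_norm_le (G y) (G z)
    linarith [hy.2, hz.2]
  obtain ⟨η, h1, h2, h3, h4⟩ := exists_contMDiff_zero_iff_one_iff_of_isClosed
    (modelWithCornersSelf ℝ E) (n := 1) (isClosed_closure : IsClosed S₁)
    (isClosed_closure : IsClosed S₂) hdisj
  have hη : ContDiff ℝ 1 η := h1.contDiff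
  obtain ⟨L, hL⟩ := hS.exists_bound_of_continuousOn
    (hη.continuous_fderiv one_ne_zero).continuousOn
  exact ⟨η, max L 0, hη, fun x => (h2 ⟨x, rfl⟩).1, fun x => (h2 ⟨x, rfl⟩).2,
    fun x hx h => (h4 x).1 (subset_closure ⟨hx, h⟩), fun x hx h => (h3 x).1 (subset_closure ⟨hx, h⟩),
    le_max_right _ _, fun x hx => (hL x (subset_closure hx)).trans (le_max_left _ _)⟩

theorem norm_fderiv_mul_sq_le {η φ : E → ℝ} (hη : ContDiff ℝ 1 η) (hφ : ContDiff ℝ 1 φ) (x : E) :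
    ‖fderiv ℝ (fun y => η y * φ y) x‖ ^ 2 ≤
      2 * (η x ^ 2 * ‖fderiv ℝ φ x‖ ^ 2) + 2 * (‖fderiv ℝ η x‖ ^ 2 * φ x ^ 2) := by
  have h1 : fderiv ℝ (fun y => η y * φ y) x = η x • fderiv ℝ φ x + φ x • fderiv ℝ η x :=
    fderiv_fun_mul (hη.differentiable one_ne_zero x) (hφ.differentiable one_ne_zero x)
  have h2 : ‖fderiv ℝ (fun y => η y * φ y) x‖ ≤
      |η x| * ‖fderiv ℝ φ x‖ + |φ x| * ‖fderiv ℝ η x‖ := by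
    rw [h1]
    refine (norm_add_le _ _).trans ?_
    rw [norm_smul, norm_smul, Real.norm_eq_abs, Real.norm_eq_abs]
  calc _ ≤ (|η x| * ‖fderiv ℝ φ x‖ + |φ x| * ‖fderiv ℝ η x‖) ^ 2 := by gcongr
    _ ≤ 2 * (|η x| * ‖fderiv ℝ φ x‖) ^ 2 + 2 * (|φ x| * ‖fderiv ℝ η x‖) ^ 2 := by
      nlinarith [sq_nonneg (|η x| * ‖fderiv ℝ φ x‖ - |φ x| * ‖fderiv ℝ η x‖)]
    _ = _ := by rw [mul_pow, mul_pow, sq_abs, sq_abs]; ring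

theorem tsupport_mul_subset (η φ : E → ℝ) : tsupport (fun y => η y * φ y) ⊆ tsupport φ :=
  closure_mono fun x hx h => hx (by
    have : φ x = 0 := h
    simp [this])

/-- In a domain of small measure, the energy with weight `A(|∇u|)` controls the `L²` norm with
(truncated) weight `1 / A(|∇u|)`, with a small constant. -/
theorem exists_small_domain_weighted_poincare (hdim : 2 ≤ Module.finrank ℝ E)
    {A B f : ℝ → ℝ} {M D : ℝ} (hA : DegenerateA A M D)
    (hB : ContDiffOn ℝ 1 B (Ioi 0)) {Lb : ℝ} (hLb : 0 ≤ Lb)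
    (hBd : ∀ t, 0 < t → t ≤ 1 → |deriv B t| ≤ Lb) (hBc : ContinuousOn B (Ici 0)) {L : ℝ≥0}
    (hf : LipschitzWith L f)
    {Ω : Set E} (hΩ : IsOpen Ω) {u : E → ℝ} (hu : ContDiffOn ℝ 1 u Ω)
    (hu2 : ContDiffOn ℝ 2 u {x ∈ Ω | gradient u x ≠ 0})
    (hw : WeakDiv Ω (fun x => A ‖gradient u x‖ • gradient u x)
      fun x => f (u x) - B ‖gradient u x‖)
    {S : Set E} (hSΩ : S ⊆ Ω) (hS : IsCompact (closure S)) (hG : UniformContinuousOn (gradient u) S)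
    {R : ℝ} (hR0 : 0 < R) (hR : ∀ x ∈ S, ‖gradient u x‖ ≤ R) {c ε₀ : ℝ} (hc : 0 < c) (hε₀ : 0 < ε₀)
    (hcS : ∀ x ∈ S, ‖gradient u x‖ ≤ ε₀ → c ≤ f (u x) - B ‖gradient u x‖) {κ : ℝ} (hκ : 0 < κ) :
    ∃ δ : ℝ, 0 < δ ∧ ∀ W : Set E, W ⊆ S → volume W ≤ ENNReal.ofReal δ →
      ∀ (σ : ℝ) (θ m : ℝ → ℝ), 0 < σ → σ ≤ R → TruncationProfile σ θ m →
      ∀ φ : E → ℝ, ContDiff ℝ 1 φ → HasCompactSupport φ → tsupport φ ⊆ W → (∀ x, 0 ≤ φ x) →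
      Integrable (fun x => (A (θ ‖gradient u x‖))⁻¹ * φ x ^ 2) ∧
      Integrable (fun x => A ‖gradient u x‖ * ‖fderiv ℝ φ x‖ ^ 2) ∧
      ∫ x, (A (θ ‖gradient u x‖))⁻¹ * φ x ^ 2 ≤
        κ * ∫ x, A ‖gradient u x‖ * ‖fderiv ℝ φ x‖ ^ 2 := by
  obtain ⟨C, ε₁, hC, hε₁, hardy⟩ := hardy_near_critical hA hB hLb hBd hBc hf hΩ hu hu2 hw hc
  -- The level `ε` is fixed by the Hardy constant before the measure bound `δ`: the Lipschitz
  -- constants of the cutoffs depend on `ε` and are compensated later by `κ₂`.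
  obtain ⟨ε, hε, hεε₀, hεε₁, hCε⟩ : ∃ ε : ℝ, 0 < ε ∧ ε ≤ ε₀ ∧ ε ≤ ε₁ ∧ 2 * (C * ε ^ 2) ≤ κ / 4 := by
    set e := √(κ / (8 * C)) with he
    have he0 : 0 < e := by positivity
    refine ⟨min (min ε₀ ε₁) e, by positivity, (min_le_left _ _).trans (min_le_left _ _),
      (min_le_left _ _).trans (min_le_right _ _), ?_⟩
    calc 2 * (C * min (min ε₀ ε₁) e ^ 2) ≤ 2 * (C * e ^ 2) := by
          gcongr; exact min_le_right _ _
      _ = κ / 4 := by rw [he, Real.sq_sqrt (by positivity)]; field_simp; norm_num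
  obtain ⟨η, Lη, hη, hη0, hη1, hηone, hηzero, hLη0, hLη⟩ :=
    exists_gradient_cutoff hS hG (by linarith : ε / 2 < ε)
  obtain ⟨ξ, Lξ, hξ, hξ0, hξ1, hξone, hξzero, hLξ0, hLξ⟩ :=
    exists_gradient_cutoff hS hG (by linarith : ε / 4 < ε / 2)
  -- `η φ` is treated by the Hardy-type inequality, `χ φ` by the unweighted one. On `S`, `χ = 1`
  -- wherever `|∇u| ≥ ε / 2`, which contains the region where `η` varies, while `χ` vanishes for
  -- `|∇u| ≤ ε / 4`.
  set χ : E → ℝ := fun x => 1 - ξ x with hχdef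
  have hχ : ContDiff ℝ 1 χ := contDiff_const.sub hξ
  have hχd : ∀ x, ‖fderiv ℝ χ x‖ = ‖fderiv ℝ ξ x‖ := fun x => by
    rw [hχdef, fderiv_const_sub, norm_neg]
  have hA2 : 0 < A (ε / 2) := hA.pos _ (by positivity)
  have hA4 : 0 < A (ε / 4) := hA.pos _ (by positivity)
  have hAR : 0 < A R := hA.pos _ hR0
  have hA3R : 0 < A (3 * R) := hA.pos _ (by positivity)
  -- With `I` the weighted norm, `En` the energy and `J = ∫ (χ φ)²`, the estimates below read `I ≤ 2
  -- C ε² En + γ J` and `J ≤ κ₂ (a En + b I)`. The choice of `κ₂` absorbs half of `I`.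
  set γ := C * ε ^ 2 * (2 * (Lη ^ 2 * A R)) + (A (ε / 2))⁻¹ with hγ
  have hγ0 : 0 < γ := by positivity
  set a := 2 * (A (ε / 4))⁻¹ with ha
  set b := 2 * (Lξ ^ 2 * A (3 * R)) with hb
  have ha0 : 0 < a := by positivity
  have hb0 : 0 ≤ b := by positivity
  obtain ⟨κ₂, hκ₂, hk1, hk2⟩ : ∃ κ₂ : ℝ, 0 < κ₂ ∧ γ * κ₂ * a ≤ κ / 4 ∧ γ * κ₂ * b ≤ 1 / 2 := by
    refine ⟨min (κ / (4 * γ * a)) (1 / (2 * γ * (b + 1))), by positivity, ?_, ?_⟩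
    · calc _ ≤ γ * (κ / (4 * γ * a)) * a := by gcongr; exact min_le_left _ _
        _ = κ / 4 := by field_simp
    · calc _ ≤ γ * (1 / (2 * γ * (b + 1))) * (b + 1) := by
            gcongr
            · exact min_le_right _ _
            · linarith
        _ = 1 / 2 := by field_simp
  obtain ⟨δ, hδ, hpoin⟩ := exists_small_domain_poincare hdim hκ₂
  refine ⟨δ, hδ, fun W hWS hWδ σ θ m hσ hσR hθ φ hφ hφc hφW hφ0 => ?_⟩
  set G := gradient u with hGdef
  have hφS : tsupport φ ⊆ S := hφW.trans hWS
  have hGS : ContinuousOn G S := hG.continuousOn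
  have hθpos : ∀ t, 0 < θ t := fun t => by linarith [hθ.const_le t]
  have hAθ : ∀ t, 0 < A (θ t) := fun t => hA.pos _ (hθpos t)
  have hθc : Continuous θ := continuous_iff_continuousAt.2 fun t => (hθ.hasDerivAt t).continuousAt
  have hqc : Continuous fun t => (A (θ t))⁻¹ :=
    (continuous_iff_continuousAt.2 fun t => ContinuousAt.comp (f := θ)
      (differentiableAt_of_contDiffOn_Ioi hA.contDiffOn (hθpos t)).continuousAt
      hθc.continuousAt).inv₀ fun t => (hAθ t).ne'
  set q : E → ℝ := fun x => (A (θ ‖G x‖))⁻¹ with hq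
  have hq0 : ∀ x, 0 < q x := fun x => inv_pos.2 (hAθ _)
  have hqS : ContinuousOn q S := hqc.comp_continuousOn hGS.norm
  have hIq : ∀ ζ : E → ℝ, Continuous ζ → tsupport ζ ⊆ tsupport φ →
      Integrable fun x => q x * ζ x ^ 2 := fun ζ hζ hs =>
    integrable_of_continuousOn_of_eq_zero hφc ((hqS.mono hφS).mul (hζ.pow 2).continuousOn)
      fun x hx => by simp [image_eq_zero_of_notMem_tsupport fun h => hx (hs h)]
  have hIA : ∀ ζ : E → ℝ, ContDiff ℝ 1 ζ → tsupport ζ ⊆ tsupport φ →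
      Integrable fun x => A ‖G x‖ * ‖fderiv ℝ ζ x‖ ^ 2 := fun ζ hζ hs =>
    integrable_weight_mul hA.mono hφc (hGS.mono hφS)
      ((hζ.continuous_fderiv one_ne_zero).norm.pow 2)
      fun x hx => by simp [fderiv_eq_zero_of_notMem_tsupport fun h => hx (hs h)]
  have hηφ := hη.mul hφ
  have hχφ := hχ.mul hφ
  have hsη := tsupport_mul_subset η φ
  have hsχ := tsupport_mul_subset χ φ
  have hcη : HasCompactSupport fun y => η y * φ y := hφc.of_isClosed_subset (isClosed_tsupport _) hsη
  have hcχ : HasCompactSupport fun y => χ y * φ y := hφc.of_isClosed_subset (isClosed_tsupport _) hsχ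
  have hsupp : ∀ x, φ x ≠ 0 → x ∈ S := fun x hx => hφS (subset_tsupport _ hx)
  have hi := hIq φ hφ.continuous le_rfl
  have hE := hIA φ hφ le_rfl
  have hSχ := integrable_sq_of_hasCompactSupport hχφ.continuous hcχ
  refine ⟨hi, hE, ?_⟩
  set I := ∫ x, q x * φ x ^ 2 with hIdef
  set En := ∫ x, A ‖G x‖ * ‖fderiv ℝ φ x‖ ^ 2 with hEndef
  set J := ∫ x, (χ x * φ x) ^ 2 with hJdef
  have r1 : ∫ x, q x * (η x * φ x) ^ 2 ≤
      C * ε ^ 2 * ∫ x, A ‖G x‖ * ‖fderiv ℝ (fun y => η y * φ y) x‖ ^ 2 := by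
    refine hardy ε hε hεε₁ σ θ m hσ hθ _ hηφ hcη (hsη.trans (hφS.trans hSΩ))
      (fun x => mul_nonneg (hη0 x) (hφ0 x)) fun x hx => ?_
    have hxS : x ∈ S := hsupp x (right_ne_zero_of_mul hx)
    have hxε : ‖G x‖ ≤ ε := by
      by_contra h
      exact left_ne_zero_of_mul hx (hηzero x hxS (not_le.1 h).le)
    exact ⟨hxε, hcS x hxS (hxε.trans hεε₀)⟩
  have r2 : ∫ x, A ‖G x‖ * ‖fderiv ℝ (fun y => η y * φ y) x‖ ^ 2 ≤
      2 * En + 2 * (Lη ^ 2 * A R) * J := by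
    rw [hEndef, hJdef, ← integral_const_mul, ← integral_const_mul,
      ← integral_add (hE.const_mul _) (hSχ.const_mul _)]
    refine integral_mono (hIA _ hηφ hsη) ((hE.const_mul _).add (hSχ.const_mul _)) fun x => ?_
    beta_reduce
    by_cases hx : x ∈ tsupport φ
    · have hxS := hφS hx
      have hAx : A ‖G x‖ ≤ A R := hA.mono (hR x hxS)
      have hAx0 := hA.nonneg ‖G x‖
      have e1 : ‖fderiv ℝ η x‖ ^ 2 * φ x ^ 2 ≤ Lη ^ 2 * (χ x * φ x) ^ 2 := by
        rcases le_or_gt ‖G x‖ (ε / 2) with h | h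
        -- `η` attains its global maximum `1` here, so its derivative vanishes even if `x` is not
        -- interior to `S`.
        · have hmax : IsLocalMax η x := Eventually.of_forall fun y => by
            rw [hηone x hxS h]; exact hη1 y
          rw [hmax.fderiv_eq_zero]
          simp; positivity
        · have : χ x = 1 := by simp [hχdef, hξzero x hxS h.le]
          rw [this, one_mul]
          gcongr
          exact hLη x hxS
      have e2 : η x ^ 2 ≤ 1 := pow_le_one₀ (hη0 x) (hη1 x)
      calc _ ≤ A ‖G x‖ * (2 * (η x ^ 2 * ‖fderiv ℝ φ x‖ ^ 2) +
            2 * (‖fderiv ℝ η x‖ ^ 2 * φ x ^ 2)) := by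
            gcongr; exact norm_fderiv_mul_sq_le hη hφ x
        _ ≤ A ‖G x‖ * (2 * (1 * ‖fderiv ℝ φ x‖ ^ 2)) + A R * (2 * (Lη ^ 2 * (χ x * φ x) ^ 2)) := by
            rw [mul_add]; gcongr
        _ = _ := by ring
    · rw [fderiv_eq_zero_of_notMem_tsupport fun h => hx (hsη h)]
      have := hA.nonneg ‖G x‖
      simp; positivity
  have r3 : I ≤ (∫ x, q x * (η x * φ x) ^ 2) + (A (ε / 2))⁻¹ * J := by
    rw [hIdef, hJdef, ← integral_const_mul,
      ← integral_add (hIq _ hηφ.continuous hsη) (hSχ.const_mul _)]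
    refine integral_mono hi ((hIq _ hηφ.continuous hsη).add (hSχ.const_mul _)) fun x => ?_
    beta_reduce
    have hqx := hq0 x
    by_cases hx : φ x = 0
    · simp [hx]
    · have hxS := hsupp x hx
      rcases le_or_gt ‖G x‖ (ε / 2) with h | h
      · rw [hηone x hxS h, one_mul]
        have : 0 ≤ (A (ε / 2))⁻¹ * (χ x * φ x) ^ 2 := by positivity
        linarith
      · have e1 : χ x = 1 := by simp [hχdef, hξzero x hxS h.le]
        have e2 : q x ≤ (A (ε / 2))⁻¹ := by
          have := hA.mono (h.le.trans (hθ.le_self ‖G x‖))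
          exact inv_anti₀ hA2 this
        have e3 : q x * φ x ^ 2 ≤ (A (ε / 2))⁻¹ * φ x ^ 2 := by gcongr
        have e4 : 0 ≤ q x * (η x * φ x) ^ 2 := by positivity
        rw [e1, one_mul]
        linarith
  have r4 : J ≤ κ₂ * (a * En + b * I) := by
    refine (hpoin W hWδ _ hχφ hcχ fun x hx => ?_).trans ?_
    · have : φ x = 0 := image_eq_zero_of_notMem_tsupport fun h => hx (hφW h)
      simp [this]
    · gcongr
      rw [hEndef, hIdef, ← integral_const_mul, ← integral_const_mul,
        ← integral_add (hE.const_mul _) (hi.const_mul _)]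
      refine integral_mono (integrable_norm_fderiv_sq hχφ hcχ)
        ((hE.const_mul _).add (hi.const_mul _)) fun x => ?_
      beta_reduce
      by_cases hx : x ∈ tsupport φ
      · have hxS := hφS hx
        have hχ0 : 0 ≤ χ x := sub_nonneg.2 (hξ1 x)
        have hχ1 : χ x ≤ 1 := by simp only [hχdef]; linarith [hξ0 x]
        have e1 : χ x ^ 2 ≤ (A (ε / 4))⁻¹ * A ‖G x‖ := by
          rcases le_or_gt ‖G x‖ (ε / 4) with h | h
          · have : χ x = 0 := by simp [hχdef, hξone x hxS h]
            rw [this]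
            have := hA.nonneg ‖G x‖
            simp; positivity
          · refine (pow_le_one₀ hχ0 hχ1).trans ?_
            rw [← div_eq_inv_mul, one_le_div hA4]
            exact hA.mono h.le
        have e2 : φ x ^ 2 ≤ A (3 * R) * (q x * φ x ^ 2) := by
          have h1 : A (θ ‖G x‖) ≤ A (3 * R) := hA.mono ((hθ.le_max _).trans (by
            gcongr; exact max_le (hR x hxS) hσR))
          have h2 : 1 ≤ A (3 * R) * q x := by
            rw [hq, ← div_eq_mul_inv, one_le_div (hAθ _)]; exact h1
          calc φ x ^ 2 = 1 * φ x ^ 2 := by ring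
            _ ≤ A (3 * R) * q x * φ x ^ 2 := by gcongr
            _ = _ := by ring
        refine (norm_fderiv_mul_sq_le hχ hφ x).trans ?_
        rw [hχd]
        calc _ ≤ 2 * ((A (ε / 4))⁻¹ * A ‖G x‖ * ‖fderiv ℝ φ x‖ ^ 2) +
              2 * (Lξ ^ 2 * (A (3 * R) * (q x * φ x ^ 2))) := by
              gcongr; exact hLξ x hxS
          _ = _ := by ring
      · have h0 : φ x = 0 := image_eq_zero_of_notMem_tsupport hx
        rw [fderiv_eq_zero_of_notMem_tsupport fun h => hx (hsχ h), h0]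
        have := hA.nonneg ‖G x‖
        simp; positivity
  have hEn0 : 0 ≤ En := integral_nonneg fun x => by have := hA.nonneg ‖G x‖; positivity
  have hI0 : 0 ≤ I := integral_nonneg fun x => by have := hq0 x; positivity
  have r5 : I ≤ 2 * (C * ε ^ 2) * En + γ * J := by
    have : C * ε ^ 2 * (∫ x, A ‖G x‖ * ‖fderiv ℝ (fun y => η y * φ y) x‖ ^ 2) ≤
        C * ε ^ 2 * (2 * En + 2 * (Lη ^ 2 * A R) * J) := by gcongr
    rw [hγ]
    linarith
  have r6 : γ * J ≤ γ * (κ₂ * (a * En + b * I)) := by gcongr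
  have r7 : γ * κ₂ * a * En ≤ κ / 4 * En := by gcongr
  have r8 : γ * κ₂ * b * I ≤ 1 / 2 * I := by gcongr
  have r9 : 2 * (C * ε ^ 2) * En ≤ κ / 4 * En := by gcongr
  linarith

end SmallDomain

/-! ### Powers of the truncated difference as test functions -/

theorem hasDerivAt_max_zero_pow (n : ℕ) (s : ℝ) :
    HasDerivAt (fun s : ℝ => max s 0 ^ (n + 2)) ((n + 2) * max s 0 ^ (n + 1)) s := by
  rcases lt_trichotomy s 0 with hs | hs | hs
  · have h : (fun s : ℝ => max s 0 ^ (n + 2)) =ᶠ[𝓝 s] fun _ => 0 := by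
      filter_upwards [Iio_mem_nhds hs] with y hy
      simp [max_eq_right (le_of_lt (mem_Iio.1 hy))]
    rw [max_eq_right hs.le]
    simpa using (hasDerivAt_const s (0 : ℝ)).congr_of_eventuallyEq h
  · subst hs
    have h0 : HasDerivAt (fun s : ℝ => s ^ 2) 0 0 := by simpa using hasDerivAt_pow 2 (0 : ℝ)
    rw [hasDerivAt_iff_isLittleO] at h0 ⊢
    refine Asymptotics.IsBigO.trans_isLittleO (Asymptotics.IsBigO.of_bound 1 ?_) h0
    filter_upwards [Icc_mem_nhds (show (-1 : ℝ) < 0 by norm_num) (show (0 : ℝ) < 1 by norm_num)]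
      with y hy
    have hm : 0 ≤ max y 0 := le_max_right _ _
    have hm1 : max y 0 ≤ 1 := max_le hy.2 zero_le_one
    have hmy : max y 0 ≤ |y| := max_le (le_abs_self y) (abs_nonneg y)
    have h1 : max y 0 ^ (n + 2) ≤ y ^ 2 := by
      calc max y 0 ^ (n + 2) ≤ max y 0 ^ 2 := pow_le_pow_of_le_one hm hm1 (by omega)
        _ ≤ |y| ^ 2 := pow_le_pow_left₀ hm hmy 2
        _ = y ^ 2 := sq_abs y
    have h2 : 0 ≤ max y 0 ^ (n + 2) := pow_nonneg hm _
    simpa [abs_of_nonneg hm] using h1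
  · have h : (fun s : ℝ => max s 0 ^ (n + 2)) =ᶠ[𝓝 s] fun s => s ^ (n + 2) := by
      filter_upwards [Ioi_mem_nhds hs] with y hy
      rw [max_eq_left (le_of_lt hy)]
    rw [max_eq_left hs.le]
    have := (hasDerivAt_pow (n + 2) s).congr_of_eventuallyEq h
    push_cast at this
    exact this

theorem contDiff_max_zero_pow (n : ℕ) : ContDiff ℝ 1 fun s : ℝ => max s 0 ^ (n + 2) := by
  rw [contDiff_one_iff_deriv]
  refine ⟨fun s => (hasDerivAt_max_zero_pow n s).differentiableAt, ?_⟩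
  have : deriv (fun s : ℝ => max s 0 ^ (n + 2)) = fun s : ℝ => ((n : ℝ) + 2) * max s 0 ^ (n + 1) :=
    funext fun s => (hasDerivAt_max_zero_pow n s).deriv
  rw [this]
  fun_prop

section Comparison

variable {E : Type*} [NormedAddCommGroup E] [InnerProductSpace ℝ E] [FiniteDimensional ℝ E]
  [MeasurableSpace E] [BorelSpace E]

/-- `(d - k)₊` in `W`, extended by zero. -/
noncomputable def excess (W : Set E) (d : E → ℝ) (k : ℝ) : E → ℝ :=
  W.indicator fun x => max (d x - k) 0

theorem excess_nonneg (W : Set E) (d : E → ℝ) (k : ℝ) (x : E) : 0 ≤ excess W d k x :=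
  indicator_nonneg (fun _ _ => le_max_right _ _) x

theorem excess_of_mem {W : Set E} {d : E → ℝ} {k : ℝ} {x : E} (hx : x ∈ W) :
    excess W d k x = max (d x - k) 0 := indicator_of_mem hx _

theorem excess_of_notMem {W : Set E} {d : E → ℝ} {k : ℝ} {x : E} (hx : x ∉ W) :
    excess W d k x = 0 := indicator_of_notMem hx _

/-- The support lies in `closure W ∩ {d ≥ k}`, which is compact and avoids the frontier because `d ≤
0 < k` there. An exponent of at least two makes the positive part `C¹`. -/
theorem excess_pow_isTest {W : Set E} (hW : IsOpen W) (hWc : IsCompact (closure W)) {d : E → ℝ}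
    (hd : ContDiffOn ℝ 1 d W) (hdc : ContinuousOn d (closure W))
    (hfr : ∀ x ∈ frontier W, d x ≤ 0) {k : ℝ} (hk : 0 < k) (n : ℕ) :
    ContDiff ℝ 1 (fun x => excess W d k x ^ (n + 2)) ∧
    HasCompactSupport (fun x => excess W d k x ^ (n + 2)) ∧
    tsupport (fun x => excess W d k x ^ (n + 2)) ⊆ W ∧
    ∀ x, fderiv ℝ (fun x => excess W d k x ^ (n + 2)) x =
      ((n + 2) * excess W d k x ^ (n + 1)) • fderiv ℝ d x := by
  set T : Set E := closure W ∩ d ⁻¹' Ici k with hT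
  have hTcl : IsClosed T := hdc.preimage_isClosed_of_isClosed isClosed_closure isClosed_Ici
  have hTc : IsCompact T := hWc.of_isClosed_subset hTcl inter_subset_left
  have hTW : T ⊆ W := fun x hx => by
    by_contra hxW
    have : x ∈ frontier W := by rw [hW.frontier_eq]; exact ⟨hx.1, hxW⟩
    have h1 := hfr x this
    have h2 : k ≤ d x := hx.2
    linarith
  have hsupp : tsupport (fun x => excess W d k x ^ (n + 2)) ⊆ T := by
    refine closure_minimal (fun x hx => ?_) hTcl
    have hx0 : excess W d k x ≠ 0 := fun h => hx (by simp [h])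
    have hxW : x ∈ W := by
      by_contra h
      exact hx0 (excess_of_notMem h)
    rw [excess_of_mem hxW] at hx0
    refine ⟨subset_closure hxW, ?_⟩
    by_contra h
    exact hx0 (max_eq_right (by simp only [mem_preimage, mem_Ici, not_le] at h; linarith))
  have heq : EqOn (fun x => excess W d k x ^ (n + 2)) (fun x => max (d x - k) 0 ^ (n + 2)) W :=
    fun x hx => by simp only [excess_of_mem hx]
  have hC : ContDiffOn ℝ 1 (fun x => excess W d k x ^ (n + 2)) W :=
    ((contDiff_max_zero_pow n).comp_contDiffOn (hd.sub contDiffOn_const)).congr heq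
  refine ⟨contDiff_of_contDiffOn_of_tsupport_subset hW hC (hsupp.trans hTW),
    hTc.of_isClosed_subset (isClosed_tsupport _) hsupp, hsupp.trans hTW, fun x => ?_⟩
  by_cases hx : x ∈ W
  · have hdx : HasFDerivAt d (fderiv ℝ d x) x :=
      ((hd.differentiableOn one_ne_zero).differentiableAt (hW.mem_nhds hx)).hasFDerivAt
    have h1 : HasFDerivAt (fun y => max (d y - k) 0 ^ (n + 2))
        (((n + 2) * max (d x - k) 0 ^ (n + 1) : ℝ) • fderiv ℝ d x) x :=
      by
      simpa only [Function.comp_def] using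
        (hasDerivAt_max_zero_pow n (d x - k)).comp_hasFDerivAt x (hdx.sub_const k)
    have h2 := (h1.congr_of_eventuallyEq (heq.eventuallyEq_of_mem (hW.mem_nhds hx))).fderiv
    rw [h2, excess_of_mem hx]
  · rw [fderiv_eq_zero_of_notMem_tsupport fun h => hx (hTW (hsupp h)), excess_of_notMem hx]
    simp

/-- A point with `d > 0` has a ball on which the excess stays above a fixed `η` for all small `k`,
so the integral cannot tend to zero with `k`. -/
theorem nonpos_of_integral_excess_le {W : Set E} (hW : IsOpen W) (hWc : IsCompact (closure W))
    {d : E → ℝ} (hd : ContDiffOn ℝ 1 d W) (hdc : ContinuousOn d (closure W))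
    (hfr : ∀ x ∈ frontier W, d x ≤ 0) {C k₀ : ℝ} (hk₀ : 0 < k₀)
    (h : ∀ k, 0 < k → k < k₀ → ∫ x, (excess W d k x ^ 2) ^ 2 ≤ C * k) : ∀ x ∈ W, d x ≤ 0 := by
  intro x₁ hx₁
  by_contra! hpos
  set η := d x₁ / 4 with hη
  have hη0 : 0 < η := by positivity
  have hcont : ContinuousAt d x₁ := hd.continuousOn.continuousAt (hW.mem_nhds hx₁)
  have hev : ∀ᶠ x in 𝓝 x₁, x ∈ W ∧ 2 * η < d x :=
    (hW.eventually_mem hx₁).and (hcont.eventually_const_lt (by rw [hη]; linarith))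
  obtain ⟨r, hr, hball⟩ := Metric.eventually_nhds_iff_ball.1 hev
  set U := Metric.ball x₁ r with hU
  have hUpos : 0 < volume.real U :=
    ENNReal.toReal_pos (Metric.measure_ball_pos volume x₁ hr).ne' measure_ball_lt_top.ne
  have key : ∀ k, 0 < k → k < k₀ → k < η → (η ^ 2) ^ 2 * volume.real U ≤ C * k := by
    intro k hk hkk hkη
    refine le_trans ?_ (h k hk hkk)
    obtain ⟨hC, hcs, -, -⟩ := excess_pow_isTest hW hWc hd hdc hfr hk 0
    have hint := integrable_sq_of_hasCompactSupport hC.continuous hcs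
    calc (η ^ 2) ^ 2 * volume.real U = ∫ x in U, (η ^ 2) ^ 2 := by
          rw [setIntegral_const, smul_eq_mul, mul_comm]
      _ ≤ ∫ x in U, (excess W d k x ^ 2) ^ 2 := by
          refine setIntegral_mono_on (integrableOn_const measure_ball_lt_top.ne)
            hint.integrableOn measurableSet_ball fun x hx => ?_
          obtain ⟨hxW, hxd⟩ := hball x hx
          have : η ≤ excess W d k x := by
            rw [excess_of_mem hxW]
            exact le_max_of_le_left (by linarith)
          gcongr
      _ ≤ ∫ x, (excess W d k x ^ 2) ^ 2 :=
          setIntegral_le_integral hint (Eventually.of_forall fun x => by positivity)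
  have hlim : Tendsto (fun k : ℝ => C * k) (𝓝[>] 0) (𝓝 (C * 0)) :=
    ((continuous_const.mul continuous_id).tendsto 0).mono_left nhdsWithin_le_nhds
  rw [mul_zero] at hlim
  have : (η ^ 2) ^ 2 * volume.real U ≤ 0 := by
    refine ge_of_tendsto hlim ?_
    filter_upwards [self_mem_nhdsWithin, mem_nhdsWithin_of_mem_nhds (Iio_mem_nhds hk₀),
      mem_nhdsWithin_of_mem_nhds (Iio_mem_nhds hη0)] with k h1 h2 h3 using key k h1 h2 h3
  have : 0 < (η ^ 2) ^ 2 * volume.real U := by positivity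
  linarith

/-- Testing the difference of two equations with the cube of the truncated difference. -/
theorem le_of_energy_bounds {Ω : Set E} (hΩ : IsOpen Ω) {A B f : ℝ → ℝ}
    (hA : Continuous fun ξ : E => A ‖ξ‖ • ξ) (hB : ContinuousOn B (Ici 0)) (hf : Continuous f)
    {u v : E → ℝ} (hu : ContDiffOn ℝ 1 u Ω) (hv : ContDiffOn ℝ 1 v Ω)
    (hwu : WeakDiv Ω (fun x => A ‖gradient u x‖ • gradient u x)
      fun x => f (u x) - B ‖gradient u x‖)
    (hwv : WeakDiv Ω (fun x => A ‖gradient v x‖ • gradient v x)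
      fun x => f (v x) - B ‖gradient v x‖)
    {W : Set E} (hW : IsOpen W) (hWΩ : W ⊆ Ω) (hWc : IsCompact (closure W))
    (huc : ContinuousOn u (closure W)) (hvc : ContinuousOn v (closure W))
    (hfr : ∀ x ∈ frontier W, u x ≤ v x) {a C Q κ k₀ e : ℝ} (ha : 0 < a) (hC : 0 ≤ C) (hQ : 0 ≤ Q)
    (hκ : 0 ≤ κ) (hCκ : C * κ ≤ a / 2) (hk₀ : 0 < k₀) (he : 0 ≤ e)
    (h : ∀ k, 0 < k → k < k₀ → ∃ p q : E → ℝ,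
      (∀ φ : E → ℝ, ContDiff ℝ 1 φ → HasCompactSupport φ → tsupport φ ⊆ W → (∀ x, 0 ≤ φ x) →
        Integrable (fun x => q x * φ x ^ 2) ∧ Integrable (fun x => p x * ‖fderiv ℝ φ x‖ ^ 2) ∧
        ∫ x, q x * φ x ^ 2 ≤ κ * ∫ x, p x * ‖fderiv ℝ φ x‖ ^ 2) ∧
      (∀ x ∈ W, 1 ≤ Q * q x) ∧
      ∀ x ∈ W, ∀ g, 0 < g → u x - v x = g + k →
        a * (p x * (2 * g * ‖gradient u x - gradient v x‖) ^ 2) - C * (q x * (g ^ 2) ^ 2) - e * k ≤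
          3 * g ^ 2 * inner ℝ (A ‖gradient u x‖ • gradient u x - A ‖gradient v x‖ • gradient v x)
              (gradient u x - gradient v x) +
            (B ‖gradient u x‖ - B ‖gradient v x‖) * g ^ 3 - (f (u x) - f (v x)) * g ^ 3) :
    ∀ x ∈ W, u x ≤ v x := by
  set d : E → ℝ := fun x => u x - v x with hd
  have hdC : ContDiffOn ℝ 1 d W := (hu.mono hWΩ).sub (hv.mono hWΩ)
  have hdc : ContinuousOn d (closure W) := huc.sub hvc
  have hdfr : ∀ x ∈ frontier W, d x ≤ 0 := fun x hx => sub_nonpos.2 (hfr x hx)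
  have hvolW : volume W ≠ ⊤ := ((measure_mono subset_closure).trans_lt hWc.measure_lt_top).ne
  suffices H : ∀ x ∈ W, d x ≤ 0 from fun x hx => sub_nonpos.1 (H x hx)
  refine nonpos_of_integral_excess_le (C := Q * (κ * (2 * (e * volume.real W) / a)))
    hW hWc hdC hdc hdfr hk₀ fun k hk hkk => ?_
  obtain ⟨p, q, hpq, hq, hpt⟩ := h k hk hkk
  set g := excess W d k with hg
  have hg0 : ∀ x, 0 ≤ g x := excess_nonneg W d k
  -- Exponent shift `0` gives `g²`, to which the Poincaré hypothesis is applied; shift `1` gives the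
  -- test function `g³`.
  obtain ⟨hφC, hφc, hφs, hφd⟩ := excess_pow_isTest hW hWc hdC hdc hdfr hk 0
  obtain ⟨hψC, hψc, hψs, hψd⟩ := excess_pow_isTest hW hWc hdC hdc hdfr hk 1
  rw [← hg] at hφC hφc hφs hφd hψC hψc hψs hψd
  simp only [Nat.cast_zero, zero_add, pow_one, Nat.cast_one] at hφC hφc hφs hφd hψC hψc hψs hψd
  norm_num at hψC hψc hψs hψd
  obtain ⟨hI2, hI1, hP⟩ := hpq (fun x => g x ^ 2) hφC hφc hφs fun x => sq_nonneg _
  have hgrad : ∀ {w : E → ℝ}, ContDiffOn ℝ 1 w Ω → ContinuousOn (gradient w) Ω := fun hw =>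
    continuousOn_gradient hΩ hw
  have hXu : ContinuousOn (fun x => A ‖gradient u x‖ • gradient u x) Ω :=
    hA.comp_continuousOn (hgrad hu)
  have hXv : ContinuousOn (fun x => A ‖gradient v x‖ • gradient v x) Ω :=
    hA.comp_continuousOn (hgrad hv)
  have hhu : ContinuousOn (fun x => f (u x) - B ‖gradient u x‖) Ω :=
    (hf.comp_continuousOn hu.continuousOn).sub
      (hB.comp (hgrad hu).norm fun x _ => norm_nonneg _)
  have hhv : ContinuousOn (fun x => f (v x) - B ‖gradient v x‖) Ω :=
    (hf.comp_continuousOn hv.continuousOn).sub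
      (hB.comp (hgrad hv).norm fun x _ => norm_nonneg _)
  have hψs' := hψs.trans hWΩ
  have e1 := hwu.integral_eq hΩ hXu hhu hψC hψc hψs'
  have e2 := hwv.integral_eq hΩ hXv hhv hψC hψc hψs'
  have i1 := integrable_fderiv_apply hXu hψC hψc hψs'
  have i2 := integrable_fderiv_apply hXv hψC hψc hψs'
  have i3 := integrable_mul_of_tsupport hhu hψC.continuous hψc hψs'
  have i4 := integrable_mul_of_tsupport hhv hψC.continuous hψc hψs'
  set P : E → ℝ := fun x => (fderiv ℝ (fun x => g x ^ 3) x (A ‖gradient u x‖ • gradient u x) -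
      fderiv ℝ (fun x => g x ^ 3) x (A ‖gradient v x‖ • gradient v x)) -
      ((f (u x) - B ‖gradient u x‖) * g x ^ 3 - (f (v x) - B ‖gradient v x‖) * g x ^ 3) with hPdef
  have hPi : Integrable P := (i1.sub i2).sub (i3.sub i4)
  have hP0 : ∫ x, P x = 0 := by
    rw [show P = ((fun x => fderiv ℝ (fun x => g x ^ 3) x (A ‖gradient u x‖ • gradient u x)) -
      fun x => fderiv ℝ (fun x => g x ^ 3) x (A ‖gradient v x‖ • gradient v x)) -
      ((fun x => (f (u x) - B ‖gradient u x‖) * g x ^ 3) -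
        fun x => (f (v x) - B ‖gradient v x‖) * g x ^ 3) from rfl, integral_sub' (i1.sub i2) (i3.sub i4), integral_sub' i1 i2,
      integral_sub' i3 i4, e1, e2, sub_self]
  have hIW : Integrable (W.indicator fun _ => e * k) :=
    (integrable_indicator_iff hW.measurableSet).2 (integrableOn_const hvolW)
  have hpt' : ∀ x, a * (p x * ‖fderiv ℝ (fun x => g x ^ 2) x‖ ^ 2) - C * (q x * (g x ^ 2) ^ 2) -
      W.indicator (fun _ => e * k) x ≤ P x := by
    intro x
    rcases (hg0 x).eq_or_lt with h0 | h0
    · have : 0 ≤ W.indicator (fun _ => e * k) x := indicator_nonneg (fun _ _ => by positivity) x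
      simp only [hPdef, hφd, hψd, ← h0]
      simpa using this
    · have hxW : x ∈ W := by
        by_contra hx
        exact h0.ne' (excess_of_notMem hx)
      have hgx : g x = d x - k := by
        have h1 : g x = max (d x - k) 0 := excess_of_mem hxW
        rcases le_total (d x - k) 0 with h2 | h2
        · rw [max_eq_right h2] at h1; exact absurd h1 h0.ne'
        · rw [h1, max_eq_left h2]
      have hfd : ∀ y, fderiv ℝ d x y = inner ℝ y (gradient u x - gradient v x) := fun y => by
        have hx' := hΩ.mem_nhds (hWΩ hxW)
        have := ((hu.differentiableOn one_ne_zero).differentiableAt hx').hasFDerivAt.sub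
          ((hv.differentiableOn one_ne_zero).differentiableAt hx').hasFDerivAt
        rw [show fderiv ℝ d x = fderiv ℝ u x - fderiv ℝ v x from this.fderiv,
          real_inner_comm, inner_sub_left, inner_gradient_left, inner_gradient_left]
        rfl
      have hnorm : ‖fderiv ℝ d x‖ = ‖gradient u x - gradient v x‖ := by
        have : fderiv ℝ d x = innerSL ℝ (gradient u x - gradient v x) := by
          ext y
          rw [hfd, real_inner_comm]; rfl
        rw [this, innerSL_apply_norm]
      rw [indicator_of_mem hxW, hφd, norm_smul, hnorm, Real.norm_of_nonneg (by linarith)]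
      refine (hpt x hxW (g x) h0 (by rw [hgx]; ring)).trans (le_of_eq ?_)
      simp only [hPdef, hψd, smul_apply, hfd, smul_eq_mul, inner_sub_left]
      ring
  have hmono := integral_mono (((hI1.const_mul a).sub (hI2.const_mul C)).sub hIW) hPi hpt'
  rw [hP0] at hmono
  have hsplit : ∫ x, (((fun x => a * (p x * ‖fderiv ℝ (fun x => g x ^ 2) x‖ ^ 2)) -
      fun x => C * (q x * (g x ^ 2) ^ 2)) - W.indicator fun _ => e * k) x =
      a * (∫ x, p x * ‖fderiv ℝ (fun x => g x ^ 2) x‖ ^ 2) - C * (∫ x, q x * (g x ^ 2) ^ 2) -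
        e * k * volume.real W := by
    rw [integral_sub' ((hI1.const_mul a).sub (hI2.const_mul C)) hIW,
      integral_sub' (hI1.const_mul a) (hI2.const_mul C), integral_const_mul, integral_const_mul,
      integral_indicator hW.measurableSet, setIntegral_const, smul_eq_mul]
    ring
  rw [hsplit] at hmono
  set I1 := ∫ x, p x * ‖fderiv ℝ (fun x => g x ^ 2) x‖ ^ 2
  set I2 := ∫ x, q x * (g x ^ 2) ^ 2 with hI2def
  have hI2nn : 0 ≤ I2 := integral_nonneg fun x => by
    by_cases hx : x ∈ W
    · have : 0 < q x := by
        by_contra! hh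
        linarith [hq x hx, mul_nonpos_of_nonneg_of_nonpos hQ hh]
      show 0 ≤ q x * (g x ^ 2) ^ 2
      positivity
    · show 0 ≤ q x * (g x ^ 2) ^ 2
      simp [hg, excess_of_notMem hx]
  have h1 : C * I2 ≤ C * (κ * I1) := mul_le_mul_of_nonneg_left hP hC
  -- `C κ ≤ a / 2` absorbs the `I2` term into half of `a I1`. The sign of `I1` is not assumed, hence
  -- the two cases.
  have hI1b : κ * I1 ≤ κ * (2 * (e * k * volume.real W) / a) := by
    rcases le_total 0 I1 with h0 | h0
    · refine mul_le_mul_of_nonneg_left ?_ hκ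
      rw [le_div_iff₀ ha]
      nlinarith [mul_le_mul_of_nonneg_right hCκ h0]
    · have : 0 ≤ κ * (2 * (e * k * volume.real W) / a) := by
        have := measureReal_nonneg (μ := volume) (s := W)
        positivity
      linarith [mul_nonpos_of_nonneg_of_nonpos hκ h0]
  calc ∫ x, (g x ^ 2) ^ 2 ≤ ∫ x, Q * (q x * (g x ^ 2) ^ 2) := by
        refine integral_mono (integrable_sq_of_hasCompactSupport hφC.continuous hφc)
          (hI2.const_mul Q) fun x => ?_
        by_cases hx : x ∈ W
        · have := mul_le_mul_of_nonneg_right (hq x hx) (sq_nonneg (g x ^ 2))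
          show (g x ^ 2) ^ 2 ≤ Q * (q x * (g x ^ 2) ^ 2)
          linarith
        · show (g x ^ 2) ^ 2 ≤ Q * (q x * (g x ^ 2) ^ 2)
          simp [hg, excess_of_notMem hx]
    _ = Q * I2 := integral_const_mul _ _
    _ ≤ Q * (κ * (2 * (e * k * volume.real W) / a)) :=
        mul_le_mul_of_nonneg_left (hP.trans hI1b) hQ
    _ = _ := by ring

end Comparison

/-! ### Comparison in domains of small measure -/

/-- Of the `3 c₀ g² w²` supplied by the flux, two thirds form the energy of `g²` and one third
absorbs the `B` term by Young's inequality. Replacing `u - v` by `g + k` in the Lipschitz bound for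
`f` costs the error in `k`. -/
theorem nondegenerate_energy_le {c₀ I w b Δ L L' g k G : ℝ} (hc₀ : 0 < c₀) (hL' : 0 ≤ L')
    (hg : 0 < g) (hk : 0 ≤ k) (hgG : g ≤ G) (hI : c₀ * w ^ 2 ≤ I)
    (hb : |b| ≤ L * w) (hΔ : Δ ≤ L' * (g + k)) :
    c₀ / 2 * (1 * (2 * g * w) ^ 2) - (L ^ 2 / (4 * c₀) + L') * (1 * (g ^ 2) ^ 2) -
      L' * G ^ 3 * k ≤ 3 * g ^ 2 * I + b * g ^ 3 - Δ * g ^ 3 := by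
  have hg3 : g ^ 3 ≤ G ^ 3 := pow_le_pow_left₀ hg.le hgG 3
  have h1 : 3 * g ^ 2 * (c₀ * w ^ 2) ≤ 3 * g ^ 2 * I := mul_le_mul_of_nonneg_left hI (by positivity)
  have h2 : -(L * w) * g ^ 3 ≤ b * g ^ 3 :=
    mul_le_mul_of_nonneg_right (abs_le.1 hb).1 (by positivity)
  have h3 : Δ * g ^ 3 ≤ L' * (g + k) * g ^ 3 := mul_le_mul_of_nonneg_right hΔ (by positivity)
  have h4 : L' * k * g ^ 3 ≤ L' * k * G ^ 3 := mul_le_mul_of_nonneg_left hg3 (by positivity)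
  have h5 : 0 ≤ g ^ 2 * ((2 * c₀ * w - L * g) ^ 2 / (4 * c₀)) := by positivity
  have h6 : g ^ 2 * ((2 * c₀ * w - L * g) ^ 2 / (4 * c₀)) =
      c₀ * g ^ 2 * w ^ 2 - L * w * g ^ 3 + L ^ 2 / (4 * c₀) * (g ^ 2) ^ 2 := by
    field_simp
    ring
  nlinarith

/-- The flux supplies `(3/2) a₁ g² w²`: the energy uses at most `a₁ g² w²` and the rest absorbs the
`B` term at the price `1 / a₁ ≤ D q`. Where that comparison fails, `w ≤ 2 * k` makes the `B` term
itself of order `k`. -/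
theorem degenerate_energy_le {a₀ a₁ q Q D I w b Δ L L' g k G : ℝ} (ha : a₀ ≤ a₁) (ha₁ : 0 ≤ a₁)
    (hq : 0 ≤ q) (hD : 0 ≤ D) (hQ : 1 ≤ Q * q) (hL : 0 ≤ L) (hL' : 0 ≤ L') (hg : 0 < g)
    (hk : 0 ≤ k) (hgG : g ≤ G) (hI : a₁ / 2 * w ^ 2 ≤ I) (hb : |b| ≤ L * w) (hΔ : Δ ≤ L' * (g + k))
    (h : (0 < a₁ ∧ 1 ≤ D * q * a₁) ∨ w ≤ 2 * k) :
    1 / 4 * (a₀ * (2 * g * w) ^ 2) - (D * L ^ 2 / 2 + L' * Q) * (q * (g ^ 2) ^ 2) -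
      (2 * L + L') * G ^ 3 * k ≤ 3 * g ^ 2 * I + b * g ^ 3 - Δ * g ^ 3 := by
  have hG : 0 ≤ G := hg.le.trans hgG
  have hg3 : g ^ 3 ≤ G ^ 3 := pow_le_pow_left₀ hg.le hgG 3
  have h1 : 3 * g ^ 2 * (a₁ / 2 * w ^ 2) ≤ 3 * g ^ 2 * I :=
    mul_le_mul_of_nonneg_left hI (by positivity)
  have h2 : -(L * w) * g ^ 3 ≤ b * g ^ 3 :=
    mul_le_mul_of_nonneg_right (abs_le.1 hb).1 (by positivity)
  have h3 : Δ * g ^ 3 ≤ L' * (g + k) * g ^ 3 := mul_le_mul_of_nonneg_right hΔ (by positivity)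
  have h4 : L' * k * g ^ 3 ≤ L' * k * G ^ 3 := mul_le_mul_of_nonneg_left hg3 (by positivity)
  have h5 : a₀ * (g * w) ^ 2 ≤ a₁ * (g * w) ^ 2 := mul_le_mul_of_nonneg_right ha (sq_nonneg _)
  have h6 : L' * (g ^ 2) ^ 2 * 1 ≤ L' * (g ^ 2) ^ 2 * (Q * q) :=
    mul_le_mul_of_nonneg_left hQ (by positivity)
  have h7 : L * w * g ^ 3 ≤ 1 / 2 * a₁ * (g * w) ^ 2 + D * L ^ 2 / 2 * (q * (g ^ 2) ^ 2) +
      2 * L * k * G ^ 3 := by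
    rcases h with ⟨h0, h⟩ | h
    · have e1 : 0 ≤ a₁ * (1 / 2 * a₁ * w ^ 2 + D * L ^ 2 / 2 * q * g ^ 2 - L * w * g) := by
        have := mul_le_mul_of_nonneg_left h (show 0 ≤ L ^ 2 / 2 * g ^ 2 by positivity)
        nlinarith [sq_nonneg (a₁ * w - L * g)]
      have e2 := mul_nonneg (sq_nonneg g) (nonneg_of_mul_nonneg_right e1 h0)
      have e3 : 0 ≤ 2 * L * k * G ^ 3 := by positivity
      nlinarith
    · have e1 : L * w * g ^ 3 ≤ L * (2 * k) * g ^ 3 := by gcongr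
      have e2 : L * (2 * k) * g ^ 3 ≤ L * (2 * k) * G ^ 3 := by gcongr
      have e3 : 0 ≤ 1 / 2 * a₁ * (g * w) ^ 2 + D * L ^ 2 / 2 * (q * (g ^ 2) ^ 2) := by positivity
      linarith
  nlinarith

section Comparison

variable {E : Type*} [NormedAddCommGroup E] [InnerProductSpace ℝ E] [FiniteDimensional ℝ E]
  [MeasurableSpace E] [BorelSpace E]

theorem exists_small_domain_comparison_of_coercive (hdim : 2 ≤ Module.finrank ℝ E)
    {A B f : ℝ → ℝ} (hA : Continuous fun ξ : E => A ‖ξ‖ • ξ) {R c₀ : ℝ} (hc₀ : 0 < c₀)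
    (hco : ∀ ξ ζ : E, ‖ξ‖ ≤ R → ‖ζ‖ ≤ R →
      c₀ * ‖ξ - ζ‖ ^ 2 ≤ inner ℝ (A ‖ξ‖ • ξ - A ‖ζ‖ • ζ) (ξ - ζ))
    (hBc : ContinuousOn B (Ici 0)) {Lb : ℝ≥0} (hBL : LipschitzOnWith Lb B (Icc 0 R)) {L : ℝ≥0}
    (hf : LipschitzWith L f) {Ω : Set E} (hΩ : IsOpen Ω) {u v : E → ℝ}
    (hu : ContDiffOn ℝ 1 u Ω) (hv : ContDiffOn ℝ 1 v Ω)
    (hwu : WeakDiv Ω (fun x => A ‖gradient u x‖ • gradient u x)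
      fun x => f (u x) - B ‖gradient u x‖)
    (hwv : WeakDiv Ω (fun x => A ‖gradient v x‖ • gradient v x)
      fun x => f (v x) - B ‖gradient v x‖)
    {S : Set E} (hSΩ : S ⊆ Ω) (hS : IsCompact (closure S))
    (huc : ContinuousOn u (closure S)) (hvc : ContinuousOn v (closure S))
    (huR : ∀ x ∈ S, ‖gradient u x‖ ≤ R) (hvR : ∀ x ∈ S, ‖gradient v x‖ ≤ R)
    {G : ℝ} (hG0 : 0 ≤ G) (hG : ∀ x ∈ S, u x - v x ≤ G) :
    ∃ δ : ℝ, 0 < δ ∧ ∀ W : Set E, IsOpen W → W ⊆ S → volume W ≤ ENNReal.ofReal δ →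
      (∀ x ∈ frontier W, u x ≤ v x) → ∀ x ∈ W, u x ≤ v x := by
  set C : ℝ := (Lb : ℝ) ^ 2 / (4 * c₀) + L with hC
  have hC0 : 0 ≤ C := by positivity
  set κ : ℝ := c₀ / 2 / 2 / (C + 1) with hκ
  have hκ0 : 0 < κ := by positivity
  have hCκ : C * κ ≤ c₀ / 2 / 2 := by
    rw [hκ, mul_div_assoc', div_le_iff₀ (by positivity)]
    nlinarith
  obtain ⟨δ, hδ, hP⟩ := exists_small_domain_poincare hdim hκ0
  refine ⟨δ, hδ, fun W hW hWS hvol hfr => ?_⟩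
  have hcl : closure W ⊆ closure S := closure_mono hWS
  refine le_of_energy_bounds (a := c₀ / 2) (C := C) (Q := 1) (κ := κ) (k₀ := 1) (e := L * G ^ 3)
    hΩ hA hBc hf.continuous hu hv hwu hwv hW (hWS.trans hSΩ) (hS.of_isClosed_subset isClosed_closure hcl)
    (huc.mono hcl) (hvc.mono hcl) hfr (by positivity) hC0 zero_le_one hκ0.le hCκ one_pos
    (by positivity) fun k hk hk1 => ⟨fun _ => 1, fun _ => 1, fun φ hφ hφc hφs hφ0 => ⟨?_, ?_, ?_⟩,
      fun x hx => by norm_num, fun x hx g hg hdk => ?_⟩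
  · simpa using integrable_sq_of_hasCompactSupport hφ.continuous hφc
  · simpa using integrable_norm_fderiv_sq hφ hφc
  · simpa using hP W hvol φ hφ hφc fun x hx =>
      image_eq_zero_of_notMem_tsupport fun h => hx (hφs h)
  · have hxS := hWS hx
    refine nondegenerate_energy_le (L := Lb) hc₀ L.2 hg hk.le ?_ (hco _ _ (huR x hxS) (hvR x hxS)) ?_ ?_
    · linarith [hG x hxS]
    · have := hBL.dist_le_mul _ ⟨norm_nonneg _, huR x hxS⟩ _ ⟨norm_nonneg _, hvR x hxS⟩
      rw [Real.dist_eq, Real.dist_eq] at this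
      exact this.trans (mul_le_mul_of_nonneg_left (abs_norm_sub_norm_le _ _) Lb.2)
    · have := hf.dist_le_mul (u x) (v x)
      rw [Real.dist_eq, Real.dist_eq, hdk, abs_of_pos (show 0 < g + k by linarith)] at this
      exact (le_abs_self _).trans this

/-- The truncation level is the excess level `k`; the weighted Poincaré inequality is uniform in it,
so `δ` does not depend on `k`. -/
theorem exists_small_domain_comparison_of_monotone (hdim : 2 ≤ Module.finrank ℝ E)
    {A B f : ℝ → ℝ} {M D : ℝ} (hA : DegenerateA A M D) {R : ℝ} (hR1 : 1 < R)
    (hBC : ContDiffOn ℝ 1 B (Ioi 0)) (hBc : ContinuousOn B (Ici 0)) {Lb : ℝ≥0}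
    (hBL : LipschitzOnWith Lb B (Icc 0 R)) {L : ℝ≥0}
    (hf : LipschitzWith L f) {Ω : Set E} (hΩ : IsOpen Ω) {u v : E → ℝ}
    (hu : ContDiffOn ℝ 1 u Ω) (hv : ContDiffOn ℝ 1 v Ω)
    (hu2 : ContDiffOn ℝ 2 u {x ∈ Ω | gradient u x ≠ 0})
    (hwu : WeakDiv Ω (fun x => A ‖gradient u x‖ • gradient u x)
      fun x => f (u x) - B ‖gradient u x‖)
    (hwv : WeakDiv Ω (fun x => A ‖gradient v x‖ • gradient v x)
      fun x => f (v x) - B ‖gradient v x‖)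
    {S : Set E} (hSΩ : S ⊆ Ω) (hS : IsCompact (closure S)) (hGr : UniformContinuousOn (gradient u) S)
    (huc : ContinuousOn u (closure S)) (hvc : ContinuousOn v (closure S))
    (huR : ∀ x ∈ S, ‖gradient u x‖ ≤ R) (hvR : ∀ x ∈ S, ‖gradient v x‖ ≤ R)
    {c ε₀ : ℝ} (hc : 0 < c) (hε₀ : 0 < ε₀)
    (hcS : ∀ x ∈ S, ‖gradient u x‖ ≤ ε₀ → c ≤ f (u x) - B ‖gradient u x‖)
    {G : ℝ} (hG0 : 0 ≤ G) (hG : ∀ x ∈ S, u x - v x ≤ G) :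
    ∃ δ : ℝ, 0 < δ ∧ ∀ W : Set E, IsOpen W → W ⊆ S → volume W ≤ ENNReal.ofReal δ →
      (∀ x ∈ frontier W, u x ≤ v x) → ∀ x ∈ W, u x ≤ v x := by
  have hR0 : 0 < R := one_pos.trans hR1
  have hAR : 0 < A (3 * R) := hA.pos _ (by positivity)
  have hD := hA.D_nonneg
  set C : ℝ := D * (Lb : ℝ) ^ 2 / 2 + L * A (3 * R) with hC
  have hC0 : 0 ≤ C := by positivity
  set κ : ℝ := 1 / 4 / 2 / (C + 1) with hκ
  have hκ0 : 0 < κ := by positivity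
  have hCκ : C * κ ≤ 1 / 4 / 2 := by
    rw [hκ, mul_div_assoc', div_le_iff₀ (by positivity)]
    nlinarith
  have hBd : ∀ t, 0 < t → t ≤ 1 → |deriv B t| ≤ Lb := fun t ht ht1 =>
    norm_deriv_le_of_lipschitzOn (Icc_mem_nhds ht (ht1.trans_lt hR1)) hBL
  obtain ⟨δ, hδ, hP⟩ := exists_small_domain_weighted_poincare hdim hA hBC
    Lb.2 hBd hBc hf hΩ hu hu2 hwu hSΩ hS hGr hR0 huR hc hε₀ hcS hκ0
  refine ⟨δ, hδ, fun W hW hWS hvol hfr => ?_⟩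
  have hcl : closure W ⊆ closure S := closure_mono hWS
  refine le_of_energy_bounds (a := 1 / 4) (C := C) (Q := A (3 * R)) (κ := κ) (k₀ := R)
    (e := (2 * Lb + L) * G ^ 3)
    hΩ (continuous_flux hA.contDiffOn hA.tendsto) hBc hf.continuous hu hv hwu hwv hW (hWS.trans hSΩ)
    (hS.of_isClosed_subset isClosed_closure hcl) (huc.mono hcl) (hvc.mono hcl) hfr (by norm_num)
    hC0 hAR.le hκ0.le hCκ hR0 (by positivity) fun k hk hkR => ?_
  obtain ⟨θ, m, hθ⟩ := exists_truncationProfile hk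
  have hθpos : ∀ t, 0 < A (θ t) := fun t => hA.pos _ (by linarith [hθ.const_le t])
  have hQ : ∀ x ∈ W, 1 ≤ A (3 * R) * (A (θ ‖gradient u x‖))⁻¹ := fun x hx => by
    rw [← div_eq_mul_inv, one_le_div (hθpos _)]
    exact hA.mono ((hθ.le_max _).trans (by
      gcongr
      exact max_le (huR x (hWS hx)) hkR.le))
  refine ⟨fun x => A ‖gradient u x‖, fun x => (A (θ ‖gradient u x‖))⁻¹,
    hP W hWS hvol k θ m hk hkR.le hθ, hQ, fun x hx g hg hdk => ?_⟩
  have hxS := hWS hx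
  have hθx := hθpos ‖gradient u x‖
  refine degenerate_energy_le (L := Lb) (hA.mono (le_max_left _ _)) (hA.nonneg _)
    (inv_nonneg.2 hθx.le) hD (hQ x hx) Lb.2 L.2 hg hk.le (by linarith [hG x hxS])
    (inner_flux_sub_ge_of_monotone hA.mono hA.nonneg _ _) ?_ ?_ ?_
  · have := hBL.dist_le_mul _ ⟨norm_nonneg _, huR x hxS⟩ _ ⟨norm_nonneg _, hvR x hxS⟩
    rw [Real.dist_eq, Real.dist_eq] at this
    exact this.trans (mul_le_mul_of_nonneg_left (abs_norm_sub_norm_le _ _) Lb.2)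
  · have := hf.dist_le_mul (u x) (v x)
    rw [Real.dist_eq, Real.dist_eq, hdk, abs_of_pos (show 0 < g + k by linarith)] at this
    exact (le_abs_self _).trans this
  -- If the larger gradient is at least `k`, then `θ(|∇u|)` is at most three times it and doubling
  -- compares the weights; otherwise both gradients are below `k`.
  · rcases le_total k (max ‖gradient u x‖ ‖gradient v x‖) with h | h
    · left
      have hpos : 0 < max ‖gradient u x‖ ‖gradient v x‖ := hk.trans_le h
      refine ⟨hA.pos _ hpos, ?_⟩
      rw [mul_right_comm, ← div_eq_mul_inv, one_le_div hθx]
      refine hA.doubling _ _ hpos ((hθ.le_max _).trans ?_)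
      exact mul_le_mul_of_nonneg_left (max_le (le_max_left _ _) h) (by norm_num)
    · right
      calc _ ≤ ‖gradient u x‖ + ‖gradient v x‖ := norm_sub_le _ _
        _ ≤ k + k := add_le_add ((le_max_left _ _).trans h) ((le_max_right _ _).trans h)
        _ = 2 * k := by ring

end Comparison

/-! ### From the weak formulation to the comparison principle -/

section General

variable {E : Type*} [NormedAddCommGroup E] [InnerProductSpace ℝ E] [FiniteDimensional ℝ E]
  [MeasurableSpace E] [BorelSpace E]

theorem WeakDiv.congr_of_subset {Ω O : Set E} {X Y : E → E} {h k : E → ℝ} (hw : WeakDiv Ω X h)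
    (hO : O ⊆ Ω) (hX : ∀ x ∈ O, Y x = X x) (hh : ∀ x ∈ O, k x = h x) : WeakDiv O Y k := by
  intro ψ h1 h2 h3
  have e1 : (fun x => fderiv ℝ ψ x (Y x)) = fun x => fderiv ℝ ψ x (X x) := funext fun x => by
    by_cases hx : x ∈ tsupport ψ
    · rw [hX x (h3 hx)]
    · simp [fderiv_eq_zero_of_notMem_tsupport hx]
  have e2 : (fun x => k x * ψ x) = fun x => h x * ψ x := funext fun x => by
    by_cases hx : x ∈ tsupport ψ
    · rw [hh x (h3 hx)]
    · simp [image_eq_zero_of_notMem_tsupport hx]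
  rw [e1, e2]
  exact hw ψ h1 h2 (h3.trans hO)

end General

theorem OperatorA.exists_degenerateA {A : ℝ → ℝ} (hA : OperatorA A) (hm : MonotoneOn A (Ioi 0)) :
    ∃ M D : ℝ, DegenerateA (fun t => if 0 < t then A t else 0) M D := by
  set A₀ : ℝ → ℝ := fun t => if 0 < t then A t else 0 with hA₀
  have hpos' : ∀ t, 0 < t → A₀ t = A t := fun t ht => if_pos ht
  have hneg : ∀ t, t ≤ 0 → A₀ t = 0 := fun t ht => if_neg ht.not_gt
  have hpos : ∀ t, 0 < t → 0 < A₀ t := fun t ht => by rw [hpos' t ht]; exact hA.pos t ht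
  have hmono : Monotone A₀ := fun s t hst => by
    rcases le_or_gt s 0 with hs | hs
    · rw [hneg s hs]
      rcases le_or_gt t 0 with ht | ht
      · rw [hneg t ht]
      · exact (hpos t ht).le
    · have ht := hs.trans_le hst
      rw [hpos' s hs, hpos' t ht]
      exact hm hs ht hst
  have hC : ContDiffOn ℝ 1 A₀ (Ioi 0) := hA.contDiffOn.congr fun t ht => hpos' t ht
  have hderiv : ∀ t, 0 < t → deriv A₀ t = deriv A t := fun t ht =>
    Filter.EventuallyEq.deriv_eq (by
      filter_upwards [Ioi_mem_nhds ht] with s hs using hpos' s hs)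
  obtain ⟨m, hm1, hml⟩ := hA.lower
  obtain ⟨M, hM⟩ := hA.upper
  have hM' : ∀ t, 0 < t → t * deriv A₀ t / A₀ t ≤ max M 0 := fun t ht => by
    rw [hderiv t ht, hpos' t ht]
    exact (hM t ht).trans (le_max_left _ _)
  obtain ⟨D, hD0, hD⟩ := exists_doubling hC hpos hM' hmono
  refine ⟨max M 0, D, ⟨hpos, hneg, hmono, hC, fun t ht => ?_, hD, ?_, le_max_right _ _, hD0.le⟩⟩
  · exact (div_le_iff₀ (hpos t ht)).1 (hM' t ht)
  · exact tendsto_mul_self_zero hC hpos hm1 fun t ht => by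
      rw [hderiv t ht, hpos' t ht]
      exact hml t ht

theorem IsWeakSolution.weakDiv {N : ℕ} {A B f : ℝ → ℝ} {Ω : Set (EuclideanSpace ℝ (Fin N))}
    {u : EuclideanSpace ℝ (Fin N) → ℝ} (hΩ : IsOpen Ω) (hu : ContDiffOn ℝ 1 u Ω)
    (hB : ContinuousOn B (Ici 0)) (hf : Continuous f) (h : IsWeakSolution A B f Ω u) :
    WeakDiv Ω (fun x => A ‖gradient u x‖ • gradient u x) fun x => f (u x) - B ‖gradient u x‖ := by
  intro ψ h1 h2 h3
  have hz : ∀ x, x ∉ Ω → ψ x = 0 := fun x hx =>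
    image_eq_zero_of_notMem_tsupport fun hh => hx (h3 hh)
  have hz' : ∀ x, x ∉ Ω → gradient ψ x = 0 := fun x hx => by
    rw [gradient, fderiv_eq_zero_of_notMem_tsupport fun hh => hx (h3 hh), map_zero]
  have key := h ψ h1 h2 h3
  rw [setIntegral_eq_integral_of_forall_compl_eq_zero fun x hx => by rw [hz' x hx]; simp,
    setIntegral_eq_integral_of_forall_compl_eq_zero fun x hx => by rw [hz x hx]; simp,
    setIntegral_eq_integral_of_forall_compl_eq_zero fun x hx => by rw [hz x hx]; simp] at key
  have i1 := integrable_mul_of_tsupport (k := fun x => f (u x)) (hf.comp_continuousOn hu.continuousOn) h1.continuous h2 h3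
  have i2 := integrable_mul_of_tsupport (O := Ω) (k := fun x => B ‖gradient u x‖)
    (hB.comp (continuousOn_gradient hΩ hu).norm fun x _ => norm_nonneg _) h1.continuous h2 h3
  simp only [sub_mul]
  rw [integral_sub i1 i2]
  have e : (fun x => fderiv ℝ ψ x (A ‖gradient u x‖ • gradient u x)) =
      fun x => A ‖gradient u x‖ * inner ℝ (gradient u x) (gradient ψ x) := funext fun x => by
    rw [map_smul, smul_eq_mul, real_inner_comm, inner_gradient_left]
  rw [e]
  linarith

/-- Only the ranges of `u` and `v` on `S` matter, so `f` is replaced by a globally Lipschitz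
function on the open set `O` where both stay inside a fixed interval. -/
theorem exists_small_domain_comparison {N : ℕ} (hN : 2 ≤ N)
    {Ω : Set (EuclideanSpace ℝ (Fin N))} (hΩ : IsOpen Ω)
    {A B f : ℝ → ℝ} (hA : OperatorA A) (hB : ContDiffOn ℝ 1 B (Ici 0)) (hf : LocallyLipschitz f)
    {u v : EuclideanSpace ℝ (Fin N) → ℝ}
    (hu : ContDiffOn ℝ 1 u Ω) (hu2 : ContDiffOn ℝ 2 u (Ω \ criticalSet u))
    (hv : ContDiffOn ℝ 1 v Ω)
    (husol : IsWeakSolution A B f Ω u) (hvsol : IsWeakSolution A B f Ω v)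
    {S : Set (EuclideanSpace ℝ (Fin N))} (hSΩ : S ⊆ Ω) (hS : IsCompact (closure S))
    (huc : ContinuousOn u (closure S)) (hvc : ContinuousOn v (closure S))
    (hGu : UniformContinuousOn (gradient u) S) {R : ℝ} (huR : ∀ x ∈ S, ‖gradient u x‖ ≤ R)
    (hvR : ∀ x ∈ S, ‖gradient v x‖ ≤ R) {c ε : ℝ} (hc : 0 < c) (hε : 0 < ε)
    (hcS : ∀ x ∈ S, ‖gradient u x‖ ≤ ε → c ≤ f (u x) - B ‖gradient u x‖) :
    ∃ δ : ℝ, 0 < δ ∧ ∀ W : Set (EuclideanSpace ℝ (Fin N)), IsOpen W → W ⊆ S →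
      volume W ≤ ENNReal.ofReal δ → (∀ x ∈ frontier W, u x ≤ v x) → ∀ x ∈ W, u x ≤ v x := by
  have hdim : 2 ≤ Module.finrank ℝ (EuclideanSpace ℝ (Fin N)) := by
    rwa [finrank_euclideanSpace, Fintype.card_fin]
  -- `R > 1` lets the Lipschitz constant of `B` on `[0, R]` bound its derivative on all of `(0, 1]`.
  wlog hR1 : 1 < R generalizing R
  · exact this (R := 2) (fun x hx => (huR x hx).trans (by linarith))
      (fun x hx => (hvR x hx).trans (by linarith)) (by norm_num)
  have hBc := hB.continuousOn
  obtain ⟨Lb, hLb⟩ := (hB.mono (Icc_subset_Ici_self : Icc 0 R ⊆ Ici 0)).exists_lipschitzOnWith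
    one_ne_zero (convex_Icc 0 R) isCompact_Icc
  obtain ⟨Tu, hTu⟩ := hS.exists_bound_of_continuousOn huc
  obtain ⟨Tv, hTv⟩ := hS.exists_bound_of_continuousOn hvc
  set T := max Tu Tv + 1 with hT
  obtain ⟨L, hL⟩ := (hf.locallyLipschitzOn (s := Icc (-T) T)).exists_lipschitzOnWith_of_compact
    isCompact_Icc
  obtain ⟨f', hf', hff'⟩ := hL.extend_real
  set O : Set (EuclideanSpace ℝ (Fin N)) := (Ω ∩ u ⁻¹' Ioo (-T) T) ∩ (Ω ∩ v ⁻¹' Ioo (-T) T) with hO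
  have hOo : IsOpen O := (hu.continuousOn.isOpen_inter_preimage hΩ isOpen_Ioo).inter
    (hv.continuousOn.isOpen_inter_preimage hΩ isOpen_Ioo)
  have hOΩ : O ⊆ Ω := fun x hx => hx.1.1
  have hSO : S ⊆ O := fun x hx => by
    have h1 := abs_le.1 (hTu x (subset_closure hx))
    have h2 := abs_le.1 (hTv x (subset_closure hx))
    have h3 := le_max_left Tu Tv
    have h4 := le_max_right Tu Tv
    exact ⟨⟨hSΩ hx, by constructor <;> linarith [h1.1, h1.2]⟩,
      hSΩ hx, by constructor <;> linarith [h2.1, h2.2]⟩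
  have hfu : ∀ x ∈ O, f' (u x) - B ‖gradient u x‖ = f (u x) - B ‖gradient u x‖ := fun x hx => by
    rw [hff' (Ioo_subset_Icc_self hx.1.2)]
  have hfv : ∀ x ∈ O, f' (v x) - B ‖gradient v x‖ = f (v x) - B ‖gradient v x‖ := fun x hx => by
    rw [hff' (Ioo_subset_Icc_self hx.2.2)]
  have hwu := husol.weakDiv hΩ hu hBc hf.continuous
  have hwv := hvsol.weakDiv hΩ hv hBc hf.continuous
  have hG : ∀ x ∈ S, u x - v x ≤ 2 * T := fun x hx => by
    have h1 := (hSO hx).1.2.2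
    have h2 := (hSO hx).2.2.1
    linarith
  have hG0 : S = ∅ ∨ 0 ≤ 2 * T := by
    rcases S.eq_empty_or_nonempty with h | ⟨x, hx⟩
    · exact Or.inl h
    · have h1 := (hSO hx).1.2.2
      have h2 := (hSO hx).1.2.1
      right; linarith
  rcases hG0 with h | hG0
  · exact ⟨1, one_pos, fun W _ hWS _ _ x hx => absurd (h ▸ hWS hx) (notMem_empty x)⟩
  rcases hA.monotone with hm | ⟨hτ, -⟩
  · obtain ⟨M, D, hD⟩ := hA.exists_degenerateA hm
    set A₀ : ℝ → ℝ := fun t => if 0 < t then A t else 0 with hA₀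
    have hflux : ∀ ξ : EuclideanSpace ℝ (Fin N), A₀ ‖ξ‖ • ξ = A ‖ξ‖ • ξ := fun ξ => by
      by_cases hξ : ξ = 0
      · simp [hξ]
      · rw [hA₀]; simp only [norm_pos_iff.2 hξ, if_true]
    exact exists_small_domain_comparison_of_monotone hdim hD hR1
      (hB.mono Ioi_subset_Ici_self) hBc hLb hf' hOo (hu.mono hOΩ) (hv.mono hOΩ)
      (hu2.mono fun x hx => ⟨hOΩ hx.1, hx.2⟩)
      (hwu.congr_of_subset hOΩ (fun x _ => hflux _) hfu)
      (hwv.congr_of_subset hOΩ (fun x _ => hflux _) hfv) hSO hS hGu huc hvc huR hvR hc hε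
      (fun x hx h => by rw [hfu x (hSO hx)]; exact hcS x hx h) hG0 hG
  · obtain ⟨τ, hτ0, hτ⟩ := hτ (Icc 0 R) isCompact_Icc Icc_subset_Ici_self
    obtain ⟨m, hm1, hml⟩ := hA.lower
    obtain ⟨c₀, hc₀, hco⟩ := exists_inner_flux_sub_ge (E := EuclideanSpace ℝ (Fin N))
      hA.contDiffOn hA.pos hm1 hml hτ0 hτ
    exact exists_small_domain_comparison_of_coercive hdim
      (continuous_flux hA.contDiffOn (tendsto_mul_self_zero hA.contDiffOn hA.pos hm1 hml)) hc₀ hco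
      hBc hLb hf' hOo (hu.mono hOΩ) (hv.mono hOΩ)
      (hwu.congr_of_subset hOΩ (fun _ _ => rfl) hfu)
      (hwv.congr_of_subset hOΩ (fun _ _ => rfl) hfv) hSO hS huc hvc huR hvR hG0 hG

/-- A sequence violating the bound clusters at some `z` in the closure with gradients tending to
zero; uniform continuity upgrades this to a limit of the gradient along `S`, and passing to the
limit gives `f (u z) ≤ 0`. Vanishing is phrased as a limit so that boundary points are covered. -/
theorem exists_pos_le_of_pos_at_critical {N : ℕ} {B f : ℝ → ℝ} (hB : ContinuousOn B (Ici 0))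
    (hB0 : B 0 = 0) (hf : Continuous f) {u : EuclideanSpace ℝ (Fin N) → ℝ}
    {S : Set (EuclideanSpace ℝ (Fin N))} (hS : IsCompact (closure S))
    (huc : ContinuousOn u (closure S)) (hGu : UniformContinuousOn (gradient u) S)
    (h : ∀ x ∈ closure S, Tendsto (gradient u) (𝓝[S] x) (𝓝 0) → 0 < f (u x)) :
    ∃ c ε : ℝ, 0 < c ∧ 0 < ε ∧
      ∀ x ∈ S, ‖gradient u x‖ ≤ ε → c ≤ f (u x) - B ‖gradient u x‖ := by
  by_contra! hcon
  choose x hxS hx1 hx2 using fun n : ℕ => hcon (1 / (n + 1)) (1 / (n + 1)) (by positivity)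
    (by positivity)
  obtain ⟨z, hz, φ, hφ, hlim⟩ := hS.tendsto_subseq fun n => subset_closure (hxS n)
  have h0 : Tendsto (fun n : ℕ => 1 / ((n : ℝ) + 1)) atTop (𝓝 0) :=
    tendsto_one_div_add_atTop_nhds_zero_nat
  have hgn : Tendsto (fun n => ‖gradient u (x (φ n))‖) atTop (𝓝 0) :=
    squeeze_zero (fun n => norm_nonneg _) (fun n => hx1 (φ n)) (h0.comp hφ.tendsto_atTop)
  have hxz : Tendsto (x ∘ φ) atTop (𝓝[S] z) :=
    tendsto_nhdsWithin_iff.2 ⟨hlim, Eventually.of_forall fun n => hxS _⟩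
  have hgrad : Tendsto (gradient u) (𝓝[S] z) (𝓝 0) := by
    rw [Metric.tendsto_nhds]
    intro ε hε
    obtain ⟨δ, hδ, hd⟩ := Metric.uniformContinuousOn_iff.1 hGu (ε / 2) (by positivity)
    obtain ⟨n, hn1, hn2⟩ := (((tendsto_order.1 hgn).2 (ε / 2) (by positivity)).and
      (hlim.eventually (Metric.ball_mem_nhds z (half_pos hδ)))).exists
    filter_upwards [self_mem_nhdsWithin,
      mem_nhdsWithin_of_mem_nhds (Metric.ball_mem_nhds z (half_pos hδ))] with y hyS hy
    have h1 := hd y hyS _ (hxS (φ n)) (by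
      calc dist y (x (φ n)) ≤ dist y z + dist (x (φ n)) z := dist_triangle_right _ _ _
        _ < δ / 2 + δ / 2 := add_lt_add hy hn2
        _ = δ := by ring)
    calc dist (gradient u y) 0 ≤ dist (gradient u y) (gradient u (x (φ n))) +
          dist (gradient u (x (φ n))) 0 := dist_triangle _ _ _
      _ < ε / 2 + ε / 2 := add_lt_add h1 (by rwa [dist_zero_right])
      _ = ε := by ring
  have hpos := h z hz hgrad
  have hfu : Tendsto (fun n => f (u (x (φ n)))) atTop (𝓝 (f (u z))) :=
    (hf.tendsto _).comp ((huc z hz).tendsto.comp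
      (tendsto_nhdsWithin_mono_right subset_closure hxz))
  have hBn : Tendsto (fun n => B ‖gradient u (x (φ n))‖) atTop (𝓝 0) := by
    rw [← hB0]
    exact (hB 0 self_mem_Ici).tendsto.comp
      (tendsto_nhdsWithin_iff.2 ⟨hgn, Eventually.of_forall fun n => norm_nonneg _⟩)
  have := le_of_tendsto_of_tendsto' (hfu.sub hBn) (h0.comp hφ.tendsto_atTop)
    fun n => (hx2 (φ n)).le
  linarith
theorem HolderOnWith.exists_norm_le_of_isBounded {X F : Type*} [PseudoMetricSpace X]
    [SeminormedAddCommGroup F] {C α : ℝ≥0} {g : X → F} {S : Set X} (hg : HolderOnWith C α g S)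
    (hS : Bornology.IsBounded S) : ∃ R : ℝ, ∀ x ∈ S, ‖g x‖ ≤ R := by
  rcases S.eq_empty_or_nonempty with rfl | ⟨y, hy⟩
  · exact ⟨0, fun x hx => absurd hx (notMem_empty x)⟩
  · refine ⟨‖g y‖ + C * Metric.diam S ^ (α : ℝ), fun x hx => ?_⟩
    have h1 := hg.dist_le_of_le hx hy (Metric.dist_le_diam_of_mem hS hx hy)
    rw [dist_eq_norm] at h1
    linarith [norm_le_norm_add_norm_sub' (g x) (g y)]

theorem theorem1p4 (N : ℕ) (hN : 2 ≤ N)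
    (Ω : Set (EuclideanSpace ℝ (Fin N))) (hΩ : IsOpen Ω)
    (A B f : ℝ → ℝ) (hA : OperatorA A) (hB : OperatorB A B)
    (hf : LocallyLipschitz f) (hfpos : ∀ s : ℝ, 0 < s → 0 < f s)
    (α : ℝ≥0) (hα : 0 < α) (hα1 : α ≤ 1)
    (u v : EuclideanSpace ℝ (Fin N) → ℝ)
    (hu : IsC1Holder α Ω u) (hu2 : ContDiffOn ℝ 2 u (Ω \ criticalSet u))
    (hv : IsC1Holder α Ω v) (hv2 : ContDiffOn ℝ 2 v (Ω \ criticalSet v))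
    (husol : IsWeakSolution A B f Ω u) (hvsol : IsWeakSolution A B f Ω v)
    (hupos : ∀ x ∈ Ω, 0 < u x) :
    (∀ K : Set (EuclideanSpace ℝ (Fin N)), IsCompact K → K ⊆ Ω →
      ∃ δ : ℝ, 0 < δ ∧ ∀ Ω' : Set (EuclideanSpace ℝ (Fin N)), IsOpen Ω' → Ω' ⊆ K →
        volume Ω' ≤ ENNReal.ofReal δ →
        (∀ x ∈ frontier Ω', u x ≤ v x) → ∀ x ∈ Ω', u x ≤ v x) ∧
    (Bornology.IsBounded Ω → IsC1HolderClosure α Ω u → IsC1HolderClosure α Ω v →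
      (∀ x ∈ frontier Ω, u x = 0 → ¬ Tendsto (gradient u) (𝓝[Ω] x) (𝓝 0)) →
      ∃ δ : ℝ, 0 < δ ∧ ∀ Ω' : Set (EuclideanSpace ℝ (Fin N)), IsOpen Ω' → Ω' ⊆ Ω →
        volume Ω' ≤ ENNReal.ofReal δ →
        (∀ x ∈ frontier Ω', u x ≤ v x) → ∀ x ∈ Ω', u x ≤ v x) := by
  have hBc := hB.contDiffOn.continuousOn
  refine ⟨fun K hK hKΩ => ?_, fun hbd hu' hv' hcrit => ?_⟩
  · have hcl : closure K = K := hK.isClosed.closure_eq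
    have hguc := (continuousOn_gradient hΩ hu.1).mono hKΩ
    have hgvc := (continuousOn_gradient hΩ hv.1).mono hKΩ
    have hucK := hu.1.continuousOn.mono hKΩ
    have hGu := hK.uniformContinuousOn_of_continuous hguc
    obtain ⟨Ru, hRu⟩ := hK.exists_bound_of_continuousOn hguc
    obtain ⟨Rv, hRv⟩ := hK.exists_bound_of_continuousOn hgvc
    obtain ⟨c, ε, hc, hε, hcS⟩ := exists_pos_le_of_pos_at_critical hBc hB.zero hf.continuous
      (hcl.symm ▸ hK) (hcl.symm ▸ hucK) hGu fun x hx _ => hfpos _ (hupos x (hKΩ (hcl ▸ hx)))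
    exact exists_small_domain_comparison hN hΩ hA hB.contDiffOn hf hu.1 hu2 hv.1 husol hvsol hKΩ
      (hcl.symm ▸ hK) (hcl.symm ▸ hucK) (hcl.symm ▸ hv.1.continuousOn.mono hKΩ) hGu
      (fun x hx => (hRu x hx).trans (le_max_left Ru Rv))
      (fun x hx => (hRv x hx).trans (le_max_right Ru Rv)) hc hε hcS
  · obtain ⟨huc, -, Cu, hCu⟩ := hu'
    obtain ⟨hvc, -, Cv, hCv⟩ := hv'
    have hS : IsCompact (closure Ω) := hbd.isCompact_closure
    have hGu := hCu.uniformContinuousOn hα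
    obtain ⟨Ru, hRu⟩ := hCu.exists_norm_le_of_isBounded hbd
    obtain ⟨Rv, hRv⟩ := hCv.exists_norm_le_of_isBounded hbd
    obtain ⟨c, ε, hc, hε, hcS⟩ := exists_pos_le_of_pos_at_critical hBc hB.zero hf.continuous
      hS huc hGu fun x hx hlim => by
        refine hfpos _ ?_
        by_cases hxΩ : x ∈ Ω
        · exact hupos x hxΩ
        · have hfr : x ∈ frontier Ω := by rw [hΩ.frontier_eq]; exact ⟨hx, hxΩ⟩
          -- Continuity gives `u ≥ 0` up to the boundary, and the hypothesis on the boundary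
          -- excludes `u x = 0` when the gradient tends to zero.
          have h0 : 0 ≤ u x := (isClosed_Ici (a := (0 : ℝ))).closure_subset_iff.2
            (image_subset_iff.2 fun y hy => (hupos y hy).le) (huc.image_closure ⟨x, hx, rfl⟩)
          exact h0.lt_of_ne fun h => hcrit x hfr h.symm hlim
    exact exists_small_domain_comparison hN hΩ hA hB.contDiffOn hf hu.1 hu2 hv.1 husol hvsol
      Subset.rfl hS huc hvc hGu
      (fun x hx => (hRu x hx).trans (le_max_left Ru Rv))
      (fun x hx => (hRv x hx).trans (le_max_right Ru Rv)) hc hε hcS
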